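/- **Setting.** Let $\theta\in\{1,-1\}$, let $p,q,n\ge 0$ be integers, $m=p+q$. The Yangian $\mathrm Y(\mathfrak{gl}_n)$ is the unital associative $\mathbb C$-algebra generated by $T_{ij}^{(1)},T_{ij}^{(2)},\dots$ ($1\le i,j\le n$) with the relations $$(u-v)\,[T_{ij}(u),T_{kl}(v)]=T_{kj}(u)T_{il}(v)-T_{kj}(v)T_{il}(u),\qquad T_{ij}(u)=\delta_{ij}+\sum_{r\ge1}T_{ij}^{(r)}u^{-r}.$$ It acts on tensor products of modules through $\Delta: T_{ij}(u)\mapsto\sum_k T_{ik}(u)\otimes T_{kj}(u)$; an empty tensor product is $\mathbb C$ with $T_{ij}(u)\mapsto\delta_{ij}$. Let $\mathcal H(\mathbb C^m\otimes\mathbb C^n)$ be the polynomial algebra (if $\theta=1$) or the Grassmann algebra (if $\theta=-1$) over $\mathbb C$ in the variables $x_{ai}$ ($1\le a\le m$, $1\le i\le n$), and let $\partial_{ai}$ be the corresponding (left) derivations. Put $p_{ai}=-\theta x_{ai}$, $q_{ai}=\partial_{ai}$ for $a\le p$, and $p_{ai}=\partial_{ai}$, $q_{ai}=x_{ai}$ for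 $a>p$. For a $\mathfrak{gl}_m$-module $V$ let $\mathcal E_{p,q}(V)=V\otimes\mathcal H(\mathbb C^m\otimes\mathbb C^n)$, on which $\mathfrak{gl}_m$ and $\mathrm Y(\mathfrak{gl}_n)$ act by the commuting actions $$E_{ab}\mapsto E_{ab}\otimes1+1\otimes\Bigl(\theta\,\delta_{ab}\tfrac n2+\sum_{k=1}^n q_{ak}p_{bk}\Bigr),\qquad T_{ij}(u)\mapsto\delta_{ij}+\sum_{a,b=1}^m X_{ab}(u)\otimes q_{ai}p_{bj},$$ where $X(u)=(u+\theta E')^{-1}$ and $E'$ is the $m\times m$ matrix with $a,b$ entry $E_{ba}$. For $z\in\mathbb C$ let $\mathcal E^z_{p,q}(V)$ be the same space with the same action of $\mathfrak{gl}_m$, on which $T_{ij}(u)$ acts in the way $T_{ij}(u-\theta z)$ acts on $\mathcal E_{p,q}(V)$. Let $\mathfrak n,\mathfrak n'\subset\mathfrak{gl}_m$ be spanned by the $E_{ba}$, respectively $E_{ab}$, with $a<b$, and let $\mathfrak h$ be spanned by $E_{11},\dots,E_{mm}$. For $\mu=(\mu_1,\dots,\mu_m)\in\mathbb C^m$ let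 $M_\mu$ be the Verma module of $\mathfrak{gl}_m$, generated by a vector killed by $\mathfrak n'$ on which $E_{aa}$ acts by $\mu_a$; in particular $M_t$, $t\in\mathbb C$, is the one-dimensional $\mathfrak{gl}_1$-module with $E_{11}\mapsto t$. Let $\mathcal E_{p,q}(M_\mu)_{\mathfrak n}=\mathcal E_{p,q}(M_\mu)/\mathfrak n\cdot\mathcal E_{p,q}(M_\mu)$ be the space of $\mathfrak n$-coinvariants, a bimodule over $\mathfrak h$ and $\mathrm Y(\mathfrak{gl}_n)$. **Statement.** (i) The bimodule $\mathcal E_{p,q}(M_\mu)_{\mathfrak n}$ over $\mathfrak h$ and $\mathrm Y(\mathfrak{gl}_n)$ is isomorphic to the tensor product $$\mathcal E_{1,0}(M_{\mu_1})\otimes\mathcal E^1_{1,0}(M_{\mu_2})\otimes\dots\otimes\mathcal E^{p-1}_{1,0}(M_{\mu_p})\otimes\mathcal E^{p}_{0,1}(M_{\mu_{p+1}})\otimes\dots\otimes\mathcal E^{m-1}_{0,1}(M_{\mu_m}),$$ where $E_{aa}\in\mathfrak h$ acts on the $a$-th factor as $E_{11}\in\mathfrak{gl}_1$. (ii) Put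 $\rho_a=1-a$. As a $\mathrm Y(\mathfrak{gl}_n)$-module, $\mathcal E_{p,q}(M_\mu)_{\mathfrak n}$ is isomorphic to $$\bigotimes_{a=1}^p\Omega^*_{\theta(\mu_a+\rho_a)}\otimes\bigotimes_{a=1}^p\Phi'_{\mu_a+\rho_a}\otimes\bigotimes_{a=p+1}^m\Phi_{\mu_a+\rho_a}.$$ Here $\Phi_z$ and $\Phi'_z$ are the space $\mathcal H(\mathbb C^n)$ in the variables $x_1,\dots,x_n$ with $$T_{ij}(u)\mapsto\delta_{ij}+\frac{x_i\partial_j}{u+\theta z},\qquad\text{respectively}\qquad T_{ij}(u)\mapsto\delta_{ij}-\frac{x_j\partial_i}{u+\theta(z-1)},$$ and $\Omega^*_z=\mathbb C$ with $T_{ij}(u)\mapsto\delta_{ij}\frac{u+z-1}{u+z}$ if $\theta=1$ and $T_{ij}(u)\mapsto\delta_{ij}\frac{u+z+1}{u+z}$ if $\theta=-1$. (iii) The modules $\Omega^*_z$, $z\in\mathbb C$, are cocentral: for every $\mathrm Y(\mathfrak{gl}_n)$-module $M$ the map $M\otimes\Omega^*_z\to\Omega^*_z\otimes M$, $w\otimes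 c\mapsto c\otimes w$, is an isomorphism of $\mathrm Y(\mathfrak{gl}_n)$-modules. -/

import Mathlib

open scoped TensorProduct

attribute [local instance] LieRing.ofAssociativeRing

namespace RationalYangian

noncomputable section

/-! ### The Yangian -/

/-- All coefficients `T^(0), T^(1), T^(2), …` of a series `T_ij(u) = δ_ij + ∑ T_ij^(r) u^(-r)`,
where `t r i j` is the coefficient `T_ij^(r+1)`. -/
def coeffT {A : Type*} [Ring A] {n : ℕ} (t : ℕ → Fin n → Fin n → A) : ℕ → Fin n → Fin n → A
  | 0, i, j => if i = j then 1 else 0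
  | r + 1, i, j => t r i j

/-- The relations
`(u - v) [T_ij(u), T_kl(v)] = T_kj(u) T_il(v) - T_kj(v) T_il(u)`,
written out at `u^(-r) v^(-s)` for all `r, s ≥ 0`
(at `u v^(-s)` and at `u^(-r) v` they are void, as `T_ij^(0) = δ_ij`). -/
def YangianRelations {A : Type*} [Ring A] {n : ℕ} (t : ℕ → Fin n → Fin n → A) : Prop :=
  ∀ (r s : ℕ) (i j k l : Fin n),
    (coeffT t (r + 1) i j * coeffT t s k l - coeffT t s k l * coeffT t (r + 1) i j)
      - (coeffT t r i j * coeffT t (s + 1) k l - coeffT t (s + 1) k l * coeffT t r i j)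
    = coeffT t r k j * coeffT t s i l - coeffT t s k j * coeffT t r i l

/-- The free generators; `(r, i, j)` stands for `T_ij^(r+1)`. -/
def freeT (n : ℕ) (r : ℕ) (i j : Fin n) : FreeAlgebra ℂ (ℕ × Fin n × Fin n) :=
  FreeAlgebra.ι ℂ (r, i, j)

/-- The defining relations of the Yangian in the free algebra. -/
inductive YangianRel (n : ℕ) :
    FreeAlgebra ℂ (ℕ × Fin n × Fin n) → FreeAlgebra ℂ (ℕ × Fin n × Fin n) → Prop
  | rtt (r s : ℕ) (i j k l : Fin n) : YangianRel n
      ((coeffT (freeT n) (r + 1) i j * coeffT (freeT n) s k l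
          - coeffT (freeT n) s k l * coeffT (freeT n) (r + 1) i j)
        - (coeffT (freeT n) r i j * coeffT (freeT n) (s + 1) k l
          - coeffT (freeT n) (s + 1) k l * coeffT (freeT n) r i j))
      (coeffT (freeT n) r k j * coeffT (freeT n) s i l
        - coeffT (freeT n) s k j * coeffT (freeT n) r i l)

/-- The Yangian `Y(gl_n)` over `ℂ`. -/
def Yangian (n : ℕ) : Type := RingQuot (YangianRel n)

instance (n : ℕ) : Ring (Yangian n) := inferInstanceAs (Ring (RingQuot (YangianRel n)))

instance (n : ℕ) : Algebra ℂ (Yangian n) :=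
  inferInstanceAs (Algebra ℂ (RingQuot (YangianRel n)))

/-- The quotient map onto the Yangian. -/
def Yangian.mk (n : ℕ) : FreeAlgebra ℂ (ℕ × Fin n × Fin n) →ₐ[ℂ] Yangian n :=
  RingQuot.mkAlgHom ℂ (YangianRel n)

/-- The generator `T_ij^(r+1)` of the Yangian. -/
def Yangian.gen (n : ℕ) (r : ℕ) (i j : Fin n) : Yangian n :=
  Yangian.mk n (freeT n r i j)

theorem map_coeffT {A B F : Type*} [Ring A] [Ring B] [FunLike F A B] [RingHomClass F A B] {n : ℕ}
    (f : F) (t : ℕ → Fin n → Fin n → A) (r : ℕ) (i j : Fin n) :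
    f (coeffT t r i j) = coeffT (fun r i j => f (t r i j)) r i j := by
  cases r with
  | zero => simp only [coeffT]; split <;> simp
  | succ r => rfl

theorem YangianRelations.map {A B F : Type*} [Ring A] [Ring B] [FunLike F A B] [RingHomClass F A B]
    {n : ℕ} (f : F) {t : ℕ → Fin n → Fin n → A} (h : YangianRelations t) :
    YangianRelations (fun r i j => f (t r i j)) := by
  intro r s i j k l
  simpa only [map_sub, map_mul, map_coeffT] using congrArg f (h r s i j k l)

theorem Yangian.relations (n : ℕ) : YangianRelations (Yangian.gen n) := by
  intro r s i j k l
  have h : Yangian.mk n _ = Yangian.mk n _ :=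
    RingQuot.mkAlgHom_rel ℂ (YangianRel.rtt (n := n) r s i j k l)
  simp only [map_sub, map_mul, map_coeffT] at h
  exact h

/-- A family of elements that satisfies the defining relations gives a homomorphism from the
Yangian. -/
def Yangian.lift {A : Type*} [Ring A] [Algebra ℂ A] {n : ℕ} (t : ℕ → Fin n → Fin n → A)
    (h : YangianRelations t) : Yangian n →ₐ[ℂ] A :=
  RingQuot.liftAlgHom ℂ ⟨FreeAlgebra.lift ℂ (fun x => t x.1 x.2.1 x.2.2), by
    rintro x y ⟨r, s, i, j, k, l⟩
    have h' := h r s i j k l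
    simpa only [map_sub, map_mul, map_coeffT, freeT, FreeAlgebra.lift_ι_apply] using h'⟩

theorem Yangian.lift_gen {A : Type*} [Ring A] [Algebra ℂ A] {n : ℕ} (t : ℕ → Fin n → Fin n → A)
    (h : YangianRelations t) (r : ℕ) (i j : Fin n) :
    Yangian.lift t h (Yangian.gen n r i j) = t r i j := by
  refine (RingQuot.liftAlgHom_mkAlgHom_apply ℂ _ _ (freeT n r i j)).trans ?_
  simp [freeT]

theorem Yangian.hom_ext {A : Type*} [Ring A] [Algebra ℂ A] {n : ℕ} {f g : Yangian n →ₐ[ℂ] A}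
    (h : ∀ r i j, f (Yangian.gen n r i j) = g (Yangian.gen n r i j)) : f = g := by
  refine RingQuot.ringQuot_ext' (S := ℂ) _ _ ?_
  refine FreeAlgebra.hom_ext (funext fun x => ?_)
  exact h x.1 x.2.1 x.2.2

/-- Anything that commutes with the images of the generators commutes with the whole image. -/
theorem Yangian.commute_of_gen {A : Type*} [Ring A] [Algebra ℂ A] {n : ℕ} (f : Yangian n →ₐ[ℂ] A)
    (a : A) (h : ∀ r i j, Commute a (f (Yangian.gen n r i j))) (y : Yangian n) :
    Commute a (f y) := by
  obtain ⟨x, rfl⟩ : ∃ x, Yangian.mk n x = y := RingQuot.mkAlgHom_surjective ℂ (YangianRel n) y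
  induction x using FreeAlgebra.induction with
  | grade0 c => 
    simp only [AlgHom.commutes]
    exact (Algebra.commutes c a).symm
  | grade1 x => exact h x.1 x.2.1 x.2.2
  | mul x y hx hy => simpa only [map_mul] using hx.mul_right hy
  | add x y hx hy => simpa only [map_add] using hx.add_right hy

/-- The relations in terms of the coefficients `T^(1), T^(2), …` only. -/
theorem yangianRelations_of {A : Type*} [Ring A] {n : ℕ} {t : ℕ → Fin n → Fin n → A}
    (h0 : ∀ s i j k l, t 0 i j * t s k l - t s k l * t 0 i j
      = (if k = j then t s i l else 0) - (if i = l then t s k j else 0))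
    (h1 : ∀ r s i j k l,
      (t (r + 1) i j * t s k l - t s k l * t (r + 1) i j)
        - (t r i j * t (s + 1) k l - t (s + 1) k l * t r i j)
      = t r k j * t s i l - t s k j * t r i l) : YangianRelations t := by
  intro r s i j k l
  match r, s with
  | 0, 0 => simp only [coeffT]; split_ifs <;> simp
  | 0, s + 1 =>
    have := h0 s i j k l
    simp only [coeffT]
    split_ifs at this ⊢ <;> simp_all
  | r + 1, 0 =>
    have := h0 r k l i j
    simp only [coeffT]
    split_ifs at this ⊢ <;> simp_all
  | r + 1, s + 1 => exact h1 r s i j k l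

theorem YangianRelations.zero {A : Type*} [Ring A] {n : ℕ} {t : ℕ → Fin n → Fin n → A}
    (h : YangianRelations t) (s : ℕ) (i j k l : Fin n) : t 0 i j * t s k l - t s k l * t 0 i j
      = (if k = j then t s i l else 0) - (if i = l then t s k j else 0) := by
  have := h 0 (s + 1) i j k l
  simp only [coeffT] at this
  split_ifs at this ⊢ <;> simp_all

theorem YangianRelations.succ {A : Type*} [Ring A] {n : ℕ} {t : ℕ → Fin n → Fin n → A}
    (h : YangianRelations t) (r s : ℕ) (i j k l : Fin n) :
      (t (r + 1) i j * t s k l - t s k l * t (r + 1) i j)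
        - (t r i j * t (s + 1) k l - t (s + 1) k l * t r i j)
      = t r k j * t s i l - t s k j * t r i l := h (r + 1) (s + 1) i j k l

/-! #### Counit, evaluation, shift -/

/-- The counit `T_ij(u) ↦ δ_ij`. -/
def Yangian.counit (n : ℕ) : Yangian n →ₐ[ℂ] ℂ :=
  Yangian.lift (fun _ _ _ => 0) (yangianRelations_of (by simp) (by simp))

/-- The relations `[e_ij, e_kl] = δ_jk e_il - δ_il e_kj` of the matrix units of `gl_n`. -/
def GlRelations {A : Type*} [Ring A] {n : ℕ} (e : Fin n → Fin n → A) : Prop :=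
  ∀ i j k l, e i j * e k l - e k l * e i j
    = (if k = j then e i l else 0) - (if i = l then e k j else 0)

/-- The evaluation homomorphism `T_ij(u) ↦ δ_ij + e_ij / (u + w)`, that is
`T_ij^(r+1) ↦ (-w)^r e_ij`, for elements `e_ij` that satisfy the commutation relations
of the matrix units of `gl_n`. -/
def Yangian.evaluation {A : Type*} [Ring A] [Algebra ℂ A] {n : ℕ} (e : Fin n → Fin n → A)
    (he : GlRelations e) (w : ℂ) : Yangian n →ₐ[ℂ] A :=
  Yangian.lift (fun r i j => (-w) ^ r • e i j) (yangianRelations_of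
    (by
      intro s i j k l
      have := congrArg (fun a => (-w) ^ s • a) (he i j k l)
      simp only [smul_sub, smul_ite, smul_zero] at this
      simpa [smul_mul_assoc, mul_smul_comm] using this)
    (by
      intro r s i j k l
      have h := he i j k l
      have e1 : e k j * e i l - e i l * e k j
          = (if i = j then e k l else 0) - (if k = l then e i j else 0) := he k j i l
      simp only [smul_mul_assoc, mul_smul_comm, smul_smul, pow_succ]
      rw [mul_comm ((-w) ^ s * -w) ((-w) ^ r), ← mul_assoc ((-w) ^ r) ((-w) ^ s),
        mul_comm ((-w) ^ s) ((-w) ^ r)]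
      have e2 : (-w) ^ r * -w * (-w) ^ s = (-w) ^ r * (-w) ^ s * -w := by ring
      have e3 : (-w) ^ s * ((-w) ^ r * -w) = (-w) ^ r * (-w) ^ s * -w := by ring
      rw [e2, e3]
      abel))

/-- `T[f]`, the value of the linear functional with `T[u^r] = T^(r+1)` at a polynomial `f`;
this is the residue of `f(u) T(u)`. -/
def residuePairing {A : Type*} [Ring A] [Algebra ℂ A] {n : ℕ} (t : ℕ → Fin n → Fin n → A)
    (i j : Fin n) : Polynomial ℂ →ₗ[ℂ] A :=
  Polynomial.lsum (fun r => LinearMap.toSpanSingleton ℂ A (t r i j))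

theorem residuePairing_monomial {A : Type*} [Ring A] [Algebra ℂ A] {n : ℕ}
    (t : ℕ → Fin n → Fin n → A) (i j : Fin n) (r : ℕ) (c : ℂ) :
    residuePairing t i j (Polynomial.monomial r c) = c • t r i j := by
  simp [residuePairing, Polynomial.lsum_apply, Polynomial.sum_monomial_index]

theorem residuePairing_X_pow {A : Type*} [Ring A] [Algebra ℂ A] {n : ℕ}
    (t : ℕ → Fin n → Fin n → A) (i j : Fin n) (r : ℕ) :
    residuePairing t i j (Polynomial.X ^ r) = t r i j := by
  rw [← Polynomial.monomial_one_right_eq_X_pow, residuePairing_monomial, one_smul]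

theorem residuePairing_zero {A : Type*} [Ring A] [Algebra ℂ A] {n : ℕ}
    {t : ℕ → Fin n → Fin n → A} (h : YangianRelations t) (g : Polynomial ℂ) (i j k l : Fin n) :
    t 0 i j * residuePairing t k l g - residuePairing t k l g * t 0 i j
      = (if k = j then residuePairing t i l g else 0)
        - (if i = l then residuePairing t k j g else 0) := by
  induction g using Polynomial.induction_on' with
  | add g g' h1 h2 =>
    simp only [map_add, mul_add, add_mul]
    rw [add_sub_add_comm, h1, h2]
    split_ifs <;> abel
  | monomial s c =>
    simp only [residuePairing_monomial, mul_smul_comm, smul_mul_assoc]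
    rw [← smul_sub, h.zero, smul_sub, smul_ite, smul_ite, smul_zero]

theorem residuePairing_succ {A : Type*} [Ring A] [Algebra ℂ A] {n : ℕ}
    {t : ℕ → Fin n → Fin n → A} (h : YangianRelations t) (f g : Polynomial ℂ) (i j k l : Fin n) :
    (residuePairing t i j (Polynomial.X * f) * residuePairing t k l g
        - residuePairing t k l g * residuePairing t i j (Polynomial.X * f))
      - (residuePairing t i j f * residuePairing t k l (Polynomial.X * g)
        - residuePairing t k l (Polynomial.X * g) * residuePairing t i j f)
      = residuePairing t k j f * residuePairing t i l g
        - residuePairing t k j g * residuePairing t i l f := by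
  induction f using Polynomial.induction_on' with
  | add f f' h1 h2 =>
    simp only [map_add, mul_add, add_mul]
    have := congrArg₂ (· + ·) h1 h2
    convert this using 1 <;> abel
  | monomial r c =>
  induction g using Polynomial.induction_on' with
  | add f f' h1 h2 =>
    simp only [map_add, mul_add, add_mul]
    have := congrArg₂ (· + ·) h1 h2
    convert this using 1 <;> abel
  | monomial s d =>
    simp only [Polynomial.X_mul_monomial, residuePairing_monomial, mul_smul_comm, smul_mul_assoc]
    simp only [smul_comm d c, ← smul_sub, h.succ]

/-- The automorphism `τ_z : T_ij(u) ↦ T_ij(u - z)`. Re-expanding `(u - z)^(-r)` in `u^(-1)`, the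
coefficient `T_ij^(s+1)` is sent to `∑_r (s choose r) z^(s-r) T_ij^(r+1)`, the residue of
`(u + z)^s T_ij(u)`. -/
def Yangian.shift (n : ℕ) (z : ℂ) : Yangian n →ₐ[ℂ] Yangian n :=
  Yangian.lift (fun s i j => ∑ r ∈ Finset.range (s + 1),
      (z ^ (s - r) * (s.choose r : ℂ)) • Yangian.gen n r i j) (by
    have key : (fun s i j => ∑ r ∈ Finset.range (s + 1),
        (z ^ (s - r) * (s.choose r : ℂ)) • Yangian.gen n r i j)
        = fun s i j => residuePairing (Yangian.gen n) i j
          ((Polynomial.X + Polynomial.C z) ^ s) := by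
      funext s i j
      rw [add_pow, map_sum]
      refine Finset.sum_congr rfl fun r _ => ?_
      have : (Polynomial.X ^ r * Polynomial.C z ^ (s - r) * (s.choose r : Polynomial ℂ))
          = (z ^ (s - r) * (s.choose r : ℂ)) • Polynomial.X ^ r := by
        rw [Polynomial.smul_eq_C_mul]
        simp only [map_mul, map_pow, map_natCast]
        ring
      rw [this, map_smul, residuePairing_X_pow]
    rw [key]
    have hr := Yangian.relations n
    refine yangianRelations_of ?_ ?_
    · intro s i j k l
      have h0 : residuePairing (Yangian.gen n) i j ((Polynomial.X + Polynomial.C z) ^ 0)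
          = Yangian.gen n 0 i j := by
        rw [pow_zero, ← pow_zero Polynomial.X, residuePairing_X_pow]
      simp only [h0]
      exact residuePairing_zero hr _ i j k l
    · intro r s i j k l
      rw [← residuePairing_succ hr]
      simp only [pow_succ', add_mul, map_add, ← Polynomial.smul_eq_C_mul, map_smul, mul_add,
        smul_mul_assoc, mul_smul_comm]
      abel)

/-! #### Comultiplication -/

/-- The coefficients of the matrix product `A(u) B(u)` of two matrices of series. -/
def prodT {A : Type*} [Ring A] {n : ℕ} (a b : ℕ → Fin n → Fin n → A) :
    ℕ → Fin n → Fin n → A :=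
  fun r i j => ∑ k, ∑ x ∈ Finset.HasAntidiagonal.antidiagonal (r + 1), coeffT a x.1 i k * coeffT b x.2 k j

theorem coeffT_prodT {A : Type*} [Ring A] {n : ℕ} (a b : ℕ → Fin n → Fin n → A)
    (r : ℕ) (i j : Fin n) : coeffT (prodT a b) r i j
      = ∑ k, ∑ x ∈ Finset.HasAntidiagonal.antidiagonal r, coeffT a x.1 i k * coeffT b x.2 k j := by
  cases r with
  | zero => simp [coeffT]
  | succ r => rfl

/-- The series `T_ij(x⁻¹)` in the outer variable `x` of `A⟦y⟧⟦x⟧`. -/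
def outerT {A : Type*} [Ring A] {n : ℕ} (t : ℕ → Fin n → Fin n → A) (i j : Fin n) :
    PowerSeries (PowerSeries A) :=
  PowerSeries.mk fun r => PowerSeries.C (coeffT t r i j)

/-- The series `T_ij(y⁻¹)` in the inner variable `y` of `A⟦y⟧⟦x⟧`. -/
def innerT {A : Type*} [Ring A] {n : ℕ} (t : ℕ → Fin n → Fin n → A) (i j : Fin n) :
    PowerSeries (PowerSeries A) :=
  PowerSeries.C (PowerSeries.mk fun s => coeffT t s i j)

theorem coeff_outer_inner {A : Type*} [Ring A] {n : ℕ} (t : ℕ → Fin n → Fin n → A)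
    (i j k l : Fin n) (r s : ℕ) :
    PowerSeries.coeff s (PowerSeries.coeff r (outerT t i j * innerT t k l))
      = coeffT t r i j * coeffT t s k l := by
  simp [outerT, innerT, PowerSeries.coeff_mul_C]

theorem coeff_inner_outer {A : Type*} [Ring A] {n : ℕ} (t : ℕ → Fin n → Fin n → A)
    (i j k l : Fin n) (r s : ℕ) :
    PowerSeries.coeff s (PowerSeries.coeff r (innerT t k l * outerT t i j))
      = coeffT t s k l * coeffT t r i j := by
  simp [outerT, innerT, PowerSeries.coeff_mul_C]

theorem yangianRelations_iff_series {A : Type*} [Ring A] {n : ℕ} (t : ℕ → Fin n → Fin n → A) :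
    YangianRelations t ↔ ∀ i j k l : Fin n,
      (PowerSeries.C PowerSeries.X - PowerSeries.X : PowerSeries (PowerSeries A))
          * (outerT t i j * innerT t k l - innerT t k l * outerT t i j)
        = (PowerSeries.X * PowerSeries.C PowerSeries.X : PowerSeries (PowerSeries A))
          * (outerT t k j * innerT t i l - innerT t k j * outerT t i l) := by
  constructor
  · intro h i j k l
    ext r s
    have h00 : ∀ s (i j k l : Fin n), coeffT t 0 i j * coeffT t s k l
        = coeffT t s k l * coeffT t 0 i j := by
      intro s i j k l
      simp only [coeffT]; split_ifs <;> simp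
    rcases r with _ | r <;> rcases s with _ | s <;>
      simp only [sub_mul, mul_assoc, mul_sub, map_sub, PowerSeries.coeff_C_mul,
        PowerSeries.coeff_succ_X_mul, PowerSeries.coeff_zero_X_mul, coeff_outer_inner,
        coeff_inner_outer, h00, map_zero, sub_self]
    rw [← h r s i j k l]
    abel
  · intro h r s i j k l
    have := congrArg (fun f => PowerSeries.coeff (s + 1) (PowerSeries.coeff (r + 1) f)) (h i j k l)
    simp only [sub_mul, mul_assoc, mul_sub, PowerSeries.coeff_C_mul,
      PowerSeries.coeff_succ_X_mul, map_sub, coeff_outer_inner, coeff_inner_outer] at this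
    rw [← this]
    abel

theorem matrix_product_relation {R : Type*} [Ring R] {n : ℕ} (c d : R)
    (hc : ∀ x : R, Commute c x) (hd : ∀ x : R, Commute d x) (a a' b b' : Fin n → Fin n → R)
    (ha : ∀ i j k l, c * (a i j * a' k l - a' k l * a i j)
      = d * (a k j * a' i l - a' k j * a i l))
    (hb : ∀ i j k l, c * (b i j * b' k l - b' k l * b i j)
      = d * (b k j * b' i l - b' k j * b i l))
    (hab' : ∀ i j k l, Commute (a i j) (b' k l))
    (ha'b : ∀ i j k l, Commute (a' i j) (b k l))
    (i j k l : Fin n) :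
    c * ((∑ e, a i e * b e j) * (∑ f, a' k f * b' f l)
        - (∑ f, a' k f * b' f l) * (∑ e, a i e * b e j))
      = d * ((∑ e, a k e * b e j) * (∑ f, a' i f * b' f l)
        - (∑ f, a' k f * b' f j) * (∑ e, a i e * b e l)) := by
  have key : ∀ e f, c * ((a i e * b e j) * (a' k f * b' f l) - (a' k f * b' f l) * (a i e * b e j))
      = d * ((a k e * b e j) * (a' i f * b' f l)) - d * (a' k e * a i f * (b e j * b' f l))
        + (d * (a' k f * a i e * (b f j * b' e l)) - d * ((a' k f * b' f j) * (a i e * b e l))) := by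
    intro e f
    calc c * ((a i e * b e j) * (a' k f * b' f l) - (a' k f * b' f l) * (a i e * b e j))
        = (c * (a i e * a' k f - a' k f * a i e)) * (b e j * b' f l)
          + (a' k f * a i e) * (c * (b e j * b' f l - b' f l * b e j)) := by
          rw [← mul_assoc (a' k f * a i e) c, ← (hc (a' k f * a i e)).eq, mul_assoc c,
            mul_assoc c (a' k f * a i e), ← mul_add]
          congr 1
          have e1 : (a i e * b e j) * (a' k f * b' f l) = a i e * a' k f * (b e j * b' f l) := by
            rw [mul_assoc, ← mul_assoc (b e j), ← (ha'b k f e j).eq]; simp only [mul_assoc]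
          have e2 : (a' k f * b' f l) * (a i e * b e j) = a' k f * a i e * (b' f l * b e j) := by
            rw [mul_assoc, ← mul_assoc (b' f l), ← (hab' i e f l).eq]; simp only [mul_assoc]
          rw [e1, e2, sub_mul, mul_sub]
          abel
      _ = _ := by
          rw [ha, hb, ← mul_assoc (a' k f * a i e) d, ← (hd (a' k f * a i e)).eq]
          have e1 : (a k e * b e j) * (a' i f * b' f l) = a k e * a' i f * (b e j * b' f l) := by
            rw [mul_assoc, ← mul_assoc (b e j), ← (ha'b i f e j).eq]; simp only [mul_assoc]
          have e2 : (a' k f * b' f j) * (a i e * b e l) = a' k f * a i e * (b' f j * b e l) := by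
            rw [mul_assoc, ← mul_assoc (b' f j), ← (hab' i e f j).eq]; simp only [mul_assoc]
          rw [e1, e2]
          simp only [mul_sub, sub_mul, mul_assoc]
  simp only [Finset.sum_mul_sum]
  rw [Finset.sum_comm (s := Finset.univ) (t := Finset.univ)
      (f := fun f e => a' k f * b' f l * (a i e * b e j)),
    Finset.sum_comm (s := Finset.univ) (t := Finset.univ)
      (f := fun f e => a' k f * b' f j * (a i e * b e l))]
  simp only [← Finset.sum_sub_distrib, Finset.mul_sum, key]
  simp only [Finset.sum_add_distrib, Finset.sum_sub_distrib, mul_sub]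
  rw [Finset.sum_comm (f := fun e f => d * (a' k f * a i e * (b f j * b' e l)))]
  abel

theorem YangianRelations.mulT {A : Type*} [Ring A] {n : ℕ} {a b : ℕ → Fin n → Fin n → A}
    (ha : YangianRelations a) (hb : YangianRelations b)
    (hab : ∀ r s i j k l, Commute (a r i j) (b s k l)) : YangianRelations (prodT a b) := by
  rw [yangianRelations_iff_series] at ha hb ⊢
  have hC : ∀ r s i j k l, Commute (coeffT a r i j) (coeffT b s k l) := by
    intro r s i j k l
    cases r <;> cases s <;> simp only [coeffT] <;> (try split_ifs) <;> simp [hab]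
  have ho : ∀ i j, outerT (prodT a b) i j
      = ∑ k, outerT a i k * outerT b k j := by
    intro i j
    ext r : 1
    simp only [outerT, PowerSeries.coeff_mk, map_sum, PowerSeries.coeff_mul, coeffT_prodT, map_mul]
  have hi : ∀ i j, innerT (prodT a b) i j
      = ∑ k, innerT a i k * innerT b k j := by
    intro i j
    simp only [innerT, ← map_mul, ← map_sum]
    congr 1
    ext s
    simp only [PowerSeries.coeff_mk, map_sum, PowerSeries.coeff_mul, coeffT_prodT]
  have hX : ∀ f : PowerSeries (PowerSeries A), Commute (PowerSeries.C PowerSeries.X) f := by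
    intro f
    ext r s
    rw [PowerSeries.coeff_C_mul, PowerSeries.coeff_mul_C]
    rw [((PowerSeries.coeff r f).commute_X).eq]
  intro i j k l
  simp only [ho, hi]
  refine matrix_product_relation _ _ (fun x => (hX x).sub_left x.commute_X.symm)
    (fun x => x.commute_X.symm.mul_left (hX x)) _ _ _ _ ha hb ?_ ?_ i j k l
  · intro i j k l
    ext r s
    simp [outerT, innerT, PowerSeries.coeff_mul_C, (hC _ _ _ _ _ _).eq]
  · intro i j k l
    ext r s
    simp [outerT, innerT, PowerSeries.coeff_mul_C, (hC _ _ _ _ _ _).eq]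

/-- The comultiplication `T_ij(u) ↦ ∑_k T_ik(u) ⊗ T_kj(u)`. -/
def Yangian.comul (n : ℕ) : Yangian n →ₐ[ℂ] Yangian n ⊗[ℂ] Yangian n :=
  Yangian.lift (fun r i j => ∑ k, ∑ x ∈ Finset.HasAntidiagonal.antidiagonal (r + 1),
      coeffT (Yangian.gen n) x.1 i k ⊗ₜ[ℂ] coeffT (Yangian.gen n) x.2 k j) (by
    have h := YangianRelations.mulT
      ((Yangian.relations n).map
        (Algebra.TensorProduct.includeLeft : Yangian n →ₐ[ℂ] Yangian n ⊗[ℂ] Yangian n))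
      ((Yangian.relations n).map
        (Algebra.TensorProduct.includeRight : Yangian n →ₐ[ℂ] Yangian n ⊗[ℂ] Yangian n))
      (by intro r s i j k l; simp [Commute, SemiconjBy])
    convert h using 1
    funext r i j
    refine Finset.sum_congr rfl fun k _ => Finset.sum_congr rfl fun x _ => ?_
    rw [← map_coeffT (Algebra.TensorProduct.includeLeft : Yangian n →ₐ[ℂ] Yangian n ⊗[ℂ] Yangian n),
      ← map_coeffT (Algebra.TensorProduct.includeRight : Yangian n →ₐ[ℂ] Yangian n ⊗[ℂ] Yangian n)]
    simp)

/-! ### Polynomial and Grassmann algebras, and their differential operators -/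

/-- The two cases `θ = 1` (commuting variables) and `θ = -1` (anticommuting variables). -/
inductive Statistics : Type
  | commuting
  | anticommuting

/-- The sign `θ`. -/
def Statistics.sign : Statistics → ℂ
  | .commuting => 1
  | .anticommuting => -1

theorem Statistics.sign_mul_sign (θ : Statistics) : θ.sign * θ.sign = 1 := by
  cases θ <;> simp [Statistics.sign]

/-- The algebra `H(ℂ^m ⊗ ℂ^n)` in the variables `x_ai`: polynomials if `θ = 1`, the Grassmann
algebra if `θ = -1`. -/
def HAlg : Statistics → ℕ → ℕ → Type
  | .commuting, m, n => MvPolynomial (Fin m × Fin n) ℂ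
  | .anticommuting, m, n => ExteriorAlgebra ℂ (Fin m × Fin n → ℂ)

instance : (θ : Statistics) → (m n : ℕ) → Ring (HAlg θ m n)
  | .commuting, m, n => inferInstanceAs (Ring (MvPolynomial (Fin m × Fin n) ℂ))
  | .anticommuting, m, n => inferInstanceAs (Ring (ExteriorAlgebra ℂ (Fin m × Fin n → ℂ)))

instance : (θ : Statistics) → (m n : ℕ) → Algebra ℂ (HAlg θ m n)
  | .commuting, m, n => inferInstanceAs (Algebra ℂ (MvPolynomial (Fin m × Fin n) ℂ))
  | .anticommuting, m, n => inferInstanceAs (Algebra ℂ (ExteriorAlgebra ℂ (Fin m × Fin n → ℂ)))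

/-- The operator of left multiplication by the variable `x_ai`. -/
def opX : (θ : Statistics) → (m n : ℕ) → Fin m → Fin n → Module.End ℂ (HAlg θ m n)
  | .commuting, m, n, a, i =>
      LinearMap.mulLeft ℂ (MvPolynomial.X (a, i) : MvPolynomial (Fin m × Fin n) ℂ)
  | .anticommuting, m, n, a, i =>
      LinearMap.mulLeft ℂ (ExteriorAlgebra.ι ℂ (Pi.single (a, i) 1 : Fin m × Fin n → ℂ))

/-- The (left) derivation `∂_ai` with respect to `x_ai`. In the Grassmann algebra it is the
contraction with the coordinate functional dual to `x_ai`. -/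
def opD : (θ : Statistics) → (m n : ℕ) → Fin m → Fin n → Module.End ℂ (HAlg θ m n)
  | .commuting, m, n, a, i =>
      (MvPolynomial.pderiv (R := ℂ) ((a, i) : Fin m × Fin n)).toLinearMap
  | .anticommuting, m, n, a, i =>
      CliffordAlgebra.contractLeft (Q := (0 : QuadraticForm ℂ (Fin m × Fin n → ℂ)))
        (LinearMap.proj (R := ℂ) (φ := fun _ : Fin m × Fin n => ℂ) (a, i))

/-- The relations `q_ai q_bj = θ q_bj q_ai`, `p_ai p_bj = θ p_bj p_ai`,
`p_ai q_bj - θ q_bj p_ai = δ_ab δ_ij`. -/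
structure OscillatorRelations {A : Type*} [Ring A] [Algebra ℂ A] (θ : ℂ) {m n : ℕ}
    (q p : Fin m → Fin n → A) : Prop where
  qq : ∀ a b i j, q a i * q b j = θ • (q b j * q a i)
  pp : ∀ a b i j, p a i * p b j = θ • (p b j * p a i)
  pq : ∀ a b i j, p a i * q b j - θ • (q b j * p a i) = if a = b ∧ i = j then 1 else 0

theorem opX_opD_relations (θ : Statistics) (m n : ℕ) :
    OscillatorRelations θ.sign (opX θ m n) (opD θ m n) := by
  cases θ with
  | commuting =>
    refine ⟨?_, ?_, ?_⟩
    · intro a b i j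
      simp only [Statistics.sign, one_smul]
      refine LinearMap.ext fun (f : MvPolynomial (Fin m × Fin n) ℂ) => ?_
      exact mul_left_comm (MvPolynomial.X (a, i) : MvPolynomial (Fin m × Fin n) ℂ)
        (MvPolynomial.X (b, j)) f
    · intro a b i j
      simp only [Statistics.sign, one_smul]
      refine LinearMap.ext fun (f : MvPolynomial (Fin m × Fin n) ℂ) => ?_
      have h : ⁅MvPolynomial.pderiv (R := ℂ) ((a, i) : Fin m × Fin n),
          MvPolynomial.pderiv (R := ℂ) ((b, j) : Fin m × Fin n)⁆ = 0 := by
        refine MvPolynomial.derivation_ext fun s => ?_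
        simp [Derivation.commutator_apply, MvPolynomial.pderiv_X, Pi.single_apply, apply_ite]
      have h' := congrArg (fun D => D f) h
      simp only [Derivation.commutator_apply, Derivation.zero_apply] at h'
      exact sub_eq_zero.mp h'
    · intro a b i j
      simp only [Statistics.sign, one_smul]
      refine LinearMap.ext fun (f : MvPolynomial (Fin m × Fin n) ℂ) => ?_
      change MvPolynomial.pderiv (a, i) (MvPolynomial.X (b, j) * f)
        - MvPolynomial.X (b, j) * MvPolynomial.pderiv (a, i) f = _
      rw [Derivation.leibniz, MvPolynomial.pderiv_X]
      by_cases h : a = b ∧ i = j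
      · obtain ⟨rfl, rfl⟩ := h
        simp
        rfl
      · rw [if_neg h, Pi.single_eq_of_ne (by simpa [Prod.ext_iff, eq_comm] using h)]
        simp
        rfl
  | anticommuting =>
    refine ⟨?_, ?_, ?_⟩
    · intro a b i j
      refine LinearMap.ext fun (f : ExteriorAlgebra ℂ (Fin m × Fin n → ℂ)) => ?_
      have h := ExteriorAlgebra.ι_add_mul_swap (R := ℂ)
        (Pi.single (a, i) 1 : Fin m × Fin n → ℂ) (Pi.single (b, j) 1)
      have h' := congrArg (· * f) (eq_neg_of_add_eq_zero_left h)
      simp only [neg_mul, mul_assoc] at h'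
      simp only [Statistics.sign, neg_smul, one_smul]
      exact h'
    · intro a b i j
      refine LinearMap.ext fun (f : ExteriorAlgebra ℂ (Fin m × Fin n → ℂ)) => ?_
      simp only [Statistics.sign, neg_smul, one_smul]
      exact CliffordAlgebra.contractLeft_comm _ _ f
    · intro a b i j
      refine LinearMap.ext fun (f : ExteriorAlgebra ℂ (Fin m × Fin n → ℂ)) => ?_
      simp only [Statistics.sign, neg_smul, one_smul, sub_neg_eq_add]
      have h := CliffordAlgebra.contractLeft_ι_mul
        (Q := (0 : QuadraticForm ℂ (Fin m × Fin n → ℂ)))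
        (LinearMap.proj (R := ℂ) (φ := fun _ : Fin m × Fin n => ℂ) (a, i))
        (Pi.single (b, j) 1) f
      rw [eq_sub_iff_add_eq] at h
      refine h.trans ?_
      by_cases h : a = b ∧ i = j
      · obtain ⟨rfl, rfl⟩ := h
        simp
        rfl
      · rw [if_neg h, LinearMap.proj_apply, Pi.single_eq_of_ne (by simpa [Prod.ext_iff] using h)]
        simp
        rfl

/-- The algebra `HD(ℂ^m ⊗ ℂ^n)` of operators on `H(ℂ^m ⊗ ℂ^n)` generated by all `x_ai`
and `∂_ai`. -/
def HDAlg (θ : Statistics) (m n : ℕ) : Subalgebra ℂ (Module.End ℂ (HAlg θ m n)) :=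
  Algebra.adjoin ℂ (Set.range (fun s : Fin m × Fin n => opX θ m n s.1 s.2)
    ∪ Set.range (fun s : Fin m × Fin n => opD θ m n s.1 s.2))

/-- `x_ai` as an element of `HD`. -/
def hdX (θ : Statistics) (m n : ℕ) (a : Fin m) (i : Fin n) : HDAlg θ m n :=
  ⟨opX θ m n a i, Algebra.subset_adjoin (Or.inl ⟨(a, i), rfl⟩)⟩

/-- `∂_ai` as an element of `HD`. -/
def hdD (θ : Statistics) (m n : ℕ) (a : Fin m) (i : Fin n) : HDAlg θ m n :=
  ⟨opD θ m n a i, Algebra.subset_adjoin (Or.inr ⟨(a, i), rfl⟩)⟩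

/-- The coordinates `q_ci`: `∂_ci` for the first `p` indices `c`, and `x_ci` for the others. -/
def hdQ (θ : Statistics) (p q n : ℕ) (c : Fin (p + q)) (i : Fin n) : HDAlg θ (p + q) n :=
  if (c : ℕ) < p then hdD θ (p + q) n c i else hdX θ (p + q) n c i

/-- The coordinates `p_ci`: `-θ x_ci` for the first `p` indices `c`, and `∂_ci` for the others. -/
def hdP (θ : Statistics) (p q n : ℕ) (c : Fin (p + q)) (i : Fin n) : HDAlg θ (p + q) n :=
  if (c : ℕ) < p then -(θ.sign • hdX θ (p + q) n c i) else hdD θ (p + q) n c i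

theorem hdX_hdD_relations (θ : Statistics) (m n : ℕ) :
    OscillatorRelations θ.sign (hdX θ m n) (hdD θ m n) := by
  have h := opX_opD_relations θ m n
  refine ⟨fun a b i j => Subtype.ext (h.qq a b i j), fun a b i j => Subtype.ext (h.pp a b i j),
    fun a b i j => Subtype.ext ((h.pq a b i j).trans ?_)⟩
  split_ifs <;> rfl

theorem OscillatorRelations.twist {A : Type*} [Ring A] [Algebra ℂ A] {θ : ℂ} (hs : θ * θ = 1)
    {m n : ℕ} {x d : Fin m → Fin n → A} (h : OscillatorRelations θ x d) (P : Fin m → Prop)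
    [DecidablePred P] : OscillatorRelations θ (fun c i => if P c then d c i else x c i)
      (fun c i => if P c then -(θ • x c i) else d c i) := by
  refine ⟨?_, ?_, ?_⟩
  · intro a b i j
    have h1 := h.pq a b i j
    have h2 := h.pq b a j i
    split_ifs with ha hb hb
    · exact h.pp a b i j
    · have : ¬ (a = b ∧ i = j) := by rintro ⟨rfl, -⟩; exact hb ha
      rw [if_neg this, sub_eq_zero] at h1
      exact h1
    · have : ¬ (b = a ∧ j = i) := by rintro ⟨rfl, -⟩; exact ha hb
      rw [if_neg this, sub_eq_zero] at h2
      rw [h2, smul_smul, hs, one_smul]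
    · exact h.qq a b i j
  · intro a b i j
    have h1 := h.pq a b i j
    have h2 := h.pq b a j i
    split_ifs with ha hb hb
    · have := h.qq a b i j
      simp only [neg_mul_neg, smul_mul_smul_comm, hs, one_smul]
      exact this
    · have : ¬ (b = a ∧ j = i) := by rintro ⟨rfl, -⟩; exact hb ha
      rw [if_neg this, sub_eq_zero] at h2
      simp only [neg_mul, mul_neg, smul_mul_assoc, mul_smul_comm, h2, smul_neg]
      rw [smul_smul θ θ, hs, one_smul]
    · have : ¬ (a = b ∧ i = j) := by rintro ⟨rfl, -⟩; exact ha hb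
      rw [if_neg this, sub_eq_zero] at h1
      simp only [neg_mul, mul_neg, smul_mul_assoc, mul_smul_comm, h1, smul_neg]
    · exact h.pp a b i j
  · intro a b i j
    have h1 := h.pq a b i j
    have h2 := h.pq b a j i
    by_cases ha : P a <;> by_cases hb : P b
    · simp only [if_pos ha, if_pos hb, neg_mul, mul_neg, smul_mul_assoc, mul_smul_comm, smul_neg,
        smul_smul, hs, one_smul]
      rw [sub_neg_eq_add, neg_add_eq_sub, h2]
      simp only [eq_comm]
    · have : ¬ (a = b ∧ i = j) := by rintro ⟨rfl, -⟩; exact hb ha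
      have h3 := h.qq a b i j
      simp only [if_pos ha, if_neg hb, if_neg this, neg_mul, mul_neg, smul_mul_assoc,
        mul_smul_comm, smul_neg, h3, sub_neg_eq_add, neg_add_cancel]
    · have : ¬ (a = b ∧ i = j) := by rintro ⟨rfl, -⟩; exact ha hb
      simp only [if_neg ha, if_pos hb, if_neg this, h.pp a b i j, sub_self]
    · simpa only [if_neg ha, if_neg hb] using h1

theorem hdQ_hdP_relations (θ : Statistics) (p q n : ℕ) :
    OscillatorRelations θ.sign (hdQ θ p q n) (hdP θ p q n) :=
  (hdX_hdD_relations θ (p + q) n).twist θ.sign_mul_sign (fun c => (c : ℕ) < p)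

/-! ### The algebra `U(gl_m)` and the matrix `X(u)` -/

/-- The universal enveloping algebra `U(gl_m)`. -/
abbrev Ugl (m : ℕ) : Type := UniversalEnvelopingAlgebra ℂ (Matrix (Fin m) (Fin m) ℂ)

/-- The matrix unit `E_ab` as an element of `U(gl_m)`. -/
def glE (m : ℕ) (a b : Fin m) : Ugl m :=
  UniversalEnvelopingAlgebra.ι ℂ (Matrix.single a b (1 : ℂ))

theorem glE_relations (m : ℕ) : GlRelations (glE m) := by
  intro a b c d
  have h := (UniversalEnvelopingAlgebra.ι ℂ (L := Matrix (Fin m) (Fin m) ℂ)).map_lie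
    (Matrix.single a b (1 : ℂ)) (Matrix.single c d (1 : ℂ))
  rw [LieRing.of_associative_ring_bracket, LieRing.of_associative_ring_bracket] at h
  rw [glE, glE, ← h, map_sub]
  congr 1
  · by_cases hbc : b = c
    · subst hbc; simp [glE]
    · rw [Matrix.single_mul_single_of_ne (h := hbc), map_zero, if_neg (Ne.symm hbc)]
  · by_cases had : d = a
    · subst had; simp [glE]
    · rw [Matrix.single_mul_single_of_ne (h := had), map_zero, if_neg (Ne.symm had)]

/-- The matrix `-θ E'`, where `E'` is the transpose of the matrix `(E_ab)`. As
`X(u) = (u + θ E')⁻¹ = ∑_r (-θ E')^r u^(-r-1)`, the coefficient of `X(u)` at `u^(-r-1)` is the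
`r`-th power of this matrix. -/
def Xmat (θ : ℂ) (m : ℕ) : Matrix (Fin m) (Fin m) (Ugl m) :=
  Matrix.of fun a b => -(θ • glE m b a)

theorem Xmat_apply (θ : ℂ) (m : ℕ) (a b : Fin m) : Xmat θ m a b = -(θ • glE m b a) := rfl

theorem glE_comm_Xmat (θ : ℂ) (m : ℕ) (a b c d : Fin m) :
    glE m c d * Xmat θ m a b - Xmat θ m a b * glE m c d
      = (if b = d then Xmat θ m a c else 0) - (if a = c then Xmat θ m d b else 0) := by
  have h := congrArg (fun x => -(θ • x)) (glE_relations m c d b a)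
  simp only [smul_sub, smul_ite, smul_zero, neg_sub] at h
  simp only [Xmat_apply, mul_neg, neg_mul, mul_smul_comm, smul_mul_assoc, sub_neg_eq_add]
  have e : (c = a) = (a = c) := propext eq_comm
  rw [neg_add_eq_sub, h]
  simp only [e]
  split_ifs <;> abel

theorem glE_comm_Xmat_pow (θ : ℂ) (m : ℕ) (r : ℕ) (a b c d : Fin m) :
    glE m c d * (Xmat θ m ^ r) a b - (Xmat θ m ^ r) a b * glE m c d
      = (if b = d then (Xmat θ m ^ r) a c else 0) - (if a = c then (Xmat θ m ^ r) d b else 0) := by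
  induction r generalizing a b with
  | zero =>
    simp only [pow_zero, Matrix.one_apply]
    have e : (d = b) = (b = d) := propext eq_comm
    simp only [e, mul_ite, ite_mul, mul_one, one_mul, mul_zero, zero_mul, sub_self]
    split_ifs <;> simp
  | succ r ih =>
    have hD : ∀ f, glE m c d * ((Xmat θ m ^ r) a f * Xmat θ m f b)
        - ((Xmat θ m ^ r) a f * Xmat θ m f b) * glE m c d
        = (glE m c d * (Xmat θ m ^ r) a f - (Xmat θ m ^ r) a f * glE m c d) * Xmat θ m f b
          + (Xmat θ m ^ r) a f * (glE m c d * Xmat θ m f b - Xmat θ m f b * glE m c d) := by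
      intro f
      simp only [sub_mul, mul_sub, mul_assoc]
      abel
    simp only [pow_succ, Matrix.mul_apply, Finset.mul_sum, Finset.sum_mul]
    rw [← Finset.sum_sub_distrib]
    simp only [hD, ih, glE_comm_Xmat, sub_mul, mul_sub, ite_mul, mul_ite, zero_mul, mul_zero,
      Finset.sum_add_distrib, Finset.sum_sub_distrib, Finset.sum_ite_eq', Finset.mem_univ, if_true]
    split_ifs <;> (simp; try abel)

theorem Xmat_comm_Xmat_pow (θ : ℂ) (m : ℕ) (s : ℕ) (a b c d : Fin m) :
    Xmat θ m a b * (Xmat θ m ^ s) c d - (Xmat θ m ^ s) c d * Xmat θ m a b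
      = θ • ((if c = b then (Xmat θ m ^ s) a d else 0)
        - (if a = d then (Xmat θ m ^ s) c b else 0)) := by
  have h := congrArg (fun x => -(θ • x)) (glE_comm_Xmat_pow θ m s c d b a)
  simp only [smul_sub] at h
  rw [Xmat_apply]
  simp only [mul_neg, neg_mul, mul_smul_comm, smul_mul_assoc, sub_neg_eq_add]
  have e : (d = a) = (a = d) := propext eq_comm
  rw [neg_add_eq_sub, ← neg_sub, h, smul_sub]
  simp only [e]
  abel

/-- The relation `(u - v) [X_ab(u), X_cd(v)] = θ (X_cb(u) X_ad(v) - X_cb(v) X_ad(u))`. -/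
theorem Xmat_pow_relation (θ : ℂ) (m : ℕ) (r s : ℕ) (a b c d : Fin m) :
    ((Xmat θ m ^ (r + 1)) a b * (Xmat θ m ^ s) c d - (Xmat θ m ^ s) c d * (Xmat θ m ^ (r + 1)) a b)
      - ((Xmat θ m ^ r) a b * (Xmat θ m ^ (s + 1)) c d
        - (Xmat θ m ^ (s + 1)) c d * (Xmat θ m ^ r) a b)
      = θ • ((Xmat θ m ^ r) c b * (Xmat θ m ^ s) a d
        - (Xmat θ m ^ s) c b * (Xmat θ m ^ r) a d) := by
  induction r generalizing a b c d with
  | zero =>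
    simp only [zero_add, pow_one, Xmat_comm_Xmat_pow, pow_zero, Matrix.one_apply]
    split_ifs <;> simp
  | succ r ih =>
    have hmul : ∀ k a b, (Xmat θ m ^ (k + 1)) a b
        = ∑ f, Xmat θ m a f * (Xmat θ m ^ k) f b := by
      intro k a b; rw [pow_succ', Matrix.mul_apply]
    have hD : ∀ k l, (Xmat θ m ^ (k + 1)) a b * (Xmat θ m ^ l) c d
        - (Xmat θ m ^ l) c d * (Xmat θ m ^ (k + 1)) a b
        = ∑ f, (Xmat θ m a f * ((Xmat θ m ^ k) f b * (Xmat θ m ^ l) c d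
            - (Xmat θ m ^ l) c d * (Xmat θ m ^ k) f b))
          + ∑ f, (Xmat θ m a f * (Xmat θ m ^ l) c d - (Xmat θ m ^ l) c d * Xmat θ m a f)
              * (Xmat θ m ^ k) f b := by
      intro k l
      rw [hmul k a b, Finset.sum_mul, Finset.mul_sum, ← Finset.sum_sub_distrib,
        ← Finset.sum_add_distrib]
      refine Finset.sum_congr rfl fun f _ => ?_
      simp only [sub_mul, mul_sub, mul_assoc]
      abel
    have hE : ∀ k l, ∑ f, Xmat θ m a f * ((Xmat θ m ^ k) c b * (Xmat θ m ^ l) f d)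
        = (Xmat θ m ^ k) c b * (Xmat θ m ^ (l + 1)) a d
          + θ • ((Xmat θ m ^ k) a b * (Xmat θ m ^ l) c d
            - if a = b then (Xmat θ m ^ (k + l)) c d else 0) := by
      intro k l
      have : ∀ f, Xmat θ m a f * ((Xmat θ m ^ k) c b * (Xmat θ m ^ l) f d)
          = (Xmat θ m ^ k) c b * (Xmat θ m a f * (Xmat θ m ^ l) f d)
            + (Xmat θ m a f * (Xmat θ m ^ k) c b - (Xmat θ m ^ k) c b * Xmat θ m a f)
              * (Xmat θ m ^ l) f d := by
        intro f; simp only [sub_mul, mul_assoc]; abel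
      simp only [this, Finset.sum_add_distrib, ← Finset.mul_sum, ← hmul, Xmat_comm_Xmat_pow,
        smul_mul_assoc, sub_mul, ite_mul, zero_mul, ← Finset.smul_sum, Finset.sum_sub_distrib,
        Finset.sum_ite_eq, Finset.mem_univ, if_true]
      congr 3
      split_ifs
      · rw [pow_add, Matrix.mul_apply]
      · simp
    have hF : ∀ k l, ∑ f, (Xmat θ m a f * (Xmat θ m ^ l) c d - (Xmat θ m ^ l) c d * Xmat θ m a f)
              * (Xmat θ m ^ k) f b
        = θ • ((Xmat θ m ^ l) a d * (Xmat θ m ^ k) c b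
            - if a = d then (Xmat θ m ^ (l + k)) c b else 0) := by
      intro k l
      simp only [Xmat_comm_Xmat_pow,
        smul_mul_assoc, sub_mul, ite_mul, zero_mul, ← Finset.smul_sum, Finset.sum_sub_distrib,
        Finset.sum_ite_eq, Finset.mem_univ, if_true]
      congr 2
      split_ifs
      · rw [pow_add, Matrix.mul_apply]
      · simp
    have hG : ∑ f, (Xmat θ m a f * ((Xmat θ m ^ (r + 1)) f b * (Xmat θ m ^ s) c d
            - (Xmat θ m ^ s) c d * (Xmat θ m ^ (r + 1)) f b))
          - ∑ f, (Xmat θ m a f * ((Xmat θ m ^ r) f b * (Xmat θ m ^ (s + 1)) c d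
            - (Xmat θ m ^ (s + 1)) c d * (Xmat θ m ^ r) f b))
        = θ • (∑ f, Xmat θ m a f * ((Xmat θ m ^ r) c b * (Xmat θ m ^ s) f d)
            - ∑ f, Xmat θ m a f * ((Xmat θ m ^ s) c b * (Xmat θ m ^ r) f d)) := by
      rw [← Finset.sum_sub_distrib, ← Finset.sum_sub_distrib, Finset.smul_sum]
      refine Finset.sum_congr rfl fun f _ => ?_
      rw [← mul_sub, ih, ← mul_sub, mul_smul_comm]
    rw [hD (r + 1) s, hD r (s + 1), add_sub_add_comm, hG, hF, hF, hE, hE, ← smul_sub, ← smul_add]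
    congr 1
    have h := ih c b a d
    rw [smul_sub] at h
    have e1 : s + 1 + r = s + (r + 1) := by ring
    rw [e1, add_comm s r]
    simp only [smul_sub]
    have h' : (Xmat θ m ^ (r + 1)) c b * (Xmat θ m ^ s) a d = _ := eq_add_of_sub_eq (eq_add_of_sub_eq h)
    rw [h']
    abel

/-! ### The homomorphisms `ζ_n` and `α_m` -/

section Oscillator

variable {A : Type*} [Ring A] [Algebra ℂ A] {θ : ℂ} {m n : ℕ} {q p : Fin m → Fin n → A}

theorem OscillatorRelations.comm (hs : θ * θ = 1) (h : OscillatorRelations θ q p)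
    (a b c d : Fin m) (i j k l : Fin n) :
    (q a i * p b j) * (q c k * p d l) - (q c k * p d l) * (q a i * p b j)
      = (if b = c ∧ j = k then q a i * p d l else 0)
        - (if d = a ∧ l = i then q c k * p b j else 0) := by
  have e1 : p b j * q c k = (if b = c ∧ j = k then 1 else 0) + θ • (q c k * p b j) :=
    eq_add_of_sub_eq (h.pq b c j k)
  have e2 : p d l * q a i = (if d = a ∧ l = i then 1 else 0) + θ • (q a i * p d l) :=
    eq_add_of_sub_eq (h.pq d a l i)
  have e3 : q a i * (q c k * (p b j * p d l)) = q c k * (q a i * (p d l * p b j)) := by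
    rw [← mul_assoc, h.qq a c i k, h.pp b d j l, smul_mul_smul_comm, hs, one_smul, mul_assoc]
  calc (q a i * p b j) * (q c k * p d l) - (q c k * p d l) * (q a i * p b j)
      = q a i * ((p b j * q c k) * p d l) - q c k * ((p d l * q a i) * p b j) := by
        simp only [mul_assoc]
    _ = _ := by
        rw [e1, e2]
        simp only [add_mul, mul_add, smul_mul_assoc, mul_smul_comm, mul_assoc, e3, ite_mul, mul_ite,
          one_mul, zero_mul, mul_zero]
        abel

theorem OscillatorRelations.exchange (hs : θ * θ = 1) (h : OscillatorRelations θ q p)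
    (a b c d : Fin m) (i j k l : Fin n) :
    (q a i * p b j) * (q c k * p d l)
      = θ • ((q c k * p b j) * (q a i * p d l)) + (if b = c ∧ j = k then q a i * p d l else 0)
        - θ • (if a = b ∧ i = j then q c k * p d l else 0) := by
  have e1 : p b j * q c k = (if b = c ∧ j = k then 1 else 0) + θ • (q c k * p b j) :=
    eq_add_of_sub_eq (h.pq b c j k)
  have e2 : p b j * q a i = (if b = a ∧ j = i then 1 else 0) + θ • (q a i * p b j) :=
    eq_add_of_sub_eq (h.pq b a j i)
  have e3 : q c k * (q a i * (p b j * p d l)) = θ • (q a i * (q c k * (p b j * p d l))) := by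
    rw [← mul_assoc, h.qq c a k i, smul_mul_assoc, mul_assoc]
  have e4 : (b = a ∧ j = i) = (a = b ∧ i = j) := by simp only [eq_comm]
  calc (q a i * p b j) * (q c k * p d l)
      = q a i * ((p b j * q c k) * p d l) := by simp only [mul_assoc]
    _ = θ • (q c k * ((p b j * q a i) * p d l)) + (if b = c ∧ j = k then q a i * p d l else 0)
        - θ • (if a = b ∧ i = j then q c k * p d l else 0) := by
        rw [e1, e2]
        simp only [e4, add_mul, mul_add, smul_mul_assoc, mul_smul_comm, mul_assoc, e3, ite_mul,
          mul_ite, one_mul, zero_mul, mul_zero, smul_add, smul_smul, hs, one_mul]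
        simp only [mul_one, ← mul_assoc]
        abel
    _ = _ := by simp only [mul_assoc]

/-- `ζ_n(E_ab) = θ δ_ab n/2 + ∑_k q_ak p_bk`. -/
def zetaE (θ : ℂ) (q p : Fin m → Fin n → A) (a b : Fin m) : A :=
  (if a = b then algebraMap ℂ A (θ * (n / 2)) else 0) + ∑ k, q a k * p b k

theorem OscillatorRelations.zetaE_comm_mul (hs : θ * θ = 1) (h : OscillatorRelations θ q p)
    (a b c d : Fin m) (k l : Fin n) :
    zetaE θ q p a b * (q c k * p d l) - (q c k * p d l) * zetaE θ q p a b
      = (if c = b then q a k * p d l else 0) - (if a = d then q c k * p b l else 0) := by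
  have e0 : (if a = b then algebraMap ℂ A (θ * (n / 2)) else 0) * (q c k * p d l)
      = (q c k * p d l) * (if a = b then algebraMap ℂ A (θ * (n / 2)) else 0) := by
    split_ifs
    · exact Algebra.commutes _ _
    · simp
  have e1 : (c = b) = (b = c) := propext eq_comm
  have e2 : (a = d) = (d = a) := propext eq_comm
  rw [zetaE, add_mul, mul_add, e0, add_sub_add_left_eq_sub, Finset.sum_mul, Finset.mul_sum,
    ← Finset.sum_sub_distrib]
  simp only [h.comm hs, Finset.sum_sub_distrib, ite_and, e1, e2]
  congr 1
  · split_ifs <;> simp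
  · split_ifs <;> simp

theorem OscillatorRelations.zetaE_relations (hs : θ * θ = 1) (h : OscillatorRelations θ q p) :
    GlRelations (zetaE θ q p) := by
  intro a b c d
  have e0 : zetaE θ q p a b * (if c = d then algebraMap ℂ A (θ * (n / 2)) else 0)
      = (if c = d then algebraMap ℂ A (θ * (n / 2)) else 0) * zetaE θ q p a b := by
    split_ifs
    · exact (Algebra.commutes _ _).symm
    · simp
  conv_lhs => rw [zetaE.eq_def θ q p c d]
  rw [mul_add, add_mul, e0, add_sub_add_left_eq_sub, Finset.mul_sum, Finset.sum_mul,
    ← Finset.sum_sub_distrib]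
  simp only [h.zetaE_comm_mul hs, Finset.sum_sub_distrib]
  by_cases h1 : c = b <;> by_cases h2 : a = d <;> simp [zetaE, h1, h2]

theorem sum4_comm {M : Type*} [AddCommMonoid M] {ι κ : Type*} [Fintype ι] [Fintype κ]
    (f : ι → ι → κ → κ → M) :
    ∑ a, ∑ b, ∑ c, ∑ d, f a b c d = ∑ c, ∑ d, ∑ a, ∑ b, f a b c d := by
  have : ∀ a, ∑ b, ∑ c, ∑ d, f a b c d = ∑ c, ∑ d, ∑ b, f a b c d := fun a => by
    rw [Finset.sum_comm]
    exact Finset.sum_congr rfl fun c _ => Finset.sum_comm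
  simp only [this]
  rw [Finset.sum_comm]
  exact Finset.sum_congr rfl fun c _ => Finset.sum_comm

theorem sum3_rot {M : Type*} [AddCommMonoid M] {ι : Type*} [Fintype ι]
    (f : ι → ι → ι → M) : ∑ b, ∑ c, ∑ d, f b c d = ∑ d, ∑ b, ∑ c, f b c d := by
  have : ∀ b, ∑ c, ∑ d, f b c d = ∑ d, ∑ c, f b c d := fun b => Finset.sum_comm
  simp only [this]
  exact Finset.sum_comm

theorem sum4_swap {M : Type*} [AddCommMonoid M] {ι : Type*} [Fintype ι]
    (f : ι → ι → ι → ι → M) :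
    ∑ a, ∑ b, ∑ c, ∑ d, f a b c d = ∑ c, ∑ b, ∑ a, ∑ d, f a b c d := by
  rw [sum3_rot fun a b c => ∑ d, f a b c d]
  exact Finset.sum_congr rfl fun c _ => Finset.sum_comm

/-- A family of elements satisfying the relations of the matrix units of `gl_m` gives a
homomorphism `U(gl_m) → A`. -/
def Ugl.lift {A : Type*} [Ring A] [Algebra ℂ A] {m : ℕ} (e : Fin m → Fin m → A)
    (he : GlRelations e) : Ugl m →ₐ[ℂ] A :=
  UniversalEnvelopingAlgebra.lift ℂ
    { toFun := fun M => ∑ a, ∑ b, M a b • e a b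
      map_add' := by
        intro M N
        simp only [Matrix.add_apply, add_smul, Finset.sum_add_distrib]
      map_smul' := by
        intro c M
        simp only [Matrix.smul_apply, smul_eq_mul, mul_smul, Finset.smul_sum, RingHom.id_apply]
      map_lie' := by
        intro M N
        rw [LieRing.of_associative_ring_bracket, LieRing.of_associative_ring_bracket]
        have hX : ∀ M N : Matrix (Fin m) (Fin m) ℂ,
            (∑ a, ∑ b, M a b • e a b) * (∑ a, ∑ b, N a b • e a b)
              = ∑ a, ∑ b, ∑ c, ∑ d, (M a b * N c d) • (e a b * e c d) := by
          intro M N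
          simp only [Finset.sum_mul]
          simp only [Finset.mul_sum, smul_mul_smul_comm]
        rw [hX, hX, sum4_comm (fun a b c d => (N a b * M c d) • (e a b * e c d))]
        simp only [← Finset.sum_sub_distrib, mul_comm (N _ _), ← smul_sub]
        simp only [he _ _ _ _, smul_sub, Finset.sum_sub_distrib, smul_ite, smul_zero]
        simp only [Matrix.sub_apply, Matrix.mul_apply, sub_smul, Finset.sum_smul,
          Finset.sum_sub_distrib]
        congr 1
        · refine Finset.sum_congr rfl fun a _ => ?_
          rw [Finset.sum_comm]
          refine Finset.sum_congr rfl fun b _ => ?_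
          rw [Finset.sum_comm]
          refine Finset.sum_congr rfl fun d _ => ?_
          simp
        · simp only [Finset.sum_ite_eq, Finset.mem_univ, if_true]
          rw [sum3_rot fun a b c => (M a b * N c a) • e c b]
          refine Finset.sum_congr rfl fun c _ => ?_
          rw [Finset.sum_comm]
          refine Finset.sum_congr rfl fun b _ => ?_
          refine Finset.sum_congr rfl fun a _ => ?_
          rw [mul_comm] }

theorem Ugl.lift_glE {A : Type*} [Ring A] [Algebra ℂ A] {m : ℕ} (e : Fin m → Fin m → A)
    (he : GlRelations e) (a b : Fin m) : Ugl.lift e he (glE m a b) = e a b := by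
  rw [Ugl.lift, glE, UniversalEnvelopingAlgebra.lift_ι_apply]
  change ∑ c, ∑ d, (Matrix.single a b (1 : ℂ)) c d • e c d = e a b
  rw [Finset.sum_eq_single a, Finset.sum_eq_single b] <;> simp +contextual [Matrix.single_apply, eq_comm]

theorem GlRelations.map_gl {A B : Type*} [Ring A] [Algebra ℂ A] [Ring B] [Algebra ℂ B] {m : ℕ}
    {e : Fin m → Fin m → A} (h : GlRelations e) (f : A →ₐ[ℂ] B) :
    GlRelations (fun a b => f (e a b)) := by
  intro a b c d
  have := congrArg f (h a b c d)
  simp only [map_sub, map_mul, apply_ite f, map_zero] at this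
  exact this

theorem GlRelations.add {A : Type*} [Ring A] {m : ℕ} {e e' : Fin m → Fin m → A}
    (h : GlRelations e) (h' : GlRelations e') (hc : ∀ a b c d, Commute (e a b) (e' c d)) :
    GlRelations (fun a b => e a b + e' a b) := by
  intro a b c d
  have e1 : (e a b + e' a b) * (e c d + e' c d) - (e c d + e' c d) * (e a b + e' a b)
      = (e a b * e c d - e c d * e a b) + (e' a b * e' c d - e' c d * e' a b) := by
    rw [add_mul, mul_add, mul_add, add_mul, mul_add, mul_add, (hc a b c d).eq, (hc c d a b).eq]
    abel
  rw [e1, h, h']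
  by_cases h1 : c = b <;> by_cases h2 : a = d <;> simp only [h1, h2, if_true, if_false] <;> abel

/-- The family `T_ij^(r+1) = ∑_ab X_ab^(r) ε_(ai,bj)`. -/
def alphaFamily {B : Type*} [Ring B] {m n : ℕ} (X : ℕ → Fin m → Fin m → B)
    (ε : Fin m → Fin n → Fin m → Fin n → B) (r : ℕ) (i j : Fin n) : B :=
  ∑ a, ∑ b, X r a b * ε a i b j

theorem alphaFamily_mul {B : Type*} [Ring B] {m n : ℕ} (X : ℕ → Fin m → Fin m → B)
    (ε : Fin m → Fin n → Fin m → Fin n → B)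
    (hc : ∀ r a b c k d l, Commute (X r a b) (ε c k d l)) (r s : ℕ) (i j k l : Fin n) :
    alphaFamily X ε r i j * alphaFamily X ε s k l
      = ∑ a, ∑ b, ∑ c, ∑ d, (X r a b * X s c d) * (ε a i b j * ε c k d l) := by
  simp only [alphaFamily, Finset.sum_mul]
  simp only [Finset.mul_sum]
  refine Finset.sum_congr rfl fun a _ => Finset.sum_congr rfl fun b _ =>
    Finset.sum_congr rfl fun c _ => Finset.sum_congr rfl fun d _ => ?_
  rw [mul_assoc, ← mul_assoc (ε a i b j), ← (hc s c d a i b j).eq]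
  simp only [mul_assoc]

theorem alphaFamily_relations {B : Type*} [Ring B] [Algebra ℂ B] {θ : ℂ} (hs : θ * θ = 1)
    {m n : ℕ}
    (X : ℕ → Fin m → Fin m → B) (ε : Fin m → Fin n → Fin m → Fin n → B)
    (hc : ∀ r a b c k d l, Commute (X r a b) (ε c k d l))
    (hX0 : ∀ a b, X 0 a b = if a = b then 1 else 0)
    (hXadd : ∀ r s a d, ∑ b, X r a b * X s b d = X (r + s) a d)
    (hXX : ∀ r s a b c d, (X (r + 1) a b * X s c d - X s c d * X (r + 1) a b)
      - (X r a b * X (s + 1) c d - X (s + 1) c d * X r a b)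
      = θ • (X r c b * X s a d - X s c b * X r a d))
    (h1 : ∀ a b c d i j k l, ε a i b j * ε c k d l - ε c k d l * ε a i b j
      = (if b = c ∧ j = k then ε a i d l else 0) - (if d = a ∧ l = i then ε c k b j else 0))
    (h2 : ∀ a b c d i j k l, ε a i b j * ε c k d l
      = θ • (ε c k b j * ε a i d l) + (if b = c ∧ j = k then ε a i d l else 0)
        - θ • (if a = b ∧ i = j then ε c k d l else 0)) :
    YangianRelations (alphaFamily X ε) := by
  have h3 : ∀ a b c d i j k l, ε c k d l * ε a i b j
      = θ • (ε c k b j * ε a i d l) + (if d = a ∧ l = i then ε c k b j else 0)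
        - θ • (if a = b ∧ i = j then ε c k d l else 0) := by
    intro a b c d i j k l
    have := h1 a b c d i j k l
    rw [h2, sub_eq_iff_eq_add, ← sub_eq_iff_eq_add'] at this
    rw [← this]
    abel
  refine yangianRelations_of ?_ ?_
  · intro s i j k l
    have e1 : alphaFamily X ε 0 i j = ∑ a, ε a i a j := by
      simp [alphaFamily, hX0]
    have e2 : ∀ a c d, ε a i a j * (X s c d * ε c k d l) - (X s c d * ε c k d l) * ε a i a j
        = X s c d * ((if a = c ∧ j = k then ε a i d l else 0)
          - (if d = a ∧ l = i then ε c k a j else 0)) := by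
      intro a c d
      rw [← h1, ← mul_assoc, ← (hc s c d a i a j).eq, mul_sub]
      simp only [mul_assoc]
    rw [e1]
    have hL : ∀ Y : Fin m → Fin m → B, (∑ a, ε a i a j) * (∑ c, ∑ d, Y c d)
        = ∑ c, ∑ d, ∑ a, ε a i a j * Y c d := by
      intro Y
      simp only [Finset.mul_sum]
      simp only [Finset.sum_mul]
    have hR : ∀ Y : Fin m → Fin m → B, (∑ c, ∑ d, Y c d) * (∑ a, ε a i a j)
        = ∑ c, ∑ d, ∑ a, Y c d * ε a i a j := by
      intro Y
      simp only [Finset.sum_mul]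
      simp only [Finset.mul_sum]
    simp only [alphaFamily]
    rw [hL, hR]
    simp only [← Finset.sum_sub_distrib, e2]
    by_cases hjk : k = j <;> by_cases hil : i = l <;>
      simp [hjk, hil, mul_sub, eq_comm (a := j) (b := k), eq_comm (a := l) (b := i)]
  · intro r s i j k l
    have E1 : ∀ (r s : ℕ) (i j k l : Fin n),
        ∑ a, ∑ b, ∑ c, ∑ d, X r a b * X s c d * (if b = c ∧ j = k then ε a i d l else 0)
          = if j = k then ∑ a, ∑ d, X (r + s) a d * ε a i d l else 0 := by
      intro r s i j k l
      split_ifs with hjk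
      · refine Finset.sum_congr rfl fun a _ => ?_
        rw [sum3_rot]
        refine Finset.sum_congr rfl fun d _ => ?_
        simp [hjk, ← hXadd, Finset.sum_mul]
      · simp [hjk]
    have key : ∀ r s, alphaFamily X ε r i j * alphaFamily X ε s k l
          - alphaFamily X ε s k l * alphaFamily X ε r i j
        = (∑ a, ∑ b, ∑ c, ∑ d, (X r a b * X s c d - X s c d * X r a b)
            * (θ • (ε c k b j * ε a i d l - if a = b ∧ i = j then ε c k d l else 0)))
          + ((if j = k then ∑ a, ∑ d, X (r + s) a d * ε a i d l else 0)
            - (if l = i then ∑ c, ∑ b, X (s + r) c b * ε c k b j else 0)) := by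
      intro r s
      have e2 : ∑ a, ∑ b, ∑ c, ∑ d, X s c d * X r a b * (if d = a ∧ l = i then ε c k b j else 0)
          = if l = i then ∑ c, ∑ b, X (s + r) c b * ε c k b j else 0 := by
        rw [sum4_comm]
        exact E1 s r k l i j
      rw [alphaFamily_mul X ε hc, alphaFamily_mul X ε hc,
        sum4_comm (fun a b c d => (X s a b * X r c d) * (ε a k b l * ε c i d j)), ← E1, ← e2]
      simp only [← Finset.sum_sub_distrib, ← Finset.sum_add_distrib]
      refine Finset.sum_congr rfl fun a _ => Finset.sum_congr rfl fun b _ =>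
        Finset.sum_congr rfl fun c _ => Finset.sum_congr rfl fun d _ => ?_
      rw [h2, h3 a b c d i j k l]
      simp only [sub_mul, mul_sub, mul_add, smul_sub]
      abel
    rw [key, key]
    have e1 : r + 1 + s = r + (s + 1) := by ring
    have e2 : s + (r + 1) = s + 1 + r := by ring
    rw [e1, e2, add_sub_add_right_eq_sub]
    simp only [← Finset.sum_sub_distrib, ← sub_mul, hXX]
    have e3 : ∀ a b c d, θ • (X r c b * X s a d - X s c b * X r a d)
          * (θ • (ε c k b j * ε a i d l - if a = b ∧ i = j then ε c k d l else 0))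
        = ((X r c b * X s a d) * (ε c k b j * ε a i d l)
            - (X s c b * X r a d) * (ε c k b j * ε a i d l))
          - (X r c b * X s a d - X s c b * X r a d)
            * (if a = b ∧ i = j then ε c k d l else 0) := by
      intro a b c d
      rw [smul_mul_smul_comm, hs, one_smul, mul_sub, sub_mul]
    have e4 : ∑ a, ∑ b, ∑ c, ∑ d, (X r c b * X s a d - X s c b * X r a d)
            * (if a = b ∧ i = j then ε c k d l else 0) = 0 := by
      rw [sum4_comm]
      refine Finset.sum_eq_zero fun c _ => Finset.sum_eq_zero fun d _ => ?_
      by_cases hij : i = j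
      · simp [hij, sub_mul, ← Finset.sum_mul, hXadd, add_comm s r]
      · simp [hij]
    simp only [e3, Finset.sum_sub_distrib]
    rw [e4, sub_zero, alphaFamily_mul X ε hc, alphaFamily_mul X ε hc,
      sum4_swap fun a b c d => X r c b * X s a d * (ε c k b j * ε a i d l),
      sum4_swap fun a b c d => X s c b * X r a d * (ε c k b j * ε a i d l)]

theorem alphaFamily_comm {B : Type*} [Ring B] [Algebra ℂ B] {m n : ℕ}
    (X : ℕ → Fin m → Fin m → B) (ε : Fin m → Fin n → Fin m → Fin n → B) (e z : B) (c d : Fin m)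
    (heX : ∀ r a b, e * X r a b - X r a b * e
      = (if b = d then X r a c else 0) - (if a = c then X r d b else 0))
    (heε : ∀ a i b j, Commute e (ε a i b j)) (hzX : ∀ r a b, Commute z (X r a b))
    (hzε : ∀ a i b j, z * ε a i b j - ε a i b j * z
      = (if a = d then ε c i b j else 0) - (if c = b then ε a i d j else 0))
    (r : ℕ) (i j : Fin n) : Commute (e + z) (alphaFamily X ε r i j) := by
  have key : ∀ a b, (e + z) * (X r a b * ε a i b j) - (X r a b * ε a i b j) * (e + z)
      = ((if b = d then X r a c else 0) - (if a = c then X r d b else 0)) * ε a i b j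
        + X r a b * ((if a = d then ε c i b j else 0) - (if c = b then ε a i d j else 0)) := by
    intro a b
    rw [← heX, ← hzε]
    have e1 : X r a b * ε a i b j * e = X r a b * e * ε a i b j := by
      rw [mul_assoc, ← (heε a i b j).eq, mul_assoc]
    have e2 : z * (X r a b * ε a i b j) = X r a b * (z * ε a i b j) := by
      rw [← mul_assoc, (hzX r a b).eq, mul_assoc]
    rw [add_mul, mul_add, e1, e2]
    simp only [sub_mul, mul_sub, mul_assoc]
    abel
  rw [commute_iff_eq, ← sub_eq_zero, alphaFamily]
  simp only [Finset.mul_sum, Finset.sum_mul]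
  simp only [← Finset.sum_sub_distrib, key]
  simp only [sub_mul, mul_sub, ite_mul, mul_ite, zero_mul, mul_zero, Finset.sum_add_distrib,
    Finset.sum_sub_distrib, Finset.sum_ite_eq, Finset.sum_ite_eq', Finset.mem_univ, if_true]
  rw [Finset.sum_comm (f := fun a b => if a = c then X r d b * ε a i b j else 0),
    Finset.sum_comm (f := fun a b => if a = d then X r a b * ε c i b j else 0)]
  simp

theorem Ugl.hom_ext {A : Type*} [Ring A] [Algebra ℂ A] {m : ℕ} {f g : Ugl m →ₐ[ℂ] A}
    (h : ∀ a b, f (glE m a b) = g (glE m a b)) : f = g := by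
  refine UniversalEnvelopingAlgebra.hom_ext (R := ℂ) ?_
  refine LieHom.ext fun M => ?_
  change f (UniversalEnvelopingAlgebra.ι ℂ M) = g (UniversalEnvelopingAlgebra.ι ℂ M)
  have hM : M = ∑ a, ∑ b, M a b • Matrix.single a b (1 : ℂ) := by
    conv_lhs => rw [Matrix.matrix_eq_sum_single M]
    simp
  rw [hM]
  simp only [map_sum, map_smul]
  exact Finset.sum_congr rfl fun a _ => Finset.sum_congr rfl fun b _ => congrArg _ (h a b)

theorem Ugl.commute_of_gen {A : Type*} [Ring A] [Algebra ℂ A] {m : ℕ} (f : Ugl m →ₐ[ℂ] A)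
    (y : A) (h : ∀ a b, Commute (f (glE m a b)) y) (x : Ugl m) : Commute (f x) y := by
  let S : Subalgebra ℂ A := Subalgebra.centralizer ℂ {y}
  have hS : ∀ a, a ∈ S ↔ Commute a y := by
    intro a
    simp [S, Subalgebra.mem_centralizer_iff, Commute, SemiconjBy, eq_comm]
  have hrel : GlRelations (fun a b => (⟨f (glE m a b), (hS _).2 (h a b)⟩ : S)) := by
    intro a b c d
    apply Subtype.ext
    have := (glE_relations m).map_gl f a b c d
    refine this.trans ?_
    split_ifs <;> rfl
  let g : Ugl m →ₐ[ℂ] S := Ugl.lift _ hrel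
  have hg : S.val.comp g = f := Ugl.hom_ext fun a b =>
    congrArg S.val (Ugl.lift_glE _ hrel a b)
  rw [← hg]
  exact (hS _).1 (g x).2

variable (θ : Statistics) (p q n : ℕ)

/-- The homomorphism `ζ_n : U(gl_m) → HD`, `E_ab ↦ θ δ_ab n/2 + ∑_k q_ak p_bk`. -/
def zetaHom : Ugl (p + q) →ₐ[ℂ] HDAlg θ (p + q) n :=
  Ugl.lift (zetaE θ.sign (hdQ θ p q n) (hdP θ p q n))
    ((hdQ_hdP_relations θ p q n).zetaE_relations θ.sign_mul_sign)

theorem glEmbedding_relations : GlRelations (fun a b => glE (p + q) a b ⊗ₜ[ℂ] 1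
    + (1 : Ugl (p + q)) ⊗ₜ[ℂ] zetaHom θ p q n (glE (p + q) a b)) := by
  have h1 := (glE_relations (p + q)).map_gl (Algebra.TensorProduct.includeLeft :
    Ugl (p + q) →ₐ[ℂ] Ugl (p + q) ⊗[ℂ] HDAlg θ (p + q) n)
  have h2 := (glE_relations (p + q)).map_gl ((Algebra.TensorProduct.includeRight :
    HDAlg θ (p + q) n →ₐ[ℂ] Ugl (p + q) ⊗[ℂ] HDAlg θ (p + q) n).comp (zetaHom θ p q n))
  exact h1.add h2 (by intro a b c d; simp [Commute, SemiconjBy])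

/-- The embedding `U(gl_m) → U(gl_m) ⊗ HD`, `E_ab ↦ E_ab ⊗ 1 + 1 ⊗ ζ_n(E_ab)`. -/
def glEmbedding : Ugl (p + q) →ₐ[ℂ] Ugl (p + q) ⊗[ℂ] HDAlg θ (p + q) n :=
  Ugl.lift (fun a b => glE (p + q) a b ⊗ₜ[ℂ] 1 + 1 ⊗ₜ[ℂ] zetaHom θ p q n (glE (p + q) a b))
    (glEmbedding_relations θ p q n)

theorem alphaFamily_eq :
    (fun (r : ℕ) (i j : Fin n) => ∑ a, ∑ b,
      (Xmat θ.sign (p + q) ^ r) a b ⊗ₜ[ℂ] (hdQ θ p q n a i * hdP θ p q n b j))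
    = alphaFamily (fun r a b => (Xmat θ.sign (p + q) ^ r) a b ⊗ₜ[ℂ] (1 : HDAlg θ (p + q) n))
        (fun a i b j => (1 : Ugl (p + q)) ⊗ₜ[ℂ] (hdQ θ p q n a i * hdP θ p q n b j)) := by
  funext r i j
  simp only [alphaFamily, Algebra.TensorProduct.tmul_mul_tmul, one_mul, mul_one]

/-- The homomorphism `α_m : Y(gl_n) → U(gl_m) ⊗ HD`,
`T_ij(u) ↦ δ_ij + ∑_ab X_ab(u) ⊗ q_ai p_bj`. -/
def alphaHom : Yangian n →ₐ[ℂ] Ugl (p + q) ⊗[ℂ] HDAlg θ (p + q) n :=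
  Yangian.lift (fun r i j => ∑ a, ∑ b,
      (Xmat θ.sign (p + q) ^ r) a b ⊗ₜ[ℂ] (hdQ θ p q n a i * hdP θ p q n b j)) (by
    rw [alphaFamily_eq]
    have hqp := hdQ_hdP_relations θ p q n
    refine alphaFamily_relations θ.sign_mul_sign _ _ ?_ ?_ ?_ ?_ ?_ ?_
    · intro r a b c k d l
      simp only [Commute, SemiconjBy, Algebra.TensorProduct.tmul_mul_tmul, one_mul, mul_one]
    · intro a b
      simp only [pow_zero, Matrix.one_apply]
      split_ifs
      · rfl
      · rw [TensorProduct.zero_tmul]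
    · intro r s a d
      simp only [Algebra.TensorProduct.tmul_mul_tmul, mul_one, ← TensorProduct.sum_tmul, pow_add,
        Matrix.mul_apply]
    · intro r s a b c d
      simp only [Algebra.TensorProduct.tmul_mul_tmul, mul_one, ← TensorProduct.sub_tmul,
        Xmat_pow_relation, TensorProduct.smul_tmul']
    · intro a b c d i j k l
      simp only [Algebra.TensorProduct.tmul_mul_tmul, mul_one, ← TensorProduct.tmul_sub,
        hqp.comm θ.sign_mul_sign]
      split_ifs <;> simp only [TensorProduct.tmul_sub, TensorProduct.tmul_zero]
    · intro a b c d i j k l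
      simp only [Algebra.TensorProduct.tmul_mul_tmul, mul_one]
      rw [hqp.exchange θ.sign_mul_sign, TensorProduct.tmul_sub, TensorProduct.tmul_add,
        TensorProduct.tmul_smul, TensorProduct.tmul_smul]
      split_ifs <;> simp only [TensorProduct.tmul_zero])

/-- The images of `U(gl_m)` and `Y(gl_n)` in `U(gl_m) ⊗ HD` commute. -/
theorem glEmbedding_alphaHom_commute (x : Ugl (p + q)) (y : Yangian n) :
    Commute (glEmbedding θ p q n x) (alphaHom θ p q n y) := by
  have hqp := hdQ_hdP_relations θ p q n
  refine Ugl.commute_of_gen _ _ (fun c d => ?_) x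
  refine Yangian.commute_of_gen _ _ (fun r i j => ?_) y
  rw [show glEmbedding θ p q n (glE (p + q) c d) = _ from Ugl.lift_glE _ _ c d,
    show zetaHom θ p q n (glE (p + q) c d) = _ from Ugl.lift_glE _ _ c d,
    show alphaHom θ p q n (Yangian.gen n r i j) = _ from Yangian.lift_gen _ _ r i j]
  have h := congrFun (congrFun (congrFun (alphaFamily_eq θ p q n) r) i) j
  rw [h]
  refine alphaFamily_comm _ _ _ _ c d ?_ ?_ ?_ ?_ r i j
  · intro r a b
    simp only [Algebra.TensorProduct.tmul_mul_tmul, mul_one, ← TensorProduct.sub_tmul,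
      glE_comm_Xmat_pow]
    split_ifs <;> simp only [TensorProduct.sub_tmul, TensorProduct.zero_tmul]
  · intro a i b j
    simp only [Commute, SemiconjBy, Algebra.TensorProduct.tmul_mul_tmul, one_mul, mul_one]
  · intro r a b
    simp only [Commute, SemiconjBy, Algebra.TensorProduct.tmul_mul_tmul, one_mul, mul_one]
  · intro a i b j
    simp only [Algebra.TensorProduct.tmul_mul_tmul, mul_one, ← TensorProduct.tmul_sub,
      hqp.zetaE_comm_mul θ.sign_mul_sign]
    have e1 : (a = d) = (d = a) := propext eq_comm
    have e2 : (c = b) = (b = c) := propext eq_comm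
    simp only [e1, e2]
    split_ifs <;> simp only [TensorProduct.tmul_sub, TensorProduct.tmul_zero]

end Oscillator

/-! ### Modules and bimodules -/

/-- A module over the Yangian `Y(gl_n)`. -/
structure YangianModule (n : ℕ) where
  carrier : Type
  [addCommGroup : AddCommGroup carrier]
  [module : Module ℂ carrier]
  act : Yangian n →ₐ[ℂ] Module.End ℂ carrier

attribute [instance] YangianModule.addCommGroup YangianModule.module

/-- A bimodule over `gl_m` and `Y(gl_n)`: the two actions commute. The action of `gl_m` is given
as an action of `U(gl_m)`. -/
structure GlYangianBimodule (m n : ℕ) extends YangianModule n where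
  gl : Ugl m →ₐ[ℂ] Module.End ℂ carrier
  gl_act : ∀ x y, Commute (gl x) (act y)

/-- A bimodule over the abelian Lie algebra `h` with basis `E_11, …, E_mm` and `Y(gl_n)`;
`cartan a` is the action of `E_aa`. For `m = 1` this is a bimodule over `gl_1` and `Y(gl_n)`. -/
structure CartanYangianBimodule (m n : ℕ) extends YangianModule n where
  cartan : Fin m → Module.End ℂ carrier
  cartan_comm : ∀ a b, Commute (cartan a) (cartan b)
  cartan_act : ∀ a y, Commute (cartan a) (act y)

/-- Isomorphism of `Y(gl_n)`-modules. -/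
def YangianModule.Isomorphic {n : ℕ} (M N : YangianModule n) : Prop :=
  ∃ e : M.carrier ≃ₗ[ℂ] N.carrier, ∀ y w, e (M.act y w) = N.act y (e w)

/-- Isomorphism of bimodules over `h` and `Y(gl_n)`. -/
def CartanYangianBimodule.Isomorphic {m n : ℕ} (M N : CartanYangianBimodule m n) : Prop :=
  ∃ e : M.carrier ≃ₗ[ℂ] N.carrier,
    (∀ a w, e (M.cartan a w) = N.cartan a (e w)) ∧ ∀ y w, e (M.act y w) = N.act y (e w)

/-- Restriction of the action of `gl_m` to its Cartan subalgebra `h`. -/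
def GlYangianBimodule.restrictCartan {m n : ℕ} (M : GlYangianBimodule m n) :
    CartanYangianBimodule m n where
  toYangianModule := M.toYangianModule
  cartan a := M.gl (glE m a a)
  cartan_comm a b := by
    have h : Commute (glE m a a) (glE m b b) := by
      rw [commute_iff_eq, ← sub_eq_zero, glE_relations]
      by_cases hab : a = b
      · subst hab; simp
      · rw [if_neg (Ne.symm hab), if_neg hab, sub_zero]
    exact h.map M.gl
  cartan_act a y := M.gl_act _ y

/-- Pull-back through the automorphism `τ_z`: on the new bimodule `T_ij(u)` acts in the way that
`T_ij(u - z)` acts on the old one. -/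
def GlYangianBimodule.pullShift {m n : ℕ} (z : ℂ) (M : GlYangianBimodule m n) :
    GlYangianBimodule m n where
  toYangianModule := { M.toYangianModule with act := M.act.comp (Yangian.shift n z) }
  gl := M.gl
  gl_act x _ := M.gl_act x _

/-! #### Coinvariants -/

/-- The subspace `n · M`, where `n` is spanned by all `E_ba` with `a < b`. -/
def GlYangianBimodule.lowerSubspace {m n : ℕ} (M : GlYangianBimodule m n) :
    Submodule ℂ M.carrier :=
  Submodule.span ℂ {v | ∃ (a b : Fin m) (w : M.carrier), a < b ∧ v = M.gl (glE m b a) w}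

theorem GlYangianBimodule.lowerSubspace_le_act {m n : ℕ} (M : GlYangianBimodule m n)
    (y : Yangian n) : M.lowerSubspace ≤ M.lowerSubspace.comap (M.act y) := by
  refine Submodule.span_le.2 ?_
  rintro _ ⟨a, b, w, hab, rfl⟩
  have h : M.act y (M.gl (glE m b a) w) = M.gl (glE m b a) (M.act y w) :=
    (LinearMap.congr_fun (M.gl_act (glE m b a) y).eq w).symm
  exact Submodule.subset_span ⟨a, b, M.act y w, hab, h⟩

theorem GlYangianBimodule.lowerSubspace_le_cartan {m n : ℕ} (M : GlYangianBimodule m n)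
    (c : Fin m) : M.lowerSubspace ≤ M.lowerSubspace.comap (M.gl (glE m c c)) := by
  refine Submodule.span_le.2 ?_
  rintro _ ⟨a, b, w, hab, rfl⟩
  have hmem : ∀ w, M.gl (glE m b a) w ∈ M.lowerSubspace := fun w =>
    Submodule.subset_span ⟨a, b, w, hab, rfl⟩
  have h1 : glE m c c * glE m b a = glE m b a * glE m c c
      + ((if b = c then glE m c a else 0) - (if c = a then glE m b c else 0)) := by
    rw [← glE_relations]; abel
  have h2 : M.gl (glE m c c) (M.gl (glE m b a) w) = M.gl (glE m b a) (M.gl (glE m c c) w)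
      + M.gl ((if b = c then glE m c a else 0) - (if c = a then glE m b c else 0)) w := by
    have := congrArg (fun x => M.gl x w) h1
    simpa only [map_mul, map_add, LinearMap.add_apply, Module.End.mul_apply] using this
  change M.gl (glE m c c) (M.gl (glE m b a) w) ∈ M.lowerSubspace
  rw [h2]
  refine add_mem (hmem _) ?_
  rw [map_sub, LinearMap.sub_apply]
  refine sub_mem ?_ ?_
  · by_cases h : b = c
    · subst h; rw [if_pos rfl]; exact hmem w
    · rw [if_neg h, map_zero]; exact zero_mem _
  · by_cases h : c = a
    · subst h; rw [if_pos rfl]; exact hmem w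
    · rw [if_neg h, map_zero]; exact zero_mem _

/-- The bimodule of coinvariants `M_n = M / n · M` over `h` and `Y(gl_n)`. -/
def GlYangianBimodule.coinvariants {m n : ℕ} (M : GlYangianBimodule m n) :
    CartanYangianBimodule m n where
  carrier := M.carrier ⧸ M.lowerSubspace
  act := AlgHom.ofLinearMap
    { toFun := fun y => M.lowerSubspace.mapQ M.lowerSubspace (M.act y) (M.lowerSubspace_le_act y)
      map_add' := fun x y => by
        refine Submodule.linearMap_qext _ (LinearMap.ext fun w => ?_)
        simp
      map_smul' := fun c y => by
        refine Submodule.linearMap_qext _ (LinearMap.ext fun w => ?_)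
        simp }
    (by
      refine Submodule.linearMap_qext _ (LinearMap.ext fun w => ?_)
      simp)
    (fun x y => by
      refine Submodule.linearMap_qext _ (LinearMap.ext fun w => ?_)
      simp)
  cartan a := M.lowerSubspace.mapQ M.lowerSubspace (M.gl (glE m a a)) (M.lowerSubspace_le_cartan a)
  cartan_comm a b := by
    refine Submodule.linearMap_qext _ (LinearMap.ext fun w => ?_)
    have h := LinearMap.congr_fun (M.restrictCartan.cartan_comm a b).eq w
    exact congrArg (Submodule.Quotient.mk (p := M.lowerSubspace)) h
  cartan_act a y := by
    refine Submodule.linearMap_qext _ (LinearMap.ext fun w => ?_)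
    have h := LinearMap.congr_fun (M.gl_act (glE m a a) y).eq w
    exact congrArg (Submodule.Quotient.mk (p := M.lowerSubspace)) h

/-! #### Tensor products -/

/-- The one-dimensional `Y(gl_n)`-module given by the counit. -/
def YangianModule.trivial (n : ℕ) : YangianModule n where
  carrier := ℂ
  act := (Algebra.ofId ℂ (Module.End ℂ ℂ)).comp (Yangian.counit n)

/-- The tensor product of two `Y(gl_n)`-modules, with the action given by the comultiplication. -/
def YangianModule.tensor {n : ℕ} (M N : YangianModule n) : YangianModule n where
  carrier := M.carrier ⊗[ℂ] N.carrier
  act := ((Module.endTensorEndAlgHom (R := ℂ) (S := ℂ) (A := ℂ)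
      (M := M.carrier) (N := N.carrier)).comp
    (Algebra.TensorProduct.map M.act N.act)).comp (Yangian.comul n)

/-- The tensor product `F_0 ⊗ (F_1 ⊗ (⋯ ⊗ (F_{m-1} ⊗ ℂ)))`. -/
def YangianModule.tensorFamily {n : ℕ} : (m : ℕ) → (Fin m → YangianModule n) → YangianModule n
  | 0, _ => YangianModule.trivial n
  | m + 1, F => (F 0).tensor (YangianModule.tensorFamily m fun a => F a.succ)

theorem YangianModule.tensor_act_commute {n : ℕ} (M N : YangianModule n)
    (f : Module.End ℂ M.carrier) (g : Module.End ℂ N.carrier)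
    (hf : ∀ y, Commute f (M.act y)) (hg : ∀ y, Commute g (N.act y)) (y : Yangian n) :
    Commute (TensorProduct.map f g : Module.End ℂ (M.carrier ⊗[ℂ] N.carrier))
      ((M.tensor N).act y) := by
  have key : ∀ t : Yangian n ⊗[ℂ] Yangian n,
      Commute (TensorProduct.map f g : Module.End ℂ (M.carrier ⊗[ℂ] N.carrier))
        (Module.endTensorEndAlgHom (R := ℂ) (S := ℂ) (A := ℂ) (M := M.carrier) (N := N.carrier)
          (Algebra.TensorProduct.map M.act N.act t)) := by
    intro t
    induction t with
    | zero => simp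
    | add t t' h h' => simpa only [map_add] using h.add_right h'
    | tmul a b =>
      refine TensorProduct.ext' fun v w => ?_
      have h1 := LinearMap.congr_fun (hf a).eq v
      have h2 := LinearMap.congr_fun (hg b).eq w
      change f (M.act a v) ⊗ₜ[ℂ] g (N.act b w) = M.act a (f v) ⊗ₜ[ℂ] N.act b (g w)
      exact congrArg₂ (fun v w => v ⊗ₜ[ℂ] w) h1 h2
  exact key _

/-- The tensor product of a bimodule over `gl_1` and `Y(gl_n)` with a bimodule over
`gl_1 ⊕ ⋯ ⊕ gl_1` (`m` summands) and `Y(gl_n)`: each copy of `gl_1` acts on its own factor, and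
`Y(gl_n)` acts by the comultiplication. -/
def CartanYangianBimodule.consTensor {m n : ℕ} (M : CartanYangianBimodule 1 n)
    (N : CartanYangianBimodule m n) : CartanYangianBimodule (m + 1) n where
  toYangianModule := M.toYangianModule.tensor N.toYangianModule
  cartan := Fin.cons ((M.cartan 0).rTensor N.carrier) fun a => (N.cartan a).lTensor M.carrier
  cartan_comm := by
    intro a b
    refine Fin.cases ?_ (fun a => ?_) a <;> refine Fin.cases ?_ (fun b => ?_) b
    · exact Commute.refl _
    · exact TensorProduct.ext' fun v w => rfl
    · exact TensorProduct.ext' fun v w => rfl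
    · refine TensorProduct.ext' fun v w => ?_
      have h := LinearMap.congr_fun (N.cartan_comm a b).eq w
      exact congrArg (fun u => v ⊗ₜ[ℂ] u) h
  cartan_act := by
    intro a y
    refine Fin.cases ?_ (fun a => ?_) a
    · exact YangianModule.tensor_act_commute _ _ (M.cartan 0) LinearMap.id (M.cartan_act 0)
        (fun _ => Commute.one_left _) y
    · exact YangianModule.tensor_act_commute _ _ LinearMap.id (N.cartan a)
        (fun _ => Commute.one_left _) (N.cartan_act a) y

/-- The tensor product `F_0 ⊗ F_1 ⊗ ⋯ ⊗ F_{m-1}` of bimodules over `gl_1` and `Y(gl_n)`, as a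
bimodule over `h = gl_1 ⊕ ⋯ ⊕ gl_1` and `Y(gl_n)`. -/
def CartanYangianBimodule.tensorFamily {n : ℕ} :
    (m : ℕ) → (Fin m → CartanYangianBimodule 1 n) → CartanYangianBimodule m n
  | 0, _ =>
    { toYangianModule := YangianModule.trivial n
      cartan := fun a => a.elim0
      cartan_comm := fun a => a.elim0
      cartan_act := fun a => a.elim0 }
  | m + 1, F => (F 0).consTensor (CartanYangianBimodule.tensorFamily m fun a => F a.succ)

/-- A `Y(gl_n)`-module `O` is cocentral if for every `Y(gl_n)`-module `M` the map
`m ⊗ a ↦ a ⊗ m` is an isomorphism `M ⊗ O → O ⊗ M` of `Y(gl_n)`-modules. -/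
def YangianModule.IsCocentral {n : ℕ} (O : YangianModule n) : Prop :=
  ∀ (M : YangianModule n) (y : Yangian n) (w : M.carrier ⊗[ℂ] O.carrier),
    TensorProduct.comm ℂ M.carrier O.carrier ((M.tensor O).act y w)
      = (O.tensor M).act y (TensorProduct.comm ℂ M.carrier O.carrier w)

/-! ### The functor `E_{p,q}` and Verma modules -/

/-- The action of `U(gl_m) ⊗ HD` on `V ⊗ H`. -/
def tensorAction (θ : Statistics) (m n : ℕ) (V : Type) [AddCommGroup V] [Module ℂ V]
    [Module (Ugl m) V] [IsScalarTower ℂ (Ugl m) V] :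
    Ugl m ⊗[ℂ] HDAlg θ m n →ₐ[ℂ] Module.End ℂ (V ⊗[ℂ] HAlg θ m n) :=
  (Module.endTensorEndAlgHom (R := ℂ) (S := ℂ) (A := ℂ) (M := V) (N := HAlg θ m n)).comp
    (Algebra.TensorProduct.map (Algebra.lsmul ℂ ℂ V) (HDAlg θ m n).val)

/-- The bimodule `E_{p,q}(V) = V ⊗ H(ℂ^m ⊗ ℂ^n)` over `gl_m` and `Y(gl_n)`, where `m = p + q`,
for a `gl_m`-module `V`. -/
def Epq (θ : Statistics) (p q n : ℕ) (V : Type) [AddCommGroup V] [Module ℂ V]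
    [Module (Ugl (p + q)) V] [IsScalarTower ℂ (Ugl (p + q)) V] :
    GlYangianBimodule (p + q) n where
  carrier := V ⊗[ℂ] HAlg θ (p + q) n
  act := (tensorAction θ (p + q) n V).comp (alphaHom θ p q n)
  gl := (tensorAction θ (p + q) n V).comp (glEmbedding θ p q n)
  gl_act x y := (glEmbedding_alphaHom_commute θ p q n x y).map (tensorAction θ (p + q) n V)

/-- The bimodule `E_{p,q}^z(V)`: `gl_m` acts as on `E_{p,q}(V)`, and `T_ij(u)` acts in the way that
`T_ij(u - θ z)` acts on `E_{p,q}(V)`. -/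
def EpqShift (θ : Statistics) (p q n : ℕ) (z : ℂ) (V : Type) [AddCommGroup V] [Module ℂ V]
    [Module (Ugl (p + q)) V] [IsScalarTower ℂ (Ugl (p + q)) V] :
    GlYangianBimodule (p + q) n :=
  (Epq θ p q n V).pullShift (θ.sign * z)

/-- The left ideal of `U(gl_m)` generated by all `E_ab` with `a < b` and all `E_aa - μ_a`. -/
def vermaIdeal (m : ℕ) (μ : Fin m → ℂ) : Submodule (Ugl m) (Ugl m) :=
  Submodule.span (Ugl m) ({x | ∃ a b : Fin m, a < b ∧ x = glE m a b}
    ∪ {x | ∃ a : Fin m, x = glE m a a - algebraMap ℂ (Ugl m) (μ a)})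

/-- The Verma module `M_μ` of `gl_m`. -/
abbrev Verma (m : ℕ) (μ : Fin m → ℂ) : Type := Ugl m ⧸ vermaIdeal m μ

/-! ### The standard modules -/

/-- The pull-back of a representation of `gl_n`, given by operators `e_ij`, through
`T_ij(u) ↦ δ_ij + e_ij / (u + w)`. -/
def YangianModule.ofEvaluation {n : ℕ} (V : Type) [AddCommGroup V] [Module ℂ V]
    (e : Fin n → Fin n → Module.End ℂ V) (he : GlRelations e) (w : ℂ) : YangianModule n where
  carrier := V
  act := Yangian.evaluation e he w

/-- The module `Φ_z`: the space `H(ℂ^n)` with `T_ij(u) ↦ δ_ij + x_i ∂_j / (u + θ z)`. -/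
def Phi (θ : Statistics) (n : ℕ) (z : ℂ) : YangianModule n :=
  YangianModule.ofEvaluation (HAlg θ 1 n) (fun i j => opX θ 1 n 0 i * opD θ 1 n 0 j) (by
    intro i j k l
    have h := (opX_opD_relations θ 1 n).comm θ.sign_mul_sign 0 0 0 0 i j k l
    refine h.trans ?_
    simp only [true_and, eq_comm]) (θ.sign * z)

/-- The module `Φ'_z`: the space `H(ℂ^n)` with `T_ij(u) ↦ δ_ij - x_j ∂_i / (u + θ (z - 1))`. -/
def PhiPrime (θ : Statistics) (n : ℕ) (z : ℂ) : YangianModule n :=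
  YangianModule.ofEvaluation (HAlg θ 1 n) (fun i j => -(opX θ 1 n 0 j * opD θ 1 n 0 i)) (by
    intro i j k l
    have h := (opX_opD_relations θ 1 n).comm θ.sign_mul_sign 0 0 0 0 j i l k
    simp only [true_and] at h
    rw [neg_mul_neg, neg_mul_neg, h]
    split_ifs <;> simp [neg_add_eq_sub]) (θ.sign * (z - 1))

/-- The one-dimensional module `Ω_z`: `T_ij(u) ↦ δ_ij (u + z + 1) / (u + z)`. -/
def Omega (n : ℕ) (z : ℂ) : YangianModule n :=
  YangianModule.ofEvaluation ℂ (fun i j => if i = j then 1 else 0) (by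
    intro i j k l
    dsimp only
    split_ifs <;> simp_all) z

/-- The one-dimensional module `Ω'_z`: `T_ij(u) ↦ δ_ij (u + z - 1) / (u + z)`. -/
def OmegaPrime (n : ℕ) (z : ℂ) : YangianModule n :=
  YangianModule.ofEvaluation ℂ (fun i j => if i = j then -1 else 0) (by
    intro i j k l
    dsimp only
    split_ifs <;> simp_all) z

/-- `Ω*_z`, which is `Ω'_z` if `θ = 1` and `Ω_z` if `θ = -1`. -/
def OmegaStar (θ : Statistics) (n : ℕ) (z : ℂ) : YangianModule n :=
  match θ with
  | .commuting => OmegaPrime n z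
  | .anticommuting => Omega n z

end

end RationalYangian

/-!
The action of `Y(gl_n)` on the coinvariants is computed explicitly: it is a product of `m` matrices,
one for each tensor factor.

Let `v` be the highest weight vector of `M_μ`, and let `ζ(E_ab)` be the operators of `gl_m` on the
Fock space `H = H(ℂ^m ⊗ ℂ^n)`. As `M_μ` is freely generated by `v` over the enveloping algebra of
the lower triangular matrices (`Verma.exists_lower_map`, `Verma.induction_lower`), the space
`M_μ ⊗ H` is the direct sum of `v ⊗ H` and of `n · (M_μ ⊗ H)`. So there is a projection `φ` to `H`
with `φ (v ⊗ h) = h`, which identifies the coinvariants with `H`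
(`Verma.exists_coinvariant_map`). Freeness is the only place where a form of the
Poincaré-Birkhoff-Witt theorem is needed; it follows by induction on `m` from a realization of
`gl_(m+1)` by differential operators in `m` variables (`inducedE_relations`).

The coefficient of `T_ij(u)` at `u^(-r-1)` acts on `H` by `∑_ac S_ac q_ai p_cj`, where `S_ac` maps
`h` to `φ (X_ac^(r) v ⊗ h)`. Since `X^(r+1) = -θ X^(r) E'`, and since `E_cb` with `b < c` can be
moved to the left of `X_ab^(r)` and then acts as `-ζ(E_cb)` on the second factor, these operators
satisfy a recursion in `r` (`transferOp_succ`). The recursion says that the matrix `T(u)` is the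
ordered product over `c` of the matrices with the entries
`δ_ij + q_ci p_cj / (u + θ (μ_c - c))`, for `c = 0, …, m - 1`: this is `transferOp_monodromy`.
The commutators that arise from the reordering are what shifts `μ_c` by `-c`.

The Fock space is the tensor product of `m` copies of `H(ℂ^n)`. For `θ = -1` the operators of one
factor involve the parity operators of the previous ones, but these cancel in the products
`q_ci p_cj` (`HAlg.exists_tensor_equiv`, `HAlg.exists_monodromy_equiv`). As the comultiplication
corresponds to the product of matrices, the coinvariants are the tensor product of the modules with
a single matrix (`exists_tensorFamily_equiv`). By the same computation for `m = 1`, where there is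
nothing to divide out, these are the modules `E_{1,0}^z(M_t)` and `E_{0,1}^z(M_t)`, and part (i)
follows.

For part (ii), a factor with `c ≥ p` is `Φ_z` by definition. In a factor with `c < p` one has
`q_i p_j = -θ ∂_i x_j = -x_j ∂_i - θ δ_ij`, which splits off the scalar series of `Ω*`
(`fockFactor_true_isomorphic`). A module on which `T_ij(u)` acts as `δ_ij` times a scalar series is
cocentral (`YangianModule.ActsByScalars.isCocentral`); this is part (iii), and it allows one to
collect the factors `Ω*` on the left (`YangianModule.tensorFamily_tensor`).
-/

namespace RationalYangian

/-! ### Modules over the Yangian and their tensor products -/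

theorem Yangian.induction_gen {n : ℕ} {P : Yangian n → Prop}
    (algebraMap : ∀ c : ℂ, P (algebraMap ℂ (Yangian n) c)) (gen : ∀ r i j, P (Yangian.gen n r i j))
    (mul : ∀ x y, P x → P y → P (x * y)) (add : ∀ x y, P x → P y → P (x + y)) (y : Yangian n) :
    P y := by
  obtain ⟨x, rfl⟩ : ∃ x, Yangian.mk n x = y := RingQuot.mkAlgHom_surjective ℂ (YangianRel n) y
  induction x using FreeAlgebra.induction with
  | grade0 c => rw [AlgHom.commutes]; exact algebraMap c
  | grade1 x => exact gen x.1 x.2.1 x.2.2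
  | mul x y hx hy => rw [map_mul]; exact mul _ _ hx hy
  | add x y hx hy => rw [map_add]; exact add _ _ hx hy

/-- A linear map that intertwines the generators intertwines the whole action. -/
theorem YangianModule.map_act_of_gen {n : ℕ} {M N : YangianModule n}
    (f : M.carrier →ₗ[ℂ] N.carrier)
    (h : ∀ r i j w, f (M.act (Yangian.gen n r i j) w) = N.act (Yangian.gen n r i j) (f w))
    (y : Yangian n) (w : M.carrier) : f (M.act y w) = N.act y (f w) := by
  induction y using Yangian.induction_gen generalizing w with
  | algebraMap c => simp
  | gen r i j => exact h r i j w
  | mul x y hx hy => simp [hx, hy]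
  | add x y hx hy => simp [hx, hy]

theorem YangianModule.map_act_of_coeffT {n : ℕ} {M N : YangianModule n}
    (f : M.carrier →ₗ[ℂ] N.carrier)
    (h : ∀ r i j w, f (M.act (coeffT (Yangian.gen n) r i j) w)
      = N.act (coeffT (Yangian.gen n) r i j) (f w))
    (y : Yangian n) (w : M.carrier) : f (M.act y w) = N.act y (f w) :=
  YangianModule.map_act_of_gen f (fun r i j w => h (r + 1) i j w) y w

theorem sum_antidiagonal_assoc {M : Type*} [AddCommMonoid M] (r : ℕ) (f : ℕ → ℕ → ℕ → M) :
    ∑ x ∈ Finset.HasAntidiagonal.antidiagonal r,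
        ∑ z ∈ Finset.HasAntidiagonal.antidiagonal x.1, f z.1 z.2 x.2
      = ∑ x ∈ Finset.HasAntidiagonal.antidiagonal r,
        ∑ z ∈ Finset.HasAntidiagonal.antidiagonal x.2, f x.1 z.1 z.2 := by
  rw [Finset.sum_sigma', Finset.sum_sigma']
  refine Finset.sum_bij' (fun x _ => ⟨(x.2.1, x.2.2 + x.1.2), (x.2.2, x.1.2)⟩)
    (fun x _ => ⟨(x.1.1 + x.2.1, x.2.2), (x.1.1, x.2.1)⟩) ?_ ?_ ?_ ?_ ?_
  all_goals
    rintro ⟨⟨a, b⟩, c, d⟩ h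
    simp only [Finset.mem_sigma, Finset.HasAntidiagonal.mem_antidiagonal] at h
    obtain ⟨rfl, h⟩ := h
    subst h
    simp [add_assoc]

theorem Yangian.comul_coeffT (n r : ℕ) (i j : Fin n) :
    Yangian.comul n (coeffT (Yangian.gen n) r i j)
      = ∑ k, ∑ x ∈ Finset.HasAntidiagonal.antidiagonal r,
        coeffT (Yangian.gen n) x.1 i k ⊗ₜ[ℂ] coeffT (Yangian.gen n) x.2 k j := by
  cases r with
  | zero =>
    simp only [Finset.Nat.antidiagonal_zero, Finset.sum_singleton, coeffT]
    rw [Finset.sum_eq_single i (fun k _ hk => by rw [if_neg (Ne.symm hk), TensorProduct.zero_tmul])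
      (fun h => absurd (Finset.mem_univ i) h), if_pos rfl]
    split_ifs
    · rw [map_one]; rfl
    · rw [map_zero, TensorProduct.tmul_zero]
  | succ r => exact Yangian.lift_gen _ _ r i j

theorem YangianModule.tensor_act_coeffT {n : ℕ} (M N : YangianModule n) (r : ℕ) (i j : Fin n)
    (v : M.carrier) (w : N.carrier) :
    (M.tensor N).act (coeffT (Yangian.gen n) r i j) (v ⊗ₜ[ℂ] w : M.carrier ⊗[ℂ] N.carrier)
      = (∑ k, ∑ x ∈ Finset.HasAntidiagonal.antidiagonal r,
        M.act (coeffT (Yangian.gen n) x.1 i k) v ⊗ₜ[ℂ] N.act (coeffT (Yangian.gen n) x.2 k j) w :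
          M.carrier ⊗[ℂ] N.carrier) := by
  change Module.endTensorEndAlgHom (R := ℂ) (S := ℂ) (A := ℂ) (M := M.carrier) (N := N.carrier)
      (Algebra.TensorProduct.map M.act N.act (Yangian.comul n (coeffT (Yangian.gen n) r i j)))
      (v ⊗ₜ[ℂ] w) = _
  rw [Yangian.comul_coeffT]
  simp only [map_sum, LinearMap.sum_apply]
  rfl

namespace YangianModule

variable {n : ℕ}

theorem Isomorphic.refl (M : YangianModule n) : M.Isomorphic M :=
  ⟨LinearEquiv.refl ℂ _, fun _ _ => rfl⟩

theorem Isomorphic.symm {M N : YangianModule n} : M.Isomorphic N → N.Isomorphic M := by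
  rintro ⟨e, h⟩
  exact ⟨e.symm, fun y w => by rw [LinearEquiv.symm_apply_eq, h, e.apply_symm_apply]⟩

theorem Isomorphic.trans {M N P : YangianModule n} :
    M.Isomorphic N → N.Isomorphic P → M.Isomorphic P := by
  rintro ⟨e, h⟩ ⟨f, h'⟩
  exact ⟨e.trans f, fun y w => by simp only [LinearEquiv.trans_apply, h, h']⟩

theorem Isomorphic.of_eq {M N : YangianModule n} (h : M = N) : M.Isomorphic N :=
  h ▸ Isomorphic.refl M

theorem tensor_congr_act {M M' N N' : YangianModule n} (e : M.carrier ≃ₗ[ℂ] M'.carrier)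
    (f : N.carrier ≃ₗ[ℂ] N'.carrier) (he : ∀ y w, e (M.act y w) = M'.act y (e w))
    (hf : ∀ y w, f (N.act y w) = N'.act y (f w)) (y : Yangian n) (w : M.carrier ⊗[ℂ] N.carrier) :
    TensorProduct.congr e f ((M.tensor N).act y w)
      = (M'.tensor N').act y (TensorProduct.congr e f w) := by
  refine map_act_of_coeffT (M := M.tensor N) (N := M'.tensor N')
    (TensorProduct.congr e f).toLinearMap (fun r i j w => ?_) y w
  refine LinearMap.congr_fun (f := (TensorProduct.congr e f).toLinearMap
      ∘ₗ (M.tensor N).act (coeffT (Yangian.gen n) r i j))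
    (g := (M'.tensor N').act (coeffT (Yangian.gen n) r i j)
      ∘ₗ (TensorProduct.congr e f).toLinearMap) (TensorProduct.ext' fun v w => ?_) w
  refine (congrArg (TensorProduct.congr e f) (tensor_act_coeffT M N r i j v w)).trans
    (Eq.trans ?_ (tensor_act_coeffT M' N' r i j (e v) (f w)).symm)
  simp only [map_sum, TensorProduct.congr_tmul, he, hf]

theorem Isomorphic.tensor_congr {M M' N N' : YangianModule n} :
    M.Isomorphic M' → N.Isomorphic N' → (M.tensor N).Isomorphic (M'.tensor N') := by
  rintro ⟨e, he⟩ ⟨f, hf⟩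
  exact ⟨TensorProduct.congr e f, tensor_congr_act e f he hf⟩

/-- Coassociativity of the comultiplication, on the level of modules. -/
theorem tensor_assoc (M N P : YangianModule n) :
    ((M.tensor N).tensor P).Isomorphic (M.tensor (N.tensor P)) := by
  refine ⟨TensorProduct.assoc ℂ M.carrier N.carrier P.carrier, fun y w => ?_⟩
  refine map_act_of_coeffT (M := (M.tensor N).tensor P) (N := M.tensor (N.tensor P))
    (TensorProduct.assoc ℂ M.carrier N.carrier P.carrier).toLinearMap (fun r i j w => ?_) y w
  refine LinearMap.congr_fun
    (f := (TensorProduct.assoc ℂ M.carrier N.carrier P.carrier).toLinearMap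
      ∘ₗ ((M.tensor N).tensor P).act (coeffT (Yangian.gen n) r i j))
    (g := (M.tensor (N.tensor P)).act (coeffT (Yangian.gen n) r i j)
      ∘ₗ (TensorProduct.assoc ℂ M.carrier N.carrier P.carrier).toLinearMap)
    (TensorProduct.ext_threefold fun u v w => ?_) w
  have h1 : ((M.tensor N).tensor P).act (coeffT (Yangian.gen n) r i j)
      (((u ⊗ₜ[ℂ] v) ⊗ₜ[ℂ] w : (M.carrier ⊗[ℂ] N.carrier) ⊗[ℂ] P.carrier))
      = (∑ k, ∑ x ∈ Finset.HasAntidiagonal.antidiagonal r,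
          ∑ l, ∑ z ∈ Finset.HasAntidiagonal.antidiagonal x.1,
            (M.act (coeffT (Yangian.gen n) z.1 i l) u
              ⊗ₜ[ℂ] N.act (coeffT (Yangian.gen n) z.2 l k) v)
              ⊗ₜ[ℂ] P.act (coeffT (Yangian.gen n) x.2 k j) w :
          (M.carrier ⊗[ℂ] N.carrier) ⊗[ℂ] P.carrier) := by
    refine (tensor_act_coeffT (M.tensor N) P r i j _ w).trans ?_
    refine Finset.sum_congr rfl fun k _ => Finset.sum_congr rfl fun x _ => ?_
    rw [tensor_act_coeffT]
    exact (TensorProduct.sum_tmul _ _ _).trans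
      (Finset.sum_congr rfl fun l _ => TensorProduct.sum_tmul _ _ _)
  have h2 : (M.tensor (N.tensor P)).act (coeffT (Yangian.gen n) r i j)
      ((u ⊗ₜ[ℂ] (v ⊗ₜ[ℂ] w) : M.carrier ⊗[ℂ] (N.carrier ⊗[ℂ] P.carrier)))
      = (∑ l, ∑ x ∈ Finset.HasAntidiagonal.antidiagonal r,
          ∑ k, ∑ z ∈ Finset.HasAntidiagonal.antidiagonal x.2,
            M.act (coeffT (Yangian.gen n) x.1 i l) u
              ⊗ₜ[ℂ] (N.act (coeffT (Yangian.gen n) z.1 l k) v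
              ⊗ₜ[ℂ] P.act (coeffT (Yangian.gen n) z.2 k j) w) :
          M.carrier ⊗[ℂ] (N.carrier ⊗[ℂ] P.carrier)) := by
    refine (tensor_act_coeffT M (N.tensor P) r i j u _).trans ?_
    refine Finset.sum_congr rfl fun k _ => Finset.sum_congr rfl fun x _ => ?_
    rw [tensor_act_coeffT]
    exact (TensorProduct.tmul_sum _ _ _).trans
      (Finset.sum_congr rfl fun l _ => TensorProduct.tmul_sum _ _ _)
  refine (congrArg (TensorProduct.assoc ℂ M.carrier N.carrier P.carrier) h1).trans
    (Eq.trans ?_ h2.symm)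
  simp only [map_sum, TensorProduct.assoc_tmul]
  have e1 : ∀ k, (∑ x ∈ Finset.HasAntidiagonal.antidiagonal r,
      ∑ l, ∑ z ∈ Finset.HasAntidiagonal.antidiagonal x.1,
        M.act (coeffT (Yangian.gen n) z.1 i l) u ⊗ₜ[ℂ] (N.act (coeffT (Yangian.gen n) z.2 l k) v
          ⊗ₜ[ℂ] P.act (coeffT (Yangian.gen n) x.2 k j) w))
      = ∑ l, ∑ x ∈ Finset.HasAntidiagonal.antidiagonal r,
        ∑ z ∈ Finset.HasAntidiagonal.antidiagonal x.2,
        M.act (coeffT (Yangian.gen n) x.1 i l) u ⊗ₜ[ℂ] (N.act (coeffT (Yangian.gen n) z.1 l k) v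
          ⊗ₜ[ℂ] P.act (coeffT (Yangian.gen n) z.2 k j) w) := by
    intro k
    rw [Finset.sum_comm]
    refine Finset.sum_congr rfl fun l _ => ?_
    exact sum_antidiagonal_assoc r fun a b c =>
      M.act (coeffT (Yangian.gen n) a i l) u ⊗ₜ[ℂ] (N.act (coeffT (Yangian.gen n) b l k) v
          ⊗ₜ[ℂ] P.act (coeffT (Yangian.gen n) c k j) w)
  simp only [e1]
  rw [Finset.sum_comm]
  exact Finset.sum_congr rfl fun l _ => Finset.sum_comm

/-- `T_ij(u)` acts on `M` as the scalar series `δ_ij ∑_r c_r u^(-r)`. -/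
def ActsByScalars (M : YangianModule n) (c : ℕ → ℂ) : Prop :=
  ∀ r i j, M.act (coeffT (Yangian.gen n) r i j) = if i = j then algebraMap ℂ _ (c r) else 0

theorem ActsByScalars.tensor_left {O : YangianModule n} {c : ℕ → ℂ} (h : O.ActsByScalars c)
    (M : YangianModule n) (r : ℕ) (i j : Fin n) (a : O.carrier) (w : M.carrier) :
    (O.tensor M).act (coeffT (Yangian.gen n) r i j) (a ⊗ₜ[ℂ] w : O.carrier ⊗[ℂ] M.carrier)
      = (∑ x ∈ Finset.HasAntidiagonal.antidiagonal r,
        a ⊗ₜ[ℂ] (c x.1 • M.act (coeffT (Yangian.gen n) x.2 i j) w) :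
          O.carrier ⊗[ℂ] M.carrier) := by
  refine (tensor_act_coeffT O M r i j a w).trans ?_
  rw [Finset.sum_eq_single i]
  · refine Finset.sum_congr rfl fun x _ => ?_
    rw [h, if_pos rfl, Module.algebraMap_end_apply, TensorProduct.smul_tmul]
  · intro k _ hk
    refine Finset.sum_eq_zero fun x _ => ?_
    rw [h, if_neg (Ne.symm hk), LinearMap.zero_apply, TensorProduct.zero_tmul]
  · exact fun h => absurd (Finset.mem_univ i) h

theorem ActsByScalars.tensor_right {O : YangianModule n} {c : ℕ → ℂ} (h : O.ActsByScalars c)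
    (M : YangianModule n) (r : ℕ) (i j : Fin n) (a : O.carrier) (w : M.carrier) :
    (M.tensor O).act (coeffT (Yangian.gen n) r i j) (w ⊗ₜ[ℂ] a : M.carrier ⊗[ℂ] O.carrier)
      = (∑ x ∈ Finset.HasAntidiagonal.antidiagonal r,
        (c x.1 • M.act (coeffT (Yangian.gen n) x.2 i j) w) ⊗ₜ[ℂ] a :
          M.carrier ⊗[ℂ] O.carrier) := by
  refine (tensor_act_coeffT M O r i j w a).trans ?_
  rw [Finset.sum_eq_single j]
  · rw [← Finset.Nat.sum_antidiagonal_swap]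
    refine Finset.sum_congr rfl fun x _ => ?_
    rw [h, if_pos rfl, Module.algebraMap_end_apply, TensorProduct.tmul_smul,
      TensorProduct.smul_tmul']
    rfl
  · intro k _ hk
    refine Finset.sum_eq_zero fun x _ => ?_
    rw [h, if_neg hk, LinearMap.zero_apply, TensorProduct.tmul_zero]
  · exact fun h => absurd (Finset.mem_univ j) h

theorem ActsByScalars.isCocentral {O : YangianModule n} {c : ℕ → ℂ} (h : O.ActsByScalars c) :
    O.IsCocentral := by
  intro M y w
  refine map_act_of_coeffT (M := M.tensor O) (N := O.tensor M)
    (TensorProduct.comm ℂ M.carrier O.carrier).toLinearMap (fun r i j w => ?_) y w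
  refine LinearMap.congr_fun (f := (TensorProduct.comm ℂ M.carrier O.carrier).toLinearMap
      ∘ₗ (M.tensor O).act (coeffT (Yangian.gen n) r i j))
    (g := (O.tensor M).act (coeffT (Yangian.gen n) r i j)
      ∘ₗ (TensorProduct.comm ℂ M.carrier O.carrier).toLinearMap)
    (TensorProduct.ext' fun v w => ?_) w
  refine (congrArg (TensorProduct.comm ℂ M.carrier O.carrier) (h.tensor_right M r i j w v)).trans
    (Eq.trans ?_ (h.tensor_left M r i j w v).symm)
  simp only [map_sum, TensorProduct.comm_tmul]

theorem trivial_actsByScalars (n : ℕ) :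
    (YangianModule.trivial n).ActsByScalars fun r => if r = 0 then 1 else 0 := by
  intro r i j
  change Algebra.ofId ℂ (Module.End ℂ ℂ) (Yangian.counit n _) = _
  rw [map_coeffT (Yangian.counit n), show (fun r i j => Yangian.counit n (Yangian.gen n r i j))
    = fun _ _ _ => 0 from funext₃ fun r i j => Yangian.lift_gen _ _ r i j]
  cases r <;> simp only [coeffT] <;> split_ifs <;> simp_all [Algebra.ofId_apply] <;>
    rfl

theorem trivial_tensor (M : YangianModule n) :
    ((YangianModule.trivial n).tensor M).Isomorphic M := by
  refine ⟨TensorProduct.lid ℂ M.carrier, fun y w => ?_⟩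
  refine map_act_of_coeffT (M := (YangianModule.trivial n).tensor M) (N := M)
    (TensorProduct.lid ℂ M.carrier).toLinearMap (fun r i j w => ?_) y w
  refine LinearMap.congr_fun (f := (TensorProduct.lid ℂ M.carrier).toLinearMap
      ∘ₗ ((YangianModule.trivial n).tensor M).act (coeffT (Yangian.gen n) r i j))
    (g := M.act (coeffT (Yangian.gen n) r i j) ∘ₗ (TensorProduct.lid ℂ M.carrier).toLinearMap)
    (TensorProduct.ext' fun (v : ℂ) w => ?_) w
  refine (congrArg (TensorProduct.lid ℂ M.carrier)
    ((trivial_actsByScalars n).tensor_left M r i j v w)).trans ?_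
  rw [Finset.sum_eq_single (0, r)]
  · rw [if_pos rfl, one_smul]
    exact ((TensorProduct.lid_tmul _ _).trans (LinearMap.map_smul _ v w).symm)
  · rintro ⟨a, b⟩ hx hne
    have : a ≠ 0 := by
      rintro rfl
      simp at hx
      exact hne (by rw [hx])
    rw [if_neg this, zero_smul]
    exact TensorProduct.tmul_zero _ _
  · simp

theorem IsCocentral.isomorphic {O : YangianModule n} (h : O.IsCocentral) (M : YangianModule n) :
    (M.tensor O).Isomorphic (O.tensor M) :=
  ⟨TensorProduct.comm ℂ M.carrier O.carrier, h M⟩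

theorem tensorFamily_congr {m : ℕ} {F G : Fin m → YangianModule n}
    (h : ∀ a, (F a).Isomorphic (G a)) : (tensorFamily m F).Isomorphic (tensorFamily m G) := by
  induction m with
  | zero => exact Isomorphic.refl _
  | succ m ih => exact (h 0).tensor_congr (ih fun a => h a.succ)

/-- A tensor product of cocentral modules can be moved past any module. -/
theorem tensor_tensorFamily_comm {m : ℕ} {F : Fin m → YangianModule n}
    (h : ∀ a, (F a).IsCocentral) (M : YangianModule n) :
    (M.tensor (tensorFamily m F)).Isomorphic ((tensorFamily m F).tensor M) := by
  induction m generalizing M with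
  | zero => exact (trivial_actsByScalars n).isCocentral.isomorphic M
  | succ m ih =>
    refine (tensor_assoc _ _ _).symm.trans ?_
    refine (((h 0).isomorphic M).tensor_congr (Isomorphic.refl _)).trans ?_
    refine (tensor_assoc _ _ _).trans ?_
    refine ((Isomorphic.refl _).tensor_congr (ih (fun a => h a.succ) M)).trans ?_
    exact (tensor_assoc _ _ _).symm

/-- The cocentral factors of a tensor product can be collected on the left. -/
theorem tensorFamily_tensor {m : ℕ} {F G : Fin m → YangianModule n}
    (h : ∀ a, (F a).IsCocentral) : (tensorFamily m fun a => (F a).tensor (G a)).Isomorphic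
      ((tensorFamily m F).tensor (tensorFamily m G)) := by
  induction m with
  | zero => exact (trivial_tensor _).symm
  | succ m ih =>
    refine ((Isomorphic.refl _).tensor_congr (ih fun a => h a.succ)).trans ?_
    refine (tensor_assoc _ _ _).trans ?_
    refine ((Isomorphic.refl _).tensor_congr ((tensor_assoc _ _ _).symm.trans
      (((tensor_tensorFamily_comm (fun a => h a.succ) (G 0)).tensor_congr
        (Isomorphic.refl _)).trans (tensor_assoc _ _ _)))).trans ?_
    exact (tensor_assoc _ _ _).symm

theorem tensorFamily_add (F : ℕ → YangianModule n) (p q : ℕ) :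
    (tensorFamily (p + q) fun a => F a).Isomorphic
      ((tensorFamily p fun a => F a).tensor (tensorFamily q fun b => F (p + b : ℕ))) := by
  induction p generalizing F with
  | zero =>
    rw [Nat.zero_add]
    simp only [Nat.zero_add]
    exact (trivial_tensor (tensorFamily q fun b => F b)).symm
  | succ p ih =>
    rw [Nat.succ_add_eq_add_succ, Nat.add_succ]
    refine ((Isomorphic.refl _).tensor_congr (ih fun a => F (a + 1))).trans ?_
    refine (tensor_assoc _ _ _).symm.trans (Isomorphic.of_eq ?_)
    simp only [tensorFamily, Fin.val_succ, Fin.val_zero, Nat.add_right_comm]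

end YangianModule


/-! ### The Fock space `H(ℂ^m ⊗ ℂ^n)` -/

theorem opD_one (θ : Statistics) (m n : ℕ) (a : Fin m) (i : Fin n) : opD θ m n a i 1 = 0 := by
  cases θ with
  | commuting =>
    exact Derivation.map_one_eq_zero (MvPolynomial.pderiv (R := ℂ) ((a, i) : Fin m × Fin n))
  | anticommuting =>
    exact CliffordAlgebra.contractLeft_one (Q := (0 : QuadraticForm ℂ (Fin m × Fin n → ℂ)))
      (LinearMap.proj (R := ℂ) (φ := fun _ : Fin m × Fin n => ℂ) (a, i))

/-- `H(ℂ^m ⊗ ℂ^n)` is spanned by the vectors obtained from `1` by the operators `x_ai`. -/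
theorem HAlg.induction {θ : Statistics} {m n : ℕ} {P : HAlg θ m n → Prop} (one : P 1)
    (add : ∀ f g, P f → P g → P (f + g)) (smul : ∀ (c : ℂ) f, P f → P (c • f))
    (opX : ∀ a i f, P f → P (opX θ m n a i f)) (f : HAlg θ m n) : P f := by
  have zero : P 0 := by simpa using smul 0 1 one
  cases θ with
  | commuting =>
    refine @MvPolynomial.induction_on ℂ (Fin m × Fin n) _ P f (fun c => ?_) (fun f g => add f g)
      (fun f s hf => ?_)
    · have h := smul c 1 one
      rwa [show c • (1 : HAlg .commuting m n) = (MvPolynomial.C c : MvPolynomial _ ℂ) from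
        (MvPolynomial.C_eq_smul_one (σ := Fin m × Fin n) (a := c)).symm] at h
    · have h := opX s.1 s.2 f hf
      rw [mul_comm]
      exact h
  | anticommuting =>
    refine CliffordAlgebra.left_induction (P := P) _ (fun c => ?_)
      (fun f g => add f g) (fun f v hf => ?_) f
    · have h := smul c 1 one
      rwa [show c • (1 : HAlg .anticommuting m n) = algebraMap ℂ _ c from
        (Algebra.algebraMap_eq_smul_one c).symm] at h
    · have hv : (CliffordAlgebra.ι (0 : QuadraticForm ℂ (Fin m × Fin n → ℂ)) v) * f
          = ∑ s : Fin m × Fin n, v s •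
            (RationalYangian.opX .anticommuting m n s.1 s.2 f : HAlg .anticommuting m n) := by
        have hv : v = ∑ s : Fin m × Fin n, v s • (Pi.single s 1 : Fin m × Fin n → ℂ) := by
          funext t
          simp [Finset.sum_apply, Pi.single_apply]
        conv_lhs => rw [hv, map_sum, Finset.sum_mul]
        refine Finset.sum_congr rfl fun s _ => ?_
        rw [map_smul, smul_mul_assoc]
        rfl
      rw [hv]
      exact Finset.sum_induction _ P add zero fun s _ => smul _ _ (opX _ _ _ hf)

theorem exists_mvPolynomial_lift {A σ : Type*} [Ring A] [Algebra ℂ A] (y : σ → A)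
    (hy : ∀ s t, y s * y t = y t * y s) :
    ∃ f : MvPolynomial σ ℂ →ₐ[ℂ] A, ∀ s, f (MvPolynomial.X s) = y s := by
  have hc : ∀ a ∈ Set.range y, ∀ b ∈ Set.range y, a * b = b * a := by
    rintro _ ⟨s, rfl⟩ _ ⟨t, rfl⟩
    exact hy s t
  have := Algebra.isMulCommutative_adjoin ℂ hc
  let _ : CommRing (Algebra.adjoin ℂ (Set.range y)) :=
    { (inferInstance : Ring (Algebra.adjoin ℂ (Set.range y))) with
      mul_comm := fun a b => (IsMulCommutative.is_comm (M := Algebra.adjoin ℂ (Set.range y))).comm a b }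
  refine ⟨(Algebra.adjoin ℂ (Set.range y)).val.comp
    (MvPolynomial.aeval fun s => ⟨y s, Algebra.subset_adjoin ⟨s, rfl⟩⟩), fun s => ?_⟩
  rw [AlgHom.comp_apply, MvPolynomial.aeval_X]
  rfl

/-- The universal property of `H(ℂ^m ⊗ ℂ^n)`: elements `y_ai` with `y_ai y_bj = θ y_bj y_ai` give
an algebra homomorphism `x_ai ↦ y_ai`. -/
theorem HAlg.exists_lift {θ : Statistics} {m n : ℕ} {A : Type*} [Ring A] [Algebra ℂ A]
    (y : Fin m → Fin n → A) (hy : ∀ a b i j, y a i * y b j = θ.sign • (y b j * y a i)) :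
    ∃ φ : HAlg θ m n →ₐ[ℂ] A, ∀ a i f, φ (opX θ m n a i f) = y a i * φ f := by
  cases θ with
  | commuting =>
    obtain ⟨φ, hφ⟩ := exists_mvPolynomial_lift (fun s : Fin m × Fin n => y s.1 s.2)
      (fun s t => by simpa [Statistics.sign] using hy s.1 t.1 s.2 t.2)
    exact ⟨φ, fun a i f => (map_mul φ _ _).trans (congrArg (· * φ f) (hφ (a, i)))⟩
  | anticommuting =>
    let ℓ : (Fin m × Fin n → ℂ) →ₗ[ℂ] A :=
      ∑ s, (LinearMap.proj s : (Fin m × Fin n → ℂ) →ₗ[ℂ] ℂ).smulRight (y s.1 s.2)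
    have hℓ : ∀ v, ℓ v = ∑ s, v s • y s.1 s.2 := fun v => by simp [ℓ]
    have hsq : ∀ v, ℓ v * ℓ v = 0 := by
      intro v
      have h : ℓ v * ℓ v = -(ℓ v * ℓ v) := by
        rw [hℓ, Finset.sum_mul_sum]
        conv_rhs => rw [Finset.sum_comm]
        rw [← Finset.sum_neg_distrib]
        refine Finset.sum_congr rfl fun s _ => ?_
        rw [← Finset.sum_neg_distrib]
        refine Finset.sum_congr rfl fun t _ => ?_
        rw [smul_mul_smul_comm, smul_mul_smul_comm, hy s.1 t.1, mul_comm (v s)]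
        simp [Statistics.sign]
      have h2 : (2 : ℂ) • (ℓ v * ℓ v) = 0 := by
        rw [two_smul]
        nth_rewrite 2 [h]
        exact add_neg_cancel _
      exact (smul_eq_zero_iff_right two_ne_zero).1 h2
    refine ⟨ExteriorAlgebra.lift ℂ ⟨ℓ, hsq⟩, fun a i f => ?_⟩
    refine (map_mul (ExteriorAlgebra.lift ℂ ⟨ℓ, hsq⟩) _ _).trans ?_
    refine congrArg (· * ExteriorAlgebra.lift ℂ ⟨ℓ, hsq⟩ f) ?_
    refine (ExteriorAlgebra.lift_ι_apply (R := ℂ) ℓ hsq _).trans ?_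
    rw [hℓ, Finset.sum_eq_single (a, i)] <;> simp +contextual

/-- A vacuum vector in a representation of the oscillator relations generates an image of the
Fock space. -/
theorem HAlg.exists_fock_map {θ : Statistics} {m n : ℕ} {W : Type*} [AddCommGroup W] [Module ℂ W]
    {x d : Fin m → Fin n → Module.End ℂ W} (h : OscillatorRelations θ.sign x d) (w : W)
    (hw : ∀ a i, d a i w = 0) :
    ∃ R : HAlg θ m n →ₗ[ℂ] W, R 1 = w ∧ (∀ a i f, R (opX θ m n a i f) = x a i (R f)) ∧
      ∀ a i f, R (opD θ m n a i f) = d a i (R f) := by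
  obtain ⟨φ, hφ⟩ := HAlg.exists_lift (θ := θ) x h.qq
  let R : HAlg θ m n →ₗ[ℂ] W := (LinearMap.applyₗ w) ∘ₗ φ.toLinearMap
  have hR : ∀ f, R f = φ f w := fun _ => rfl
  have hx : ∀ a i f, R (opX θ m n a i f) = x a i (R f) := by
    intro a i f
    rw [hR, hφ, hR, Module.End.mul_apply]
  refine ⟨R, by rw [hR, map_one, Module.End.one_apply], hx, fun a i f => ?_⟩
  induction f using HAlg.induction with
  | one => rw [opD_one, map_zero, hR, map_one, Module.End.one_apply, hw]
  | add f g hf hg => simp only [map_add, hf, hg]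
  | smul c f hf => simp only [map_smul, hf]
  | opX b j f hf =>
    have h1 := LinearMap.congr_fun ((opX_opD_relations θ m n).pq a b i j) f
    have h2 := LinearMap.congr_fun (h.pq a b i j) (R f)
    simp only [LinearMap.sub_apply, LinearMap.smul_apply, Module.End.mul_apply] at h1 h2
    rw [hx, eq_add_of_sub_eq h1, eq_add_of_sub_eq h2, map_add, map_smul, hx, hf]
    congr 1
    split_ifs <;> simp

/-- The parity operator: it commutes with `x_ai` and `∂_ai` up to the sign `θ`. -/
theorem HAlg.exists_parity (θ : Statistics) (m n : ℕ) :
    ∃ π : Module.End ℂ (HAlg θ m n), π 1 = 1 ∧ π * π = 1 ∧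
      (∀ a i, π * opX θ m n a i = θ.sign • (opX θ m n a i * π)) ∧
      ∀ a i, π * opD θ m n a i = θ.sign • (opD θ m n a i * π) := by
  have hs := θ.sign_mul_sign
  have h := opX_opD_relations θ m n
  have h' : OscillatorRelations θ.sign (fun a i => θ.sign • opX θ m n a i)
      (fun a i => θ.sign • opD θ m n a i) := by
    refine ⟨fun a b i j => ?_, fun a b i j => ?_, fun a b i j => ?_⟩ <;>
      simp only [smul_mul_smul_comm, hs, one_smul]
    · exact h.qq a b i j
    · exact h.pp a b i j
    · exact h.pq a b i j
  obtain ⟨π, h1, hx, hd⟩ := HAlg.exists_fock_map h' 1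
    (fun a i => by rw [LinearMap.smul_apply, opD_one, smul_zero])
  refine ⟨π, h1, LinearMap.ext fun f => ?_, fun a i => LinearMap.ext fun f => hx a i f,
    fun a i => LinearMap.ext fun f => hd a i f⟩
  rw [Module.End.mul_apply, Module.End.one_apply]
  induction f using HAlg.induction with
  | one => rw [h1, h1]
  | add f g hf hg => rw [map_add, map_add, hf, hg]
  | smul c f hf => rw [map_smul, map_smul, hf]
  | opX a i f hf =>
    rw [hx, LinearMap.smul_apply, map_smul, hx, LinearMap.smul_apply, hf, smul_smul, hs, one_smul]

/-- Two commuting oscillator families are combined into one: in the second family every element is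
multiplied by a parity element of the first one. -/
theorem OscillatorRelations.cons {A : Type*} [Ring A] [Algebra ℂ A] {θ : ℂ} (hs : θ * θ = 1)
    {m n : ℕ} {x d : Fin 1 → Fin n → A} {y e : Fin m → Fin n → A} {π : A}
    (h : OscillatorRelations θ x d) (h' : OscillatorRelations θ y e) (hπ : π * π = 1)
    (hx : ∀ i, π * x 0 i = θ • (x 0 i * π)) (hd : ∀ i, π * d 0 i = θ • (d 0 i * π))
    (hy : ∀ a i, Commute π (y a i)) (he : ∀ a i, Commute π (e a i))
    (hxy : ∀ i a j, Commute (x 0 i) (y a j)) (hxe : ∀ i a j, Commute (x 0 i) (e a j))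
    (hdy : ∀ i a j, Commute (d 0 i) (y a j)) (hde : ∀ i a j, Commute (d 0 i) (e a j)) :
    OscillatorRelations θ (Fin.cons (x 0) fun a i => π * y a i : Fin (m + 1) → Fin n → A)
      (Fin.cons (d 0) fun a i => π * e a i) := by
  -- the relation between an element `u` of the first family and an element `v` of the second one
  have h1 : ∀ u v : A, π * u = θ • (u * π) → Commute u v → u * (π * v) = θ • ((π * v) * u) := by
    intro u v hu huv
    rw [mul_assoc, ← huv.eq, ← mul_assoc π, hu, smul_mul_assoc, smul_smul, hs, one_smul, mul_assoc]
  have h1' : ∀ u v : A, π * u = θ • (u * π) → Commute u v → (π * v) * u = θ • (u * (π * v)) := by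
    intro u v hu huv
    rw [h1 u v hu huv, smul_smul, hs, one_smul]
  have h2 : ∀ u v : A, Commute π u → (π * u) * (π * v) = u * v := by
    intro u v hu
    rw [hu.eq, mul_assoc, ← mul_assoc π, hπ, one_mul]
  refine ⟨fun a b i j => ?_, fun a b i j => ?_, fun a b i j => ?_⟩
  · refine Fin.cases ?_ (fun a => ?_) a <;> refine Fin.cases ?_ (fun b => ?_) b <;>
      simp only [Fin.cons_zero, Fin.cons_succ]
    · exact h.qq 0 0 i j
    · exact h1 _ _ (hx i) (hxy i b j)
    · exact h1' _ _ (hx j) (hxy j a i)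
    · rw [h2 _ _ (hy a i), h2 _ _ (hy b j)]
      exact h'.qq a b i j
  · refine Fin.cases ?_ (fun a => ?_) a <;> refine Fin.cases ?_ (fun b => ?_) b <;>
      simp only [Fin.cons_zero, Fin.cons_succ]
    · exact h.pp 0 0 i j
    · exact h1 _ _ (hd i) (hde i b j)
    · exact h1' _ _ (hd j) (hde j a i)
    · rw [h2 _ _ (he a i), h2 _ _ (he b j)]
      exact h'.pp a b i j
  · refine Fin.cases ?_ (fun a => ?_) a <;> refine Fin.cases ?_ (fun b => ?_) b <;>
      simp only [Fin.cons_zero, Fin.cons_succ]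
    · simpa using h.pq 0 0 i j
    · rw [h1 _ _ (hd i) (hdy i b j), sub_self, if_neg (fun h => absurd h.1 (Fin.succ_ne_zero b).symm)]
    · rw [h1' _ _ (hx j) (hxe j a i), sub_self, if_neg (fun h => absurd h.1 (Fin.succ_ne_zero a))]
    · rw [h2 _ _ (he a i), h2 _ _ (hy b j), h'.pq]
      simp only [Fin.succ_inj]

/-- The decomposition `H(ℂ^(m+1) ⊗ ℂ^n) = H(ℂ^n) ⊗ H(ℂ^m ⊗ ℂ^n)`: the variables of the first factor
are the `x_0i`; the operators of the second factor come with the parity `π` of the first one. -/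
theorem HAlg.exists_tensor_equiv (θ : Statistics) (m n : ℕ) :
    ∃ (R : HAlg θ (m + 1) n ≃ₗ[ℂ] HAlg θ 1 n ⊗[ℂ] HAlg θ m n) (π : Module.End ℂ (HAlg θ 1 n)),
      π * π = 1 ∧
      (∀ i f, R (opX θ (m + 1) n 0 i f) = TensorProduct.map (opX θ 1 n 0 i) 1 (R f)) ∧
      (∀ i f, R (opD θ (m + 1) n 0 i f) = TensorProduct.map (opD θ 1 n 0 i) 1 (R f)) ∧
      (∀ a i f, R (opX θ (m + 1) n a.succ i f) = TensorProduct.map π (opX θ m n a i) (R f)) ∧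
      ∀ a i f, R (opD θ (m + 1) n a.succ i f) = TensorProduct.map π (opD θ m n a i) (R f) := by
  have hs := θ.sign_mul_sign
  obtain ⟨π, hπ1, hππ, hπx, hπd⟩ := HAlg.exists_parity θ 1 n
  have hmul : ∀ (a b : Module.End ℂ (HAlg θ 1 n)) (c e : Module.End ℂ (HAlg θ m n)),
      (TensorProduct.map a c * TensorProduct.map b e : Module.End ℂ (HAlg θ 1 n ⊗[ℂ] HAlg θ m n))
        = TensorProduct.map (a * b) (c * e) := fun a b c e => (TensorProduct.map_mul a b c e).symm
  have hone : (TensorProduct.map 1 1 : Module.End ℂ (HAlg θ 1 n ⊗[ℂ] HAlg θ m n)) = 1 :=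
    TensorProduct.map_one
  have hl := (opX_opD_relations θ 1 n)
  have hr := (opX_opD_relations θ m n)
  have hl' : OscillatorRelations θ.sign
      (fun a i => (TensorProduct.map (opX θ 1 n a i) 1 :
        Module.End ℂ (HAlg θ 1 n ⊗[ℂ] HAlg θ m n)))
      (fun a i => TensorProduct.map (opD θ 1 n a i) 1) := by
    refine ⟨fun a b i j => ?_, fun a b i j => ?_, fun a b i j => ?_⟩
    · simp only [hmul, hl.qq a b i j, TensorProduct.map_smul_left]
    · simp only [hmul, hl.pp a b i j, TensorProduct.map_smul_left]
    · simp only [hmul, eq_add_of_sub_eq (hl.pq a b i j), TensorProduct.map_add_left,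
        TensorProduct.map_smul_left, add_sub_cancel_right, one_mul]
      split_ifs
      · exact hone
      · exact TensorProduct.map_zero_left _
  have hr' : OscillatorRelations θ.sign
      (fun a i => (TensorProduct.map 1 (opX θ m n a i) :
        Module.End ℂ (HAlg θ 1 n ⊗[ℂ] HAlg θ m n)))
      (fun a i => TensorProduct.map 1 (opD θ m n a i)) := by
    refine ⟨fun a b i j => ?_, fun a b i j => ?_, fun a b i j => ?_⟩
    · simp only [hmul, hr.qq a b i j, TensorProduct.map_smul_right]
    · simp only [hmul, hr.pp a b i j, TensorProduct.map_smul_right]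
    · simp only [hmul, eq_add_of_sub_eq (hr.pq a b i j), TensorProduct.map_add_right,
        TensorProduct.map_smul_right, add_sub_cancel_right, one_mul]
      split_ifs
      · exact hone
      · exact TensorProduct.map_zero_right _
  have hrel := hl'.cons (π := TensorProduct.map π 1) hs hr' (by rw [hmul, hππ, one_mul, hone])
    (fun i => by simp only [hmul, hπx, TensorProduct.map_smul_left])
    (fun i => by simp only [hmul, hπd, TensorProduct.map_smul_left])
    (fun a i => by simp only [Commute, SemiconjBy, hmul, one_mul, mul_one])
    (fun a i => by simp only [Commute, SemiconjBy, hmul, one_mul, mul_one])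
    (fun a i => by simp only [Commute, SemiconjBy, hmul, one_mul, mul_one, implies_true])
    (fun a i => by simp only [Commute, SemiconjBy, hmul, one_mul, mul_one, implies_true])
    (fun a i => by simp only [Commute, SemiconjBy, hmul, one_mul, mul_one, implies_true])
    (fun a i => by simp only [Commute, SemiconjBy, hmul, one_mul, mul_one, implies_true])
  obtain ⟨R, hR1, hRx, hRd⟩ := HAlg.exists_fock_map hrel (1 ⊗ₜ[ℂ] 1) (by
    intro a i
    refine Fin.cases ?_ (fun a => ?_) a <;> simp only [Fin.cons_zero, Fin.cons_succ]
    · rw [TensorProduct.map_tmul, opD_one, TensorProduct.zero_tmul]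
    · rw [hmul, TensorProduct.map_tmul, one_mul, opD_one, TensorProduct.tmul_zero])
  have hRx0 : ∀ i f, R (opX θ (m + 1) n 0 i f) = TensorProduct.map (opX θ 1 n 0 i) 1 (R f) :=
    fun i f => hRx 0 i f
  have hRd0 : ∀ i f, R (opD θ (m + 1) n 0 i f) = TensorProduct.map (opD θ 1 n 0 i) 1 (R f) :=
    fun i f => hRd 0 i f
  have hRxs : ∀ a i f, R (opX θ (m + 1) n a.succ i f)
      = TensorProduct.map π (opX θ m n a i) (R f) := by
    intro a i f
    rw [hRx, Fin.cons_succ, hmul, mul_one, one_mul]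
  have hRds : ∀ a i f, R (opD θ (m + 1) n a.succ i f)
      = TensorProduct.map π (opD θ m n a i) (R f) := by
    intro a i f
    rw [hRd, Fin.cons_succ, hmul, mul_one, one_mul]
  -- the inverse map `f ⊗ g ↦ f(x_0) g(x_1, …, x_m)`
  have hX := opX_opD_relations θ (m + 1) n
  obtain ⟨φ, hφ⟩ := HAlg.exists_lift (θ := θ) (fun (_ : Fin 1) i => opX θ (m + 1) n 0 i)
    (fun _ _ i j => hX.qq 0 0 i j)
  obtain ⟨ψ, hψ⟩ := HAlg.exists_lift (θ := θ) (fun (a : Fin m) i => opX θ (m + 1) n a.succ i)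
    (fun a b i j => hX.qq a.succ b.succ i j)
  let L : HAlg θ 1 n ⊗[ℂ] HAlg θ m n →ₗ[ℂ] HAlg θ (m + 1) n := TensorProduct.lift
    (LinearMap.compl₂ φ.toLinearMap ((LinearMap.applyₗ 1) ∘ₗ ψ.toLinearMap))
  have hL : ∀ f g, L (f ⊗ₜ[ℂ] g) = φ f (ψ g 1) := fun f g => rfl
  have hφπ : ∀ (a : Fin m) i f, φ (π f) * opX θ (m + 1) n a.succ i
      = opX θ (m + 1) n a.succ i * φ f := by
    intro a i f
    induction f using HAlg.induction with
    | one => rw [hπ1, map_one, one_mul, mul_one]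
    | add f g hf hg => simp only [map_add, add_mul, mul_add, hf, hg]
    | smul c f hf => simp only [map_smul, smul_mul_assoc, mul_smul_comm, hf]
    | opX b j f hf =>
      have h1 : π (opX θ 1 n b j f) = θ.sign • opX θ 1 n b j (π f) :=
        LinearMap.congr_fun (hπx b j) f
      rw [h1, map_smul, hφ, hφ, smul_mul_assoc, mul_assoc, hf, ← mul_assoc, hX.qq 0 a.succ j i,
        smul_mul_assoc, smul_smul, hs, one_smul, mul_assoc]
  have hLx0 : ∀ i t, L (TensorProduct.map (opX θ 1 n 0 i) 1 t) = opX θ (m + 1) n 0 i (L t) := by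
    intro i t
    induction t with
    | zero => simp only [map_zero]
    | add s t hs ht => simp only [map_add, hs, ht]
    | tmul f g => rw [TensorProduct.map_tmul, hL, hL, hφ]; rfl
  have hLxs : ∀ a i t, L (TensorProduct.map π (opX θ m n a i) t)
      = opX θ (m + 1) n a.succ i (L t) := by
    intro a i t
    induction t with
    | zero => simp only [map_zero]
    | add s t hs ht => simp only [map_add, hs, ht]
    | tmul f g =>
      rw [TensorProduct.map_tmul, hL, hL, hψ, Module.End.mul_apply]
      exact LinearMap.congr_fun (hφπ a i f) (ψ g 1)
  have hL1 : L (1 ⊗ₜ[ℂ] 1) = 1 := by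
    rw [hL, map_one φ, map_one ψ, Module.End.one_apply, Module.End.one_apply]
  have hLR : ∀ f, L (R f) = f := by
    intro f
    induction f using HAlg.induction with
    | one => rw [hR1, hL1]
    | add f g hf hg => rw [map_add, map_add, hf, hg]
    | smul c f hf => rw [map_smul, map_smul, hf]
    | opX b j f hf =>
      revert hf
      refine Fin.cases (fun hf => ?_) (fun b hf => ?_) b
      · rw [hRx0, hLx0, hf]
      · rw [hRxs, hLxs, hf]
  have hRL : ∀ t, R (L t) = t := by
    intro t
    induction t with
    | zero => simp only [map_zero]
    | add s t hs ht => simp only [map_add, hs, ht]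
    | tmul f g =>
      induction f using HAlg.induction with
      | one =>
        induction g using HAlg.induction with
        | one => rw [hL1, hR1]
        | add f g hf hg => rw [TensorProduct.tmul_add, map_add, map_add, hf, hg]
        | smul c f hf => rw [TensorProduct.tmul_smul, map_smul, map_smul, hf]
        | opX b j g hg =>
          have h1 : (1 : HAlg θ 1 n) ⊗ₜ[ℂ] opX θ m n b j g
              = TensorProduct.map π (opX θ m n b j) (1 ⊗ₜ[ℂ] g) := by
            rw [TensorProduct.map_tmul, hπ1]
          rw [h1, hLxs, hRxs, hg]
      | add f f' hf hf' => rw [TensorProduct.add_tmul, map_add, map_add, hf, hf']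
      | smul c f hf => rw [← TensorProduct.smul_tmul', map_smul, map_smul, hf]
      | opX b j f hf =>
        obtain rfl : b = 0 := Subsingleton.elim _ _
        have h1 : opX θ 1 n 0 j f ⊗ₜ[ℂ] g
            = TensorProduct.map (opX θ 1 n 0 j) 1 (f ⊗ₜ[ℂ] g) := rfl
        rw [h1, hLx0, hRx0, hf]
  exact ⟨LinearEquiv.ofLinearMap R L (LinearMap.ext hRL) (LinearMap.ext hLR), π, hππ, hRx0, hRd0,
    hRxs, hRds⟩


/-! ### Parabolic induction from `gl_1 ⊕ gl_m` to `gl_(m+1)` by differential operators -/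

theorem mul_commutator {A : Type*} [Ring A] (a b c : A) :
    a * (b * c) - (b * c) * a = (a * b - b * a) * c + b * (a * c - c * a) := by
  noncomm_ring

theorem mul_commutator_left {A : Type*} [Ring A] (a b c : A) :
    (a * b) * c - c * (a * b) = a * (b * c - c * b) + (a * c - c * a) * b := by
  noncomm_ring

/-- The operators of `gl_(m+1)` on polynomials in `x_1, …, x_m` with values in a representation
`e` of `gl_m`: with the Euler operator `N = ∑_c x_c d_c` they are `E_00 = c - N`, `E_b0 = x_b`,
`E_bf = x_b d_f + e_bf` and `E_0f = (c - N) d_f - ∑_g d_g e_gf`. The representation is the one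
induced from the parabolic subalgebra spanned by `gl_1 ⊕ gl_m` and the `E_0f`. -/
def inducedE {A : Type*} [Ring A] [Algebra ℂ A] {m : ℕ} (c : ℂ) (x d : Fin m → A)
    (e : Fin m → Fin m → A) : Fin (m + 1) → Fin (m + 1) → A :=
  Fin.cons (Fin.cons (algebraMap ℂ A c - ∑ g, x g * d g)
      fun f => (algebraMap ℂ A c - ∑ g, x g * d g) * d f - ∑ g, d g * e g f)
    fun b => Fin.cons (x b) fun f => x b * d f + e b f

section Induced

variable {A : Type*} [Ring A] [Algebra ℂ A] {m : ℕ} (c : ℂ) {x d : Fin m → A}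
  {e : Fin m → Fin m → A}

theorem inducedE_zero_zero (x d : Fin m → A) (e : Fin m → Fin m → A) :
    inducedE c x d e 0 0 = algebraMap ℂ A c - ∑ g, x g * d g := rfl

theorem inducedE_zero_succ (x d : Fin m → A) (e : Fin m → Fin m → A) (f : Fin m) :
    inducedE c x d e 0 f.succ
      = (algebraMap ℂ A c - ∑ g, x g * d g) * d f - ∑ g, d g * e g f := rfl

theorem inducedE_succ_zero (x d : Fin m → A) (e : Fin m → Fin m → A) (b : Fin m) :
    inducedE c x d e b.succ 0 = x b := rfl

theorem inducedE_succ_succ (x d : Fin m → A) (e : Fin m → Fin m → A) (b f : Fin m) :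
    inducedE c x d e b.succ f.succ = x b * d f + e b f := rfl

theorem inducedE_relations (hxx : ∀ a b, x a * x b = x b * x a) (hdd : ∀ a b, d a * d b = d b * d a)
    (hdx : ∀ a b, d a * x b - x b * d a = if a = b then 1 else 0) (he : GlRelations e)
    (hxe : ∀ a b f, Commute (x a) (e b f)) (hde : ∀ a b f, Commute (d a) (e b f)) :
    GlRelations (inducedE c x d e) := by
  have hxx' : ∀ a b, x a * x b - x b * x a = 0 := fun a b => sub_eq_zero.2 (hxx a b)
  have hdd' : ∀ a b, d a * d b - d b * d a = 0 := fun a b => sub_eq_zero.2 (hdd a b)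
  have hxd : ∀ a b, x a * d b - d b * x a = -(if a = b then 1 else 0) := by
    intro a b
    rw [← neg_sub, hdx]
    simp only [eq_comm]
  have hxe' : ∀ a b f, x a * e b f - e b f * x a = 0 := fun a b f => sub_eq_zero.2 (hxe a b f)
  have hde' : ∀ a b f, d a * e b f - e b f * d a = 0 := fun a b f => sub_eq_zero.2 (hde a b f)
  have hex' : ∀ a b f, e b f * x a - x a * e b f = 0 := fun a b f => sub_eq_zero.2 (hxe a b f).symm
  have hed' : ∀ a b f, e b f * d a - d a * e b f = 0 := fun a b f => sub_eq_zero.2 (hde a b f).symm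
  obtain ⟨Z, hZ⟩ : ∃ Z, Z = algebraMap ℂ A c - ∑ g, x g * d g := ⟨_, rfl⟩
  obtain ⟨S, hS⟩ : ∃ S : Fin m → A, S = fun f => ∑ g, d g * e g f := ⟨_, rfl⟩
  have hS' : ∀ f, S f = ∑ g, d g * e g f := fun f => congrFun hS f
  have E00 : inducedE c x d e 0 0 = Z := by rw [inducedE_zero_zero, hZ]
  have E0f : ∀ f, inducedE c x d e 0 (Fin.succ f) = Z * d f - S f := fun f => by
    rw [inducedE_zero_succ, hZ, hS]
  -- commutators with a general element `y` that commutes with scalars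
  have hZy : ∀ y, Z * y - y * Z = -∑ g, (x g * (d g * y - y * d g) + (x g * y - y * x g) * d g) := by
    intro y
    rw [hZ, sub_mul, mul_sub, (Algebra.commutes c y), sub_sub_sub_cancel_left, ← neg_sub,
      Finset.sum_mul, Finset.mul_sum, ← Finset.sum_sub_distrib]
    simp only [mul_commutator_left]
  have hZx : ∀ b, Z * x b - x b * Z = -x b := by
    intro b
    rw [hZy]
    simp [hdx, hxx']
  have hZd : ∀ b, Z * d b - d b * Z = d b := by
    intro b
    rw [hZy]
    simp [hdd', hxd]
  have hZe : ∀ b f, Z * e b f - e b f * Z = 0 := by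
    intro b f
    rw [hZy]
    simp [hxe', hde']
  have hZS : ∀ f, Z * S f - S f * Z = S f := by
    intro f
    rw [hS', Finset.mul_sum, Finset.sum_mul, ← Finset.sum_sub_distrib]
    simp only [mul_commutator, hZd, hZe, mul_zero, add_zero]
  have hSd : ∀ f b, S f * d b - d b * S f = 0 := by
    intro f b
    rw [hS', Finset.mul_sum, Finset.sum_mul, ← Finset.sum_sub_distrib]
    simp only [mul_commutator_left, hed', hdd', mul_zero, zero_mul, add_zero,
      Finset.sum_const_zero]
  have hSx : ∀ f b, S f * x b - x b * S f = e b f := by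
    intro f b
    rw [hS', Finset.mul_sum, Finset.sum_mul, ← Finset.sum_sub_distrib]
    simp [mul_commutator_left, hex', hdx]
  have heS : ∀ a b f, e a b * S f - S f * e a b = d b * e a f - if a = f then S b else 0 := by
    intro a b f
    rw [hS', Finset.mul_sum, Finset.sum_mul, ← Finset.sum_sub_distrib]
    simp only [mul_commutator, hed', zero_mul, zero_add, he a b _ f, mul_sub, mul_ite, mul_zero,
      Finset.sum_sub_distrib, Finset.sum_ite_eq', Finset.mem_univ, if_true]
    by_cases h : a = f <;> simp [h, hS']
  have hSS : ∀ a f, S a * S f - S f * S a = d a * S f - d f * S a := by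
    intro a f
    have h : ∀ g, d g * S f - S f * d g = 0 := fun g => by rw [← neg_sub, hSd, neg_zero]
    have h' : ∀ g, d g * (d a * e g f) = d a * (d g * e g f) := fun g => by
      rw [← mul_assoc, hdd, mul_assoc]
    rw [hS' a, Finset.sum_mul, Finset.mul_sum, ← Finset.sum_sub_distrib]
    simp only [mul_commutator_left, h, zero_mul, add_zero, heS, mul_sub, h', mul_ite, mul_zero,
      Finset.sum_sub_distrib, Finset.sum_ite_eq', Finset.mem_univ, if_true, ← Finset.mul_sum,
      ← hS']
  have antisymm : ∀ i j k l, (inducedE c x d e i j * inducedE c x d e k l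
      - inducedE c x d e k l * inducedE c x d e i j
        = (if k = j then inducedE c x d e i l else 0)
          - (if i = l then inducedE c x d e k j else 0)) →
      inducedE c x d e k l * inducedE c x d e i j - inducedE c x d e i j * inducedE c x d e k l
        = (if i = l then inducedE c x d e k j else 0)
          - (if k = j then inducedE c x d e i l else 0) := by
    intro i j k l h
    rw [← neg_sub, h, neg_sub]
  have ne0 : ∀ a : Fin m, ((0 : Fin (m + 1)) = a.succ) = False := fun a =>
    eq_false (Fin.succ_ne_zero a).symm
  have ne1 : ∀ a : Fin m, (a.succ = 0) = False := fun a => eq_false (Fin.succ_ne_zero a)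
  have h0_x : ∀ b, Z * x b - x b * Z = -x b := hZx
  have h0_c : ∀ b f, Z * (x b * d f + e b f) - (x b * d f + e b f) * Z = 0 := by
    intro b f
    rw [mul_add, add_mul, add_sub_add_comm, hZe, mul_commutator, hZx, hZd, neg_mul,
      neg_add_cancel, add_zero]
  have h0_d : ∀ f, Z * (Z * d f - S f) - (Z * d f - S f) * Z = Z * d f - S f := by
    intro f
    have : Z * (Z * d f - S f) - (Z * d f - S f) * Z
        = Z * (Z * d f - d f * Z) - (Z * S f - S f * Z) := by noncomm_ring
    rw [this, hZd, hZS]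
  have hx_c : ∀ b g f, x b * (x g * d f + e g f) - (x g * d f + e g f) * x b
      = -if b = f then x g else 0 := by
    intro b g f
    rw [mul_add, add_mul, add_sub_add_comm, hxe', mul_commutator, hxx', hxd]
    simp
  have hx_d : ∀ b f, x b * (Z * d f - S f) - (Z * d f - S f) * x b
      = (x b * d f + e b f) - if b = f then Z else 0 := by
    intro b f
    have : x b * (Z * d f - S f) - (Z * d f - S f) * x b
        = -(Z * x b - x b * Z) * d f + Z * (x b * d f - d f * x b)
          + (S f * x b - x b * S f) := by noncomm_ring
    rw [this, hZx, hxd, hSx]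
    split_ifs <;> noncomm_ring
  have hc_d : ∀ b g f, (x b * d g + e b g) * (Z * d f - S f) - (Z * d f - S f) * (x b * d g + e b g)
      = -if b = f then Z * d g - S g else 0 := by
    intro b g f
    have : (x b * d g + e b g) * (Z * d f - S f) - (Z * d f - S f) * (x b * d g + e b g)
        = -(Z * (x b * d g + e b g) - (x b * d g + e b g) * Z) * d f
          + Z * (x b * (d g * d f - d f * d g) + (x b * d f - d f * x b) * d g
            + (e b g * d f - d f * e b g))
          + x b * (S f * d g - d g * S f) + (S f * x b - x b * S f) * d g
          - (e b g * S f - S f * e b g) := by noncomm_ring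
    rw [this, h0_c, hdd', hxd, hed', hSd, hSx, heS, ← (hde g b f).eq]
    split_ifs <;> noncomm_ring
  have hd_d : ∀ a f, (Z * d a - S a) * (Z * d f - S f) - (Z * d f - S f) * (Z * d a - S a) = 0 := by
    intro a f
    have : (Z * d a - S a) * (Z * d f - S f) - (Z * d f - S f) * (Z * d a - S a)
        = Z * Z * (d a * d f - d f * d a) - Z * ((Z * d a - d a * Z) * d f - (Z * d f - d f * Z) * d a)
          + Z * ((S f * d a - d a * S f) - (S a * d f - d f * S a))
          + ((Z * S a - S a * Z) * d f - (Z * S f - S f * Z) * d a)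
          + (S a * S f - S f * S a) := by noncomm_ring
    rw [this, hdd', hZd, hZd, hSd, hSd, hZS, hZS, hSS, hdd']
    have h1 : S a * d f = d f * S a := sub_eq_zero.1 (hSd a f)
    have h2 : S f * d a = d a * S f := sub_eq_zero.1 (hSd f a)
    rw [h1, h2]
    noncomm_ring
  have hc_c : ∀ a b g f, (x a * d b + e a b) * (x g * d f + e g f)
      - (x g * d f + e g f) * (x a * d b + e a b)
      = (if g = b then x a * d f + e a f else 0) - (if a = f then x g * d b + e g b else 0) := by
    intro a b g f
    have : (x a * d b + e a b) * (x g * d f + e g f) - (x g * d f + e g f) * (x a * d b + e a b)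
        = x a * (d b * x g - x g * d b) * d f + x a * x g * (d b * d f - d f * d b)
          + (x a * x g - x g * x a) * d f * d b + x g * (x a * d f - d f * x a) * d b
          + x a * (d b * e g f - e g f * d b) + (x a * e g f - e g f * x a) * d b
          + (e a b * x g - x g * e a b) * d f + x g * (e a b * d f - d f * e a b)
          + (e a b * e g f - e g f * e a b) := by noncomm_ring
    rw [this, hdx, hdd', hxx', hxd, hde', hxe', hex', hed', he a b g f]
    have e1 : (b = g) = (g = b) := propext eq_comm
    simp only [e1]
    split_ifs <;> noncomm_ring
  intro i j k l
  refine Fin.cases ?_ (fun i => ?_) i <;> refine Fin.cases ?_ (fun j => ?_) j <;>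
    refine Fin.cases ?_ (fun k => ?_) k <;> refine Fin.cases ?_ (fun l => ?_) l
  -- `E_00` with everything
  · simp
  · simpa [E00, E0f, ne0, ne1] using h0_d l
  · simpa [E00, inducedE_succ_zero, ne0, ne1] using h0_x k
  · simpa [E00, inducedE_succ_succ, ne0, ne1] using h0_c k l
  -- `E_0j` with everything
  · exact antisymm _ _ _ _ (by simpa [E00, E0f, ne0, ne1] using h0_d j)
  · simpa [E0f, ne0, ne1] using hd_d j l
  · exact antisymm _ _ _ _ (by
      simpa [E00, E0f, inducedE_succ_zero, inducedE_succ_succ, ne0, ne1] using hx_d k j)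
  · exact antisymm _ _ _ _ (by
      simpa [E0f, inducedE_succ_succ, ne0, ne1] using hc_d k l j)
  -- `E_i0` with everything
  · exact antisymm _ _ _ _ (by simpa [E00, inducedE_succ_zero, ne0, ne1] using h0_x i)
  · simpa [E00, E0f, inducedE_succ_zero, inducedE_succ_succ, ne0, ne1] using hx_d i l
  · simpa [inducedE_succ_zero, ne0, ne1] using hxx' i k
  · simpa [inducedE_succ_zero, inducedE_succ_succ, ne0, ne1] using hx_c i k l
  -- `E_ij` with everything
  · exact antisymm _ _ _ _ (by simpa [E00, inducedE_succ_succ, ne0, ne1] using h0_c i j)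
  · simpa [E0f, inducedE_succ_succ, ne0, ne1] using hc_d i j l
  · exact antisymm _ _ _ _ (by
      simpa [inducedE_succ_zero, inducedE_succ_succ, ne0, ne1] using hx_c k i j)
  · simpa [inducedE_succ_succ] using hc_c i j k l

end Induced

/-! ### Verma modules are free over the lower triangular subalgebra -/

/-- The highest weight vector of the Verma module. -/
def vermaVec (m : ℕ) (μ : Fin m → ℂ) : Verma m μ := Submodule.Quotient.mk 1

theorem vermaVec_upper {m : ℕ} (μ : Fin m → ℂ) {a b : Fin m} (h : a < b) :
    glE m a b • vermaVec m μ = 0 := by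
  rw [vermaVec, ← Submodule.Quotient.mk_smul, smul_eq_mul, mul_one, Submodule.Quotient.mk_eq_zero]
  exact Submodule.subset_span (Or.inl ⟨a, b, h, rfl⟩)

theorem vermaVec_cartan {m : ℕ} (μ : Fin m → ℂ) (a : Fin m) :
    glE m a a • vermaVec m μ = μ a • vermaVec m μ := by
  rw [vermaVec, ← Submodule.Quotient.mk_smul, ← Submodule.Quotient.mk_smul, smul_eq_mul, mul_one,
    Submodule.Quotient.eq, ← Algebra.algebraMap_eq_smul_one]
  exact Submodule.subset_span (Or.inr ⟨a, rfl⟩)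

/-- The universal property of the Verma module. -/
theorem Verma.exists_lift {m : ℕ} (μ : Fin m → ℂ) {W : Type*} [AddCommGroup W] [Module ℂ W]
    (ρ : Ugl m →ₐ[ℂ] Module.End ℂ W) (w : W) (h1 : ∀ a b, a < b → ρ (glE m a b) w = 0)
    (h2 : ∀ a, ρ (glE m a a) w = μ a • w) :
    ∃ Ψ : Verma m μ →ₗ[ℂ] W, Ψ (vermaVec m μ) = w ∧ ∀ u x, Ψ (u • x) = ρ u (Ψ x) := by
  let Ψ₀ : Ugl m →ₗ[ℂ] W := (LinearMap.applyₗ w) ∘ₗ ρ.toLinearMap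
  have hΨ₀ : ∀ u, Ψ₀ u = ρ u w := fun _ => rfl
  have hker : (vermaIdeal m μ).restrictScalars ℂ ≤ LinearMap.ker Ψ₀ := by
    intro u hu
    rw [Submodule.restrictScalars_mem] at hu
    rw [LinearMap.mem_ker, hΨ₀]
    induction hu using Submodule.span_induction with
    | mem x hx =>
      rcases hx with ⟨a, b, hab, rfl⟩ | ⟨a, rfl⟩
      · exact h1 a b hab
      · rw [map_sub, LinearMap.sub_apply, h2, AlgHom.commutes, Module.algebraMap_end_apply,
          sub_self]
    | zero => rw [map_zero, LinearMap.zero_apply]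
    | add x y _ _ hx hy => rw [map_add, LinearMap.add_apply, hx, hy, add_zero]
    | smul u x _ hx => rw [smul_eq_mul, map_mul, Module.End.mul_apply, hx, map_zero]
  let Ψ : Verma m μ →ₗ[ℂ] W := (((vermaIdeal m μ).restrictScalars ℂ).liftQ Ψ₀ hker) ∘ₗ
    (Submodule.Quotient.restrictScalarsEquiv ℂ (vermaIdeal m μ)).symm.toLinearMap
  have hΨ : ∀ u, Ψ (Submodule.Quotient.mk u) = ρ u w := fun _ => rfl
  refine ⟨Ψ, ?_, fun u x => ?_⟩
  · rw [vermaVec, hΨ, map_one, Module.End.one_apply]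
  · obtain ⟨x, rfl⟩ := Submodule.Quotient.mk_surjective _ x
    rw [← Submodule.Quotient.mk_smul, hΨ, hΨ, smul_eq_mul, map_mul, Module.End.mul_apply]

/-- Elements `Y_ab`, `b < a`, that satisfy the relations of the lower triangular matrix units, give
a map from the Verma module that is linear over the lower triangular subalgebra. In other words,
the Verma module is freely generated by its highest weight vector over that subalgebra.

By induction on `m`, the Verma module of `gl_(m+1)` maps to the representation on
`ℂ[x_1, …, x_m] ⊗ V`, where `V` is the Verma module of `gl_m` (see `inducedE`), and from there to
`B` by `g ⊗ w ↦ g(Y_10, …, Y_m0) ψ'(w)`. -/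
theorem Verma.exists_lower_map {m : ℕ} (μ : Fin m → ℂ) {B : Type*} [Ring B] [Algebra ℂ B]
    (Y : Fin m → Fin m → B) (hY : ∀ a b c d, b < a → d < c → Y a b * Y c d - Y c d * Y a b
      = (if c = b then Y a d else 0) - (if a = d then Y c b else 0)) :
    ∃ ψ : Verma m μ →ₗ[ℂ] B, ψ (vermaVec m μ) = 1 ∧
      ∀ a b w, b < a → ψ (glE m a b • w) = Y a b * ψ w := by
  induction m with
  | zero =>
    obtain ⟨ψ, h1, -⟩ := Verma.exists_lift μ
      (Ugl.lift (fun a _ => a.elim0 : Fin 0 → Fin 0 → Module.End ℂ B) fun a => a.elim0) (1 : B)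
      (fun a => a.elim0) (fun a => a.elim0)
    exact ⟨ψ, h1, fun a => a.elim0⟩
  | succ m ih =>
    obtain ⟨ψ', hψ1, hψ⟩ := ih (fun a => μ a.succ) (fun a b => Y a.succ b.succ)
      (fun a b c d hba hdc => by
        simpa using hY a.succ b.succ c.succ d.succ (Fin.succ_lt_succ_iff.2 hba)
          (Fin.succ_lt_succ_iff.2 hdc))
    let V := Verma m fun a => μ a.succ
    let v : V := vermaVec m fun a => μ a.succ
    let H := HAlg .commuting m 1
    let x : Fin m → Module.End ℂ (H ⊗[ℂ] V) := fun b =>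
      TensorProduct.map (opX .commuting m 1 b 0) 1
    let d : Fin m → Module.End ℂ (H ⊗[ℂ] V) := fun b =>
      TensorProduct.map (opD .commuting m 1 b 0) 1
    let e : Fin m → Fin m → Module.End ℂ (H ⊗[ℂ] V) := fun a b =>
      TensorProduct.map 1 (Algebra.lsmul ℂ ℂ V (glE m a b))
    have hmul : ∀ (a b : Module.End ℂ H) (c e : Module.End ℂ V),
        (TensorProduct.map a c * TensorProduct.map b e : Module.End ℂ (H ⊗[ℂ] V))
          = TensorProduct.map (a * b) (c * e) := fun a b c e =>
      (TensorProduct.map_mul a b c e).symm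
    have hone : (TensorProduct.map 1 1 : Module.End ℂ (H ⊗[ℂ] V)) = 1 := TensorProduct.map_one
    have hO := opX_opD_relations .commuting m 1
    have hE : GlRelations (inducedE (μ 0) x d e) := by
      refine inducedE_relations (μ 0) ?_ ?_ ?_ ?_ ?_ ?_
      · intro a b
        have := hO.qq a b 0 0
        rw [Statistics.sign, one_smul] at this
        simp only [x, hmul, this]
      · intro a b
        have := hO.pp a b 0 0
        rw [Statistics.sign, one_smul] at this
        simp only [d, hmul, this]
      · intro a b
        have := hO.pq a b 0 0
        rw [Statistics.sign, one_smul] at this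
        simp only [x, d, hmul, eq_add_of_sub_eq this, TensorProduct.map_add_left,
          add_sub_cancel_right, one_mul, and_true]
        split_ifs
        · exact hone
        · exact TensorProduct.map_zero_left _
      · intro a b f g
        have h := ((glE_relations m).map_gl (Algebra.lsmul ℂ ℂ V)) a b f g
        have hlT : ∀ f : Module.End ℂ V, TensorProduct.map (1 : Module.End ℂ H) f
            = LinearMap.lTensor H f := fun _ => rfl
        simp only [e, hmul, one_mul]
        simp only [hlT, ← LinearMap.lTensor_sub]
        refine (congrArg (LinearMap.lTensor H) h).trans ?_
        rw [LinearMap.lTensor_sub]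
        split_ifs <;> simp
      · intro a b f
        simp only [x, e, Commute, SemiconjBy, hmul, one_mul, mul_one]
      · intro a b f
        simp only [d, e, Commute, SemiconjBy, hmul, one_mul, mul_one]
    have hd0 : ∀ b, d b (1 ⊗ₜ[ℂ] v) = 0 := by
      intro b
      change opD .commuting m 1 b 0 1 ⊗ₜ[ℂ] v = 0
      rw [opD_one, TensorProduct.zero_tmul]
    have he0 : ∀ a b, e a b (1 ⊗ₜ[ℂ] v) = 1 ⊗ₜ[ℂ] (glE m a b • v) := fun a b => rfl
    obtain ⟨Ψ, hΨ1, hΨ⟩ := Verma.exists_lift μ (Ugl.lift _ hE) (1 ⊗ₜ[ℂ] v)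
      (by
        intro a b hab
        rw [Ugl.lift_glE]
        revert hab
        refine Fin.cases ?_ (fun b => ?_) b
        · exact fun h => absurd h (Fin.not_lt_zero a)
        · refine Fin.cases (fun _ => ?_) (fun a hab => ?_) a
          · rw [inducedE_zero_succ, LinearMap.sub_apply, Module.End.mul_apply, hd0, map_zero,
              LinearMap.sum_apply, zero_sub, neg_eq_zero]
            refine Finset.sum_eq_zero fun g _ => ?_
            have : Commute (d g) (e g b) := by
              simp only [d, e, Commute, SemiconjBy, hmul, one_mul, mul_one]
            rw [this.eq, Module.End.mul_apply, hd0, map_zero]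
          · rw [inducedE_succ_succ, LinearMap.add_apply, Module.End.mul_apply, hd0, map_zero,
              zero_add, he0, vermaVec_upper _ (Fin.succ_lt_succ_iff.1 hab),
              TensorProduct.tmul_zero])
      (by
        intro a
        rw [Ugl.lift_glE]
        refine Fin.cases ?_ (fun a => ?_) a
        · rw [inducedE_zero_zero, LinearMap.sub_apply, Module.algebraMap_end_apply,
            LinearMap.sum_apply, sub_eq_self]
          refine Finset.sum_eq_zero fun g _ => ?_
          rw [Module.End.mul_apply, hd0, map_zero]
        · rw [inducedE_succ_succ, LinearMap.add_apply, Module.End.mul_apply, hd0, map_zero,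
            zero_add, he0, vermaVec_cartan, TensorProduct.tmul_smul])
    -- polynomials in the `x_b` are sent to polynomials in the commuting elements `Y_b0`
    obtain ⟨φ, hφ⟩ := HAlg.exists_lift (θ := .commuting) (fun (b : Fin m) (_ : Fin 1) => Y b.succ 0)
      (fun a b _ _ => by
        have := hY a.succ 0 b.succ 0 (Fin.succ_pos a) (Fin.succ_pos b)
        rw [if_neg (Fin.succ_ne_zero b), if_neg (Fin.succ_ne_zero a), sub_zero, sub_eq_zero] at this
        rw [Statistics.sign, one_smul, this])
    have hYφ : ∀ (b f : Fin m), f < b → ∀ g, Y b.succ f.succ * φ g = φ g * Y b.succ f.succ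
        + φ (opX .commuting m 1 b 0 (opD .commuting m 1 f 0 g)) := by
      intro b f hfb g
      induction g using HAlg.induction with
      | one => rw [opD_one, map_zero, map_zero, map_one, one_mul, mul_one, add_zero]
      | add g g' hg hg' => simp only [map_add, mul_add, add_mul, hg, hg']; abel
      | smul c g hg => simp only [map_smul, mul_smul_comm, smul_mul_assoc, hg, smul_add]
      | opX c j g hg =>
        obtain rfl : j = 0 := Subsingleton.elim _ _
        have h1 : opD .commuting m 1 f 0 (opX .commuting m 1 c 0 g)
            = (if f = c then g else 0) + opX .commuting m 1 c 0 (opD .commuting m 1 f 0 g) := by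
          have := LinearMap.congr_fun (hO.pq f c 0 0) g
          simp only [Statistics.sign, one_smul, LinearMap.sub_apply, Module.End.mul_apply] at this
          rw [eq_add_of_sub_eq this]
          congr 1
          by_cases h : f = c <;> simp [h]
        have h2 := hY b.succ f.succ c.succ 0 (Fin.succ_lt_succ_iff.2 hfb) (Fin.succ_pos c)
        have h3 := hY b.succ 0 c.succ 0 (Fin.succ_pos b) (Fin.succ_pos c)
        rw [if_neg (Fin.succ_ne_zero _), sub_zero] at h2
        rw [if_neg (Fin.succ_ne_zero _), if_neg (Fin.succ_ne_zero _), sub_zero] at h3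
        rw [hφ, ← mul_assoc, eq_add_of_sub_eq h2, add_mul, mul_assoc, hg, h1, map_add, map_add,
          hφ _ _ (opX _ _ _ _ _ _), hφ _ _ (opD _ _ _ _ _ _), mul_add, ← mul_assoc,
          hφ _ _ (opD _ _ _ _ _ _), ← mul_assoc (Y b.succ 0), sub_eq_zero.1 h3, hφ]
        simp only [Fin.succ_inj, eq_comm (a := c) (b := f), mul_assoc]
        split_ifs
        · abel
        · simp
    let T : H ⊗[ℂ] V →ₗ[ℂ] B := TensorProduct.lift
      (LinearMap.compl₁₂ (LinearMap.mul ℂ B) φ.toLinearMap ψ')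
    have hT : ∀ g w, T (g ⊗ₜ[ℂ] w) = φ g * ψ' w := fun _ _ => rfl
    refine ⟨T ∘ₗ Ψ, ?_, fun a b w hba => ?_⟩
    · rw [LinearMap.comp_apply, hΨ1, hT, map_one, hψ1, one_mul]
    · rw [LinearMap.comp_apply, LinearMap.comp_apply, hΨ, Ugl.lift_glE]
      generalize Ψ w = t
      revert hba
      refine Fin.cases (fun h => absurd h (Fin.not_lt_zero b)) (fun a => ?_) a
      refine Fin.cases (fun _ => ?_) (fun b hba => ?_) b
      · rw [inducedE_succ_zero]
        induction t with
        | zero => simp only [map_zero, mul_zero]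
        | add s t hs ht => simp only [map_add, mul_add, hs, ht]
        | tmul g w =>
          rw [show x a (g ⊗ₜ[ℂ] w) = opX .commuting m 1 a 0 g ⊗ₜ[ℂ] w from rfl, hT, hT, hφ,
            mul_assoc]
      · rw [inducedE_succ_succ]
        induction t with
        | zero => simp only [map_zero, mul_zero]
        | add s t hs ht => simp only [map_add, mul_add, hs, ht]
        | tmul g w =>
          have hab := Fin.succ_lt_succ_iff.1 hba
          rw [show (x a * d b + e a b) (g ⊗ₜ[ℂ] w)
              = opX .commuting m 1 a 0 (opD .commuting m 1 b 0 g) ⊗ₜ[ℂ] w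
                + g ⊗ₜ[ℂ] (glE m a b • w) from rfl, map_add, hT, hT, hT, hψ _ _ _ hab,
            ← mul_assoc (Y a.succ b.succ), hYφ a b hab, add_mul, mul_assoc, add_comm]

theorem Ugl.induction_gen {m : ℕ} {P : Ugl m → Prop}
    (algebraMap : ∀ c : ℂ, P (algebraMap ℂ (Ugl m) c)) (gen : ∀ a b, P (glE m a b))
    (mul : ∀ x y, P x → P y → P (x * y)) (add : ∀ x y, P x → P y → P (x + y)) (x : Ugl m) :
    P x := by
  let S : Subalgebra ℂ (Ugl m) :=
    { carrier := {x | P x}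
      mul_mem' := fun hx hy => mul _ _ hx hy
      add_mem' := fun hx hy => add _ _ hx hy
      algebraMap_mem' := algebraMap }
  have hrel : GlRelations (fun a b => (⟨glE m a b, gen a b⟩ : S)) := by
    intro a b c d
    apply Subtype.ext
    refine (glE_relations m a b c d).trans ?_
    split_ifs <;> rfl
  have hg : S.val.comp (Ugl.lift _ hrel) = AlgHom.id ℂ _ := Ugl.hom_ext fun a b =>
    congrArg S.val (Ugl.lift_glE _ hrel a b)
  have := AlgHom.congr_fun hg x
  rw [AlgHom.id_apply] at this
  exact this ▸ (Ugl.lift _ hrel x).2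

/-- The Verma module is generated by its highest weight vector over the lower triangular
subalgebra. -/
theorem Verma.induction_lower {m : ℕ} (μ : Fin m → ℂ) {P : Verma m μ → Prop}
    (vec : P (vermaVec m μ)) (add : ∀ v w, P v → P w → P (v + w))
    (smul : ∀ (c : ℂ) v, P v → P (c • v))
    (lower : ∀ a b v, b < a → P v → P (glE m a b • v)) (v : Verma m μ) : P v := by
  have zero : P 0 := by simpa using smul 0 _ vec
  -- the span of the lower triangular monomials, as the intersection of all stable subspaces
  let W : Submodule ℂ (Verma m μ) := sInf {W | vermaVec m μ ∈ W ∧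
    ∀ a b v, b < a → v ∈ W → glE m a b • v ∈ W}
  have hWv : vermaVec m μ ∈ W := Submodule.mem_sInf.2 fun U hU => hU.1
  have hWl : ∀ a b v, b < a → v ∈ W → glE m a b • v ∈ W := fun a b v hab hv =>
    Submodule.mem_sInf.2 fun U hU => hU.2 a b v hab (Submodule.mem_sInf.1 hv U hU)
  have hmin : ∀ U : Submodule ℂ (Verma m μ), vermaVec m μ ∈ U →
      (∀ a b v, b < a → v ∈ U → glE m a b • v ∈ U) → W ≤ U := fun U h1 h2 => sInf_le ⟨h1, h2⟩
  have hWall : ∀ v ∈ W, ∀ a b, glE m a b • v ∈ W := by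
    let U : Submodule ℂ (Verma m μ) :=
      { carrier := {v | v ∈ W ∧ ∀ a b, glE m a b • v ∈ W}
        add_mem' := fun hv hw => ⟨add_mem hv.1 hw.1, fun a b => by
          rw [smul_add]; exact add_mem (hv.2 a b) (hw.2 a b)⟩
        zero_mem' := ⟨zero_mem _, fun a b => by rw [smul_zero]; exact zero_mem _⟩
        smul_mem' := fun c v hv => ⟨W.smul_mem c hv.1, fun a b => by
          rw [smul_comm]; exact W.smul_mem c (hv.2 a b)⟩ }
    have : W ≤ U := by
      refine hmin U ⟨hWv, fun a b => ?_⟩ fun a b v hba hv => ⟨hWl a b v hba hv.1, fun c d => ?_⟩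
      · rcases lt_trichotomy a b with h | rfl | h
        · rw [vermaVec_upper μ h]; exact zero_mem _
        · rw [vermaVec_cartan]; exact W.smul_mem _ hWv
        · exact hWl a b _ h hWv
      · rw [← mul_smul, eq_add_of_sub_eq (glE_relations m c d a b), add_smul, sub_smul, mul_smul]
        refine add_mem (sub_mem ?_ ?_) (hWl a b _ hba (hv.2 c d))
        · split_ifs
          · exact hv.2 _ _
          · rw [zero_smul]; exact zero_mem _
        · split_ifs
          · exact hv.2 _ _
          · rw [zero_smul]; exact zero_mem _
    exact fun v hv => (this hv).2
  have hWu : ∀ (u : Ugl m) (v : Verma m μ), v ∈ W → u • v ∈ W := by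
    intro u
    induction u using Ugl.induction_gen with
    | algebraMap c => intro v hv; rw [algebraMap_smul]; exact W.smul_mem c hv
    | gen a b => exact fun v hv => hWall v hv a b
    | mul x y hx hy => intro v hv; rw [mul_smul]; exact hx _ (hy _ hv)
    | add x y hx hy => intro v hv; rw [add_smul]; exact add_mem (hx _ hv) (hy _ hv)
  have hv : v ∈ W := by
    obtain ⟨u, rfl⟩ := Submodule.Quotient.mk_surjective _ v
    have := hWu u _ hWv
    rwa [vermaVec, ← Submodule.Quotient.mk_smul, smul_eq_mul, mul_one] at this
  let U : Submodule ℂ (Verma m μ) :=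
    { carrier := {v | P v}
      add_mem' := fun hv hw => add _ _ hv hw
      zero_mem' := zero
      smul_mem' := fun c v hv => smul c v hv }
  exact hmin U vec lower hv


/-! ### Coinvariants of `M_μ ⊗ H` -/

theorem sum_eq_sum_Iio_add {m : ℕ} {M : Type*} [AddCommMonoid M] (c : Fin m) (f : Fin m → M)
    (hf : ∀ b, c < b → f b = 0) : ∑ b, f b = ∑ b ∈ Finset.Iio c, f b + f c := by
  rw [add_comm, ← Finset.sum_insert (fun h => lt_irrefl c (Finset.mem_Iio.1 h)),
    Finset.Iio_insert]
  refine (Finset.sum_subset (Finset.subset_univ _) fun b _ hb => hf b ?_).symm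
  simpa using hb

/-- For operators `Z_ab` on `H` that represent `gl_m`, the space `M_μ ⊗ H` is the direct sum of
`v ⊗ H`, where `v` is the highest weight vector, and of the image of the lower triangular
subalgebra; `φ` is the projection to the first summand. -/
theorem Verma.exists_coinvariant_map {m : ℕ} (μ : Fin m → ℂ) {H : Type} [AddCommGroup H]
    [Module ℂ H] (Z : Fin m → Fin m → Module.End ℂ H) (hZ : GlRelations Z) :
    ∃ φ : Verma m μ ⊗[ℂ] H →ₗ[ℂ] H, (∀ h, φ (vermaVec m μ ⊗ₜ[ℂ] h) = h) ∧
      (∀ a b w h, b < a → φ ((glE m a b • w) ⊗ₜ[ℂ] h) = -φ (w ⊗ₜ[ℂ] Z a b h)) ∧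
      ∀ t, t - vermaVec m μ ⊗ₜ[ℂ] φ t ∈ Submodule.span ℂ
        {s : Verma m μ ⊗[ℂ] H | ∃ a b w h, b < a ∧
          s = (glE m a b • w) ⊗ₜ[ℂ] h + w ⊗ₜ[ℂ] Z a b h} := by
  obtain ⟨ψ, hψ1, hψ⟩ := Verma.exists_lower_map μ (B := (Module.End ℂ H)ᵐᵒᵖ)
    (fun a b => -MulOpposite.op (Z a b)) (by
      intro a b c d _ _
      have h := congrArg (fun z => -MulOpposite.op z) (hZ a b c d)
      simp only [MulOpposite.op_sub, MulOpposite.op_mul, neg_sub] at h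
      rw [neg_mul_neg, neg_mul_neg, h]
      split_ifs <;> simp [neg_add_eq_sub])
  let φ : Verma m μ ⊗[ℂ] H →ₗ[ℂ] H :=
    TensorProduct.lift ((MulOpposite.opLinearEquiv ℂ).symm.toLinearMap ∘ₗ ψ)
  have hφ : ∀ w h, φ (w ⊗ₜ[ℂ] h) = (ψ w).unop h := fun _ _ => rfl
  have hφv : ∀ h, φ (vermaVec m μ ⊗ₜ[ℂ] h) = h := fun h => by
    rw [hφ, hψ1, MulOpposite.unop_one, Module.End.one_apply]
  have hφl : ∀ a b w h, b < a → φ ((glE m a b • w) ⊗ₜ[ℂ] h) = -φ (w ⊗ₜ[ℂ] Z a b h) := by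
    intro a b w h hba
    rw [hφ, hφ, hψ a b w hba, MulOpposite.unop_mul, MulOpposite.unop_neg, MulOpposite.unop_op,
      Module.End.mul_apply, LinearMap.neg_apply, map_neg]
  refine ⟨φ, hφv, hφl, fun t => ?_⟩
  set N := Submodule.span ℂ {s : Verma m μ ⊗[ℂ] H | ∃ a b w h, b < a ∧
          s = (glE m a b • w) ⊗ₜ[ℂ] h + w ⊗ₜ[ℂ] Z a b h} with hN
  induction t with
  | zero => rw [map_zero, TensorProduct.tmul_zero, sub_zero]; exact zero_mem _
  | add s t hs ht =>
    rw [map_add, TensorProduct.tmul_add, add_sub_add_comm]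
    exact add_mem hs ht
  | tmul w h =>
    induction w using Verma.induction_lower generalizing h with
    | vec => rw [hφv, sub_self]; exact zero_mem _
    | add v w hv hw =>
      rw [TensorProduct.add_tmul, map_add, TensorProduct.tmul_add, add_sub_add_comm]
      exact add_mem (hv h) (hw h)
    | smul c v hv =>
      have hc := N.smul_mem c (hv h)
      rw [smul_sub] at hc
      rw [← TensorProduct.smul_tmul', map_smul, TensorProduct.tmul_smul]
      exact hc
    | lower a b v hba hv =>
      have h1 : (glE m a b • v) ⊗ₜ[ℂ] h + v ⊗ₜ[ℂ] Z a b h ∈ N :=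
        Submodule.subset_span ⟨a, b, v, h, hba, rfl⟩
      have h2 := sub_mem h1 (hv (Z a b h))
      rw [hφl a b v h hba, TensorProduct.tmul_neg, sub_neg_eq_add]
      convert h2 using 1
      abel

/-! ### The action of the Yangian on the coinvariants -/

/-- The matrix of power series in `u⁻¹` with the entries
`T_ij(u) = δ_ij + ∑_r t_ij^(r) u^(-r-1)`. -/
noncomputable def seriesMatrix {A : Type*} [Ring A] {n : ℕ} (t : ℕ → Fin n → Fin n → A) :
    Matrix (Fin n) (Fin n) (PowerSeries A) :=
  Matrix.of fun i j => PowerSeries.mk fun r => coeffT t r i j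

theorem coeff_seriesMatrix {A : Type*} [Ring A] {n : ℕ} (t : ℕ → Fin n → Fin n → A) (r : ℕ)
    (i j : Fin n) : PowerSeries.coeff r (seriesMatrix t i j) = coeffT t r i j :=
  PowerSeries.coeff_mk r fun r => coeffT t r i j

theorem seriesMatrix_prodT {A : Type*} [Ring A] {n : ℕ} (a b : ℕ → Fin n → Fin n → A) :
    seriesMatrix (prodT a b) = seriesMatrix a * seriesMatrix b := by
  ext i j r
  rw [coeff_seriesMatrix, coeffT_prodT, Matrix.mul_apply, map_sum]
  simp only [PowerSeries.coeff_mul, coeff_seriesMatrix]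

theorem seriesMatrix_zero {A : Type*} [Ring A] {n : ℕ} :
    seriesMatrix (fun _ _ _ => 0 : ℕ → Fin n → Fin n → A) = 1 := by
  ext i j r
  rw [coeff_seriesMatrix, Matrix.one_apply]
  cases r <;> simp only [coeffT] <;> split_ifs <;> simp [PowerSeries.coeff_one]

/-- The coefficients of `δ_ij + e_ij / (u + w)`. -/
noncomputable def evalT {A : Type*} [Ring A] [Algebra ℂ A] {n : ℕ} (w : ℂ)
    (e : Fin n → Fin n → A) : ℕ → Fin n → Fin n → A :=
  fun r i j => (-w) ^ r • e i j

/-- The product `A_1(u) ⋯ A_m(u)` of the matrices `A_a(u)` with the entries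
`δ_ij + e_ij^a / (u + w_a)`. -/
noncomputable def monodromy {A : Type*} [Ring A] [Algebra ℂ A] {m n : ℕ} (w : Fin m → ℂ)
    (e : Fin m → Fin n → Fin n → A) : Matrix (Fin n) (Fin n) (PowerSeries A) :=
  (List.ofFn fun a => seriesMatrix (evalT (w a) (e a))).prod

theorem monodromy_zero {A : Type*} [Ring A] [Algebra ℂ A] {n : ℕ} (w : Fin 0 → ℂ)
    (e : Fin 0 → Fin n → Fin n → A) : monodromy w e = 1 := by
  simp [monodromy]

theorem monodromy_succ {A : Type*} [Ring A] [Algebra ℂ A] {m n : ℕ} (w : Fin (m + 1) → ℂ)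
    (e : Fin (m + 1) → Fin n → Fin n → A) : monodromy w e
      = seriesMatrix (evalT (w 0) (e 0)) * monodromy (fun a => w a.succ) fun a => e a.succ := by
  rw [monodromy, List.ofFn_succ, List.prod_cons, monodromy]

theorem monodromy_map {A B : Type*} [Ring A] [Algebra ℂ A] [Ring B] [Algebra ℂ B]
    (f : A →ₐ[ℂ] B) {m n : ℕ} (w : Fin m → ℂ) (e : Fin m → Fin n → Fin n → A) :
    monodromy w (fun a i j => f (e a i j))
      = (PowerSeries.map (f : A →+* B)).mapMatrix (monodromy w e) := by
  rw [monodromy, monodromy, map_list_prod, List.map_ofFn]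
  congr 2
  funext a
  ext i j r
  simp only [Function.comp_apply, RingHom.mapMatrix_apply, Matrix.map_apply, PowerSeries.coeff_map,
    coeff_seriesMatrix]
  rw [RingHom.coe_coe, map_coeffT f]
  simp only [evalT, map_smul]
  rfl

theorem prodT_evalT_of_recursion {A : Type*} [Ring A] [Algebra ℂ A] {n : ℕ} {w : ℂ}
    {e : Fin n → Fin n → A} {F G : ℕ → Fin n → Fin n → A} (h0 : ∀ i j, G 0 i j = e i j)
    (h1 : ∀ r i j, G (r + 1) i j = (-w) • G r i j + ∑ k, F r i k * e k j) :
    prodT F (evalT w e) = fun r i j => F r i j + G r i j := by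
  have key : ∀ r i j, G r i j = ∑ k, ∑ x ∈ Finset.HasAntidiagonal.antidiagonal r,
      coeffT F x.1 i k * evalT w e x.2 k j := by
    intro r
    induction r with
    | zero =>
      intro i j
      simp [h0, coeffT, evalT]
    | succ r ih =>
      intro i j
      simp only [Finset.Nat.sum_antidiagonal_succ', Finset.sum_add_distrib]
      rw [h1, ih, Finset.smul_sum, add_comm]
      congr 1
      · simp [coeffT, evalT]
      · refine Finset.sum_congr rfl fun k _ => ?_
        rw [Finset.smul_sum]
        refine Finset.sum_congr rfl fun x _ => ?_
        simp only [evalT, pow_succ', mul_smul, mul_smul_comm]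
  funext r i j
  rw [key, prodT]
  simp only [Finset.Nat.sum_antidiagonal_succ', Finset.sum_add_distrib]
  congr 1
  simp [coeffT]

/-- The commutation of `ζ(E_cb) = ∑_k q_ck p_bk`, `b ≠ c`, with `q_ai`. -/
theorem OscillatorRelations.zetaE_mul_q {A : Type*} [Ring A] [Algebra ℂ A] {θ : ℂ}
    (hs : θ * θ = 1) {m n : ℕ} {q p : Fin m → Fin n → A} (h : OscillatorRelations θ q p)
    {b c : Fin m} (hbc : b ≠ c) (a : Fin m) (i : Fin n) :
    θ • (zetaE θ q p c b * q a i)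
      = ∑ k, q a i * p b k * q c k + if a = b then θ • q c i else 0 := by
  have h1 : ∀ k, q c k * p b k = θ • (p b k * q c k) := by
    intro k
    have := h.pq b c k k
    rw [if_neg (fun h => hbc h.1), sub_eq_zero] at this
    rw [this, smul_smul, hs, one_smul]
  have h2 : ∀ k, q c k * p b k * q a i
      = θ • (q a i * p b k * q c k) + if a = b ∧ i = k then q c k else 0 := by
    intro k
    have e : (if b = a ∧ k = i then (1 : A) else 0) = if a = b ∧ i = k then 1 else 0 := by
      simp only [eq_comm]
    rw [mul_assoc, eq_add_of_sub_eq (h.pq b a k i), mul_add, mul_smul_comm, ← mul_assoc,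
      h.qq c a k i, smul_mul_assoc, mul_assoc, h1, mul_smul_comm, e, smul_smul, smul_smul, hs,
      one_mul, add_comm, mul_assoc]
    split_ifs <;> simp
  rw [zetaE, if_neg hbc.symm, zero_add, Finset.sum_mul, Finset.smul_sum]
  simp only [h2, smul_add, smul_smul, hs, one_smul, Finset.sum_add_distrib]
  congr 1
  by_cases hab : a = b <;> simp [hab]

section Coinvariants

variable {θ : ℂ} {m n : ℕ} {μ : Fin m → ℂ} {H : Type} [AddCommGroup H] [Module ℂ H]

/-- The operator `h ↦ φ(X_ab^(r) v ⊗ h)`, where `X_ab^(r)` is the coefficient of `X_ab(u)` at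
`u^(-r-1)`. -/
noncomputable def transferOp (θ : ℂ) (φ : Verma m μ ⊗[ℂ] H →ₗ[ℂ] H) (r : ℕ) (a b : Fin m) :
    Module.End ℂ H :=
  φ ∘ₗ TensorProduct.mk ℂ (Verma m μ) H ((Xmat θ m ^ r) a b • vermaVec m μ)

theorem transferOp_apply (φ : Verma m μ ⊗[ℂ] H →ₗ[ℂ] H) (r : ℕ) (a b : Fin m) (h : H) :
    transferOp θ φ r a b h = φ (((Xmat θ m ^ r) a b • vermaVec m μ) ⊗ₜ[ℂ] h) := rfl

theorem transferOp_zero {φ : Verma m μ ⊗[ℂ] H →ₗ[ℂ] H}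
    (hφ : ∀ h, φ (vermaVec m μ ⊗ₜ[ℂ] h) = h) (a b : Fin m) :
    transferOp θ φ 0 a b = if a = b then 1 else 0 := by
  refine LinearMap.ext fun h => ?_
  rw [transferOp_apply, pow_zero, Matrix.one_apply]
  split_ifs
  · rw [one_smul, hφ, Module.End.one_apply]
  · rw [zero_smul, TensorProduct.zero_tmul, map_zero, LinearMap.zero_apply]

/-- The recursion comes from `X^(r+1) = -θ X^(r) E'` applied to the highest weight vector: in
`X_ab^(r) E_cb v` the factor `E_cb`, `b < c`, is moved to the left, where it acts modulo
coinvariants as `-ζ(E_cb)` on the second tensor factor. The commutators produce the shift of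
`μ_c` by `-c`. -/
theorem transferOp_succ {φ : Verma m μ ⊗[ℂ] H →ₗ[ℂ] H} {Z : Fin m → Fin m → Module.End ℂ H}
    (hφ : ∀ a b w h, b < a → φ ((glE m a b • w) ⊗ₜ[ℂ] h) = -φ (w ⊗ₜ[ℂ] Z a b h))
    (r : ℕ) (a c : Fin m) :
    transferOp θ φ (r + 1) a c = -(θ * (μ c - (c : ℕ))) • transferOp θ φ r a c
      + ∑ b ∈ Finset.Iio c, θ • (transferOp θ φ r a b * Z c b)
      - if a = c then ∑ b ∈ Finset.Iio c, θ • transferOp θ φ r b b else 0 := by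
  refine LinearMap.ext fun h => ?_
  have hvec : (Xmat θ m ^ (r + 1)) a c • vermaVec m μ
      = -(θ * (μ c - (c : ℕ))) • ((Xmat θ m ^ r) a c • vermaVec m μ)
        - ∑ b ∈ Finset.Iio c, θ • (glE m c b • ((Xmat θ m ^ r) a b • vermaVec m μ))
        - if a = c then ∑ b ∈ Finset.Iio c, θ • ((Xmat θ m ^ r) b b • vermaVec m μ) else 0 := by
    have hterm : ∀ b, ((Xmat θ m ^ r) a b * Xmat θ m b c) • vermaVec m μ
        = -(θ • ((Xmat θ m ^ r) a b • glE m c b • vermaVec m μ)) := by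
      intro b
      rw [Xmat_apply, mul_neg, mul_smul_comm, neg_smul, smul_assoc, mul_smul]
    rw [pow_succ, Matrix.mul_apply, Finset.sum_smul, sum_eq_sum_Iio_add c]
    · have hlow : ∀ b ∈ Finset.Iio c, ((Xmat θ m ^ r) a b * Xmat θ m b c) • vermaVec m μ
          = -(θ • (glE m c b • ((Xmat θ m ^ r) a b • vermaVec m μ)))
            + θ • ((Xmat θ m ^ r) a c • vermaVec m μ)
            - if a = c then θ • ((Xmat θ m ^ r) b b • vermaVec m μ) else 0 := by
        intro b _
        have hc := glE_comm_Xmat_pow θ m r a b c b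
        rw [if_pos rfl, sub_eq_iff_eq_add] at hc
        rw [hterm, smul_smul, smul_smul (glE m c b), hc, add_smul, sub_smul]
        split_ifs
        · simp only [smul_add, smul_sub]; abel
        · simp only [smul_add, smul_sub, zero_smul, smul_zero]; abel
      rw [Finset.sum_congr rfl hlow, hterm, vermaVec_cartan]
      simp only [Finset.sum_sub_distrib, Finset.sum_add_distrib, Finset.sum_neg_distrib,
        Finset.sum_const, Fin.card_Iio]
      rw [smul_comm ((Xmat θ m ^ r) a c) (μ c), ← Nat.cast_smul_eq_nsmul ℂ, smul_smul, smul_smul]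
      have e : -(θ * (μ c - (c : ℕ))) = (c : ℕ) * θ - θ * μ c := by ring
      rw [e, sub_smul]
      split_ifs
      · abel
      · simp only [Finset.sum_const_zero]; abel
    · intro b hb
      rw [hterm, vermaVec_upper μ hb, smul_zero, smul_zero, neg_zero]
  have hsum : ∀ f : Fin m → Verma m μ, φ ((∑ b ∈ Finset.Iio c, θ • f b) ⊗ₜ[ℂ] h)
      = ∑ b ∈ Finset.Iio c, θ • φ (f b ⊗ₜ[ℂ] h) := by
    intro f
    simp only [TensorProduct.sum_tmul, map_sum, ← TensorProduct.smul_tmul', map_smul]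
  rw [transferOp_apply, hvec, TensorProduct.sub_tmul, TensorProduct.sub_tmul, map_sub, map_sub,
    ← TensorProduct.smul_tmul', map_smul, hsum]
  have hlow : ∑ b ∈ Finset.Iio c, θ • φ ((glE m c b • ((Xmat θ m ^ r) a b • vermaVec m μ)) ⊗ₜ[ℂ] h)
      = -(∑ b ∈ Finset.Iio c, θ • (transferOp θ φ r a b * Z c b)) h := by
    rw [LinearMap.sum_apply, ← Finset.sum_neg_distrib]
    refine Finset.sum_congr rfl fun b hb => ?_
    rw [hφ c b _ h (Finset.mem_Iio.1 hb), smul_neg]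
    rfl
  rw [hlow, sub_neg_eq_add]
  simp only [LinearMap.sub_apply, LinearMap.add_apply, LinearMap.smul_apply]
  congr 1
  split_ifs
  · rw [hsum, LinearMap.sum_apply]; rfl
  · rw [TensorProduct.zero_tmul, map_zero, LinearMap.zero_apply]

/-- The action of `T_ij(u)` on the coinvariants is the product of the matrices of the tensor
factors: with `G_c = ∑_a S_ac q_ai p_cj`, where `S_ac` is the transfer operator, the recursion for
the transfer operators says that adding `G_c` to `∑_{b < c} G_b` is the multiplication by
the matrix of the factor `c`. -/
theorem transferOp_monodromy (hs : θ * θ = 1) {q p : Fin m → Fin n → Module.End ℂ H}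
    (h : OscillatorRelations θ q p) {φ : Verma m μ ⊗[ℂ] H →ₗ[ℂ] H}
    (hφ1 : ∀ h, φ (vermaVec m μ ⊗ₜ[ℂ] h) = h)
    (hφ : ∀ a b w h, b < a → φ ((glE m a b • w) ⊗ₜ[ℂ] h) = -φ (w ⊗ₜ[ℂ] zetaE θ q p a b h)) :
    seriesMatrix (fun r i j => ∑ a, ∑ c, transferOp θ φ r a c * (q a i * p c j))
      = monodromy (fun c => θ * (μ c - (c : ℕ))) fun c i j => q c i * p c j := by
  obtain ⟨G, hG⟩ : ∃ G : Fin m → ℕ → Fin n → Fin n → Module.End ℂ H,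
      G = fun c r i j => ∑ a, transferOp θ φ r a c * (q a i * p c j) := ⟨_, rfl⟩
  have hG' : ∀ c r i j, G c r i j = ∑ a, transferOp θ φ r a c * (q a i * p c j) := fun c r i j => by
    rw [hG]
  have hG0 : ∀ c i j, G c 0 i j = q c i * p c j := by
    intro c i j
    simp [hG', transferOp_zero hφ1]
  have hGs : ∀ c r i j, G c (r + 1) i j = (-(θ * (μ c - (c : ℕ)))) • G c r i j
      + ∑ k, (∑ b ∈ Finset.Iio c, G b r i k) * (q c k * p c j) := by
    intro c r i j
    have hterm : ∀ a, (∑ b ∈ Finset.Iio c, θ • (transferOp θ φ r a b * zetaE θ q p c b))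
          * (q a i * p c j)
        = ∑ b ∈ Finset.Iio c, (∑ k, transferOp θ φ r a b * (q a i * p b k) * (q c k * p c j)
          + if a = b then θ • (transferOp θ φ r a b * (q c i * p c j)) else 0) := by
      intro a
      rw [Finset.sum_mul]
      refine Finset.sum_congr rfl fun b hb => ?_
      have hbc : b ≠ c := (Finset.mem_Iio.1 hb).ne
      rw [smul_mul_assoc, mul_assoc, ← mul_assoc (zetaE θ q p c b), ← mul_smul_comm,
        ← smul_mul_assoc, h.zetaE_mul_q hs hbc, add_mul, mul_add, Finset.sum_mul, Finset.mul_sum]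
      refine congrArg₂ (· + ·) (Finset.sum_congr rfl fun k _ => ?_) ?_
      · simp only [mul_assoc]
      · split_ifs
        · rw [smul_mul_assoc, mul_smul_comm]
        · rw [zero_mul, mul_zero]
    rw [hG']
    simp only [transferOp_succ hφ, sub_mul, add_mul, hterm, Finset.sum_sub_distrib,
      Finset.sum_add_distrib, smul_mul_assoc]
    rw [← Finset.smul_sum, ← hG', add_sub_assoc]
    congr 1
    have h1 : ∑ a, ∑ b ∈ Finset.Iio c,
        (if a = b then θ • (transferOp θ φ r a b * (q c i * p c j)) else 0)
        = ∑ a, (if a = c then ∑ b ∈ Finset.Iio c, θ • transferOp θ φ r b b else 0)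
            * (q a i * p c j) := by
      rw [Finset.sum_comm]
      simp only [Finset.sum_ite_eq', Finset.mem_univ, if_true, ite_mul, zero_mul, Finset.sum_mul,
        smul_mul_assoc]
    rw [h1, add_sub_cancel_right, Finset.sum_comm]
    simp only [Finset.sum_mul, hG']
    rw [Finset.sum_comm (s := (Finset.univ : Finset (Fin n)))]
    refine Finset.sum_congr rfl fun b _ => ?_
    exact Finset.sum_comm
  -- the product of the first `c` factors
  have key : ∀ c ≤ m, ((List.ofFn fun a => seriesMatrix
        (evalT (θ * (μ a - (a : ℕ))) fun i j => q a i * p a j)).take c).prod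
      = seriesMatrix fun r i j =>
          ∑ b ∈ Finset.univ.filter (fun b : Fin m => (b : ℕ) < c), G b r i j := by
    intro c
    induction c with
    | zero =>
      intro _
      simpa using seriesMatrix_zero.symm
    | succ c ih =>
      intro hc
      rw [List.prod_take_succ _ _ (by simpa using hc), ih (Nat.le_of_succ_le hc),
        List.getElem_ofFn, ← seriesMatrix_prodT]
      congr 1
      rw [prodT_evalT_of_recursion (G := G ⟨c, hc⟩) (hG0 _)]
      · funext r i j
        have : (Finset.univ.filter fun b : Fin m => (b : ℕ) < c + 1)
            = insert ⟨c, hc⟩ (Finset.univ.filter fun b : Fin m => (b : ℕ) < c) := by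
          ext b
          simp only [Finset.mem_filter, Finset.mem_univ, true_and, Finset.mem_insert, Fin.ext_iff]
          omega
        rw [this, Finset.sum_insert (by simp), add_comm]
      · intro r i j
        rw [hGs]
        have : Finset.Iio (⟨c, hc⟩ : Fin m) = Finset.univ.filter fun b : Fin m => (b : ℕ) < c := by
          ext b
          simp [Fin.lt_def]
        rw [this]
  have := key m le_rfl
  rw [List.take_of_length_le (by simp)] at this
  rw [monodromy, this]
  congr 1
  funext r i j
  rw [Finset.sum_comm, Finset.filter_true_of_mem fun b _ => b.2]
  simp only [hG']

end Coinvariants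


/-! ### The coinvariants of `E_{p,q}(M_μ)` -/

/-- The operators `q_ai` on `H(ℂ^m ⊗ ℂ^n)`, where `s a` tells whether `q_ai` is `∂_ai`
or `x_ai`. -/
noncomputable def fockQ (θ : Statistics) (n : ℕ) {m : ℕ} (s : Fin m → Bool) (a : Fin m)
    (i : Fin n) : Module.End ℂ (HAlg θ m n) :=
  if s a = true then opD θ m n a i else opX θ m n a i

/-- The operators `p_ai` on `H(ℂ^m ⊗ ℂ^n)`, where `s a` tells whether `p_ai` is `-θ x_ai`
or `∂_ai`. -/
noncomputable def fockP (θ : Statistics) (n : ℕ) {m : ℕ} (s : Fin m → Bool) (a : Fin m)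
    (i : Fin n) : Module.End ℂ (HAlg θ m n) :=
  if s a = true then -(θ.sign • opX θ m n a i) else opD θ m n a i

theorem fockQ_fockP_relations (θ : Statistics) (n : ℕ) {m : ℕ} (s : Fin m → Bool) :
    OscillatorRelations θ.sign (fockQ θ n s) (fockP θ n s) :=
  (opX_opD_relations θ m n).twist θ.sign_mul_sign (fun c => s c = true)

theorem coe_hdQ (θ : Statistics) (p q n : ℕ) (c : Fin (p + q)) (i : Fin n) :
    (hdQ θ p q n c i : Module.End ℂ (HAlg θ (p + q) n))
      = fockQ θ n (fun c => decide ((c : ℕ) < p)) c i := by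
  simp only [hdQ, fockQ, decide_eq_true_eq]
  split_ifs <;> rfl

theorem coe_hdP (θ : Statistics) (p q n : ℕ) (c : Fin (p + q)) (i : Fin n) :
    (hdP θ p q n c i : Module.End ℂ (HAlg θ (p + q) n))
      = fockP θ n (fun c => decide ((c : ℕ) < p)) c i := by
  simp only [hdP, fockP, decide_eq_true_eq]
  split_ifs <;> rfl

theorem coe_zetaHom (θ : Statistics) (p q n : ℕ) (a b : Fin (p + q)) :
    (zetaHom θ p q n (glE (p + q) a b) : Module.End ℂ (HAlg θ (p + q) n))
      = zetaE θ.sign (fockQ θ n fun c => decide ((c : ℕ) < p))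
          (fockP θ n fun c => decide ((c : ℕ) < p)) a b := by
  rw [show zetaHom θ p q n (glE (p + q) a b) = _ from Ugl.lift_glE _ _ a b, zetaE, zetaE]
  simp only [← coe_hdQ, ← coe_hdP]
  rw [Subalgebra.coe_add, AddSubmonoidClass.coe_finsetSum]
  split_ifs <;> rfl

section EpqAction

variable (θ : Statistics) (p q n : ℕ) {V : Type} [AddCommGroup V] [Module ℂ V]
    [Module (Ugl (p + q)) V] [IsScalarTower ℂ (Ugl (p + q)) V]

theorem Epq_gl_tmul (a b : Fin (p + q)) (w : V) (h : HAlg θ (p + q) n) :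
    (Epq θ p q n V).gl (glE (p + q) a b) (w ⊗ₜ[ℂ] h : V ⊗[ℂ] HAlg θ (p + q) n)
      = ((glE (p + q) a b • w) ⊗ₜ[ℂ] h
        + w ⊗ₜ[ℂ] zetaE θ.sign (fockQ θ n fun c => decide ((c : ℕ) < p))
          (fockP θ n fun c => decide ((c : ℕ) < p)) a b h : V ⊗[ℂ] HAlg θ (p + q) n) := by
  change tensorAction θ (p + q) n V (glEmbedding θ p q n (glE (p + q) a b)) (w ⊗ₜ[ℂ] h) = _
  rw [show glEmbedding θ p q n (glE (p + q) a b) = _ from Ugl.lift_glE _ _ a b, map_add,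
    LinearMap.add_apply, ← coe_zetaHom]
  change (glE (p + q) a b • w) ⊗ₜ[ℂ] h + ((1 : Ugl (p + q)) • w) ⊗ₜ[ℂ] _ = _
  rw [one_smul]
  rfl

theorem Epq_act_tmul (r : ℕ) (i j : Fin n) (w : V) (h : HAlg θ (p + q) n) :
    (Epq θ p q n V).act (Yangian.gen n r i j) (w ⊗ₜ[ℂ] h : V ⊗[ℂ] HAlg θ (p + q) n)
      = (∑ a, ∑ b, ((Xmat θ.sign (p + q) ^ r) a b • w) ⊗ₜ[ℂ]
          (fockQ θ n (fun c => decide ((c : ℕ) < p)) a i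
            * fockP θ n (fun c => decide ((c : ℕ) < p)) b j) h : V ⊗[ℂ] HAlg θ (p + q) n) := by
  change tensorAction θ (p + q) n V (alphaHom θ p q n (Yangian.gen n r i j)) (w ⊗ₜ[ℂ] h) = _
  rw [show alphaHom θ p q n (Yangian.gen n r i j) = _ from Yangian.lift_gen _ _ r i j]
  simp only [map_sum, LinearMap.sum_apply, ← coe_hdQ, ← coe_hdP]
  rfl

end EpqAction

/-- A projection `φ` with a section `ι` whose image complements `n · E` identifies the coinvariants
of `E` with a given space, and the actions can be computed on the image of `ι`. -/
theorem GlYangianBimodule.projection_of_section {m n : ℕ} (E : GlYangianBimodule m n) {H : Type}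
    [AddCommGroup H] [Module ℂ H] (φ : E.carrier →ₗ[ℂ] H) (ι : H → E.carrier)
    (h1 : ∀ h, φ (ι h) = h) (h2 : ∀ a b t, a < b → φ (E.gl (glE m b a) t) = 0)
    (h3 : ∀ t, t - ι (φ t) ∈ E.lowerSubspace) :
    Function.Surjective φ ∧ LinearMap.ker φ = E.lowerSubspace ∧
      (∀ y t, φ (E.act y t) = φ (E.act y (ι (φ t)))) ∧
      ∀ a t, φ (E.gl (glE m a a) t) = φ (E.gl (glE m a a) (ι (φ t))) := by
  have hlow : E.lowerSubspace ≤ LinearMap.ker φ := by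
    refine Submodule.span_le.2 ?_
    rintro _ ⟨a, b, t, hab, rfl⟩
    exact h2 a b t hab
  have hred : ∀ f : Module.End ℂ E.carrier, E.lowerSubspace ≤ E.lowerSubspace.comap f →
      ∀ t, φ (f t) = φ (f (ι (φ t))) := by
    intro f hf t
    have h := LinearMap.mem_ker.1 (hlow (hf (h3 t)))
    rw [map_sub, map_sub] at h
    exact sub_eq_zero.1 h
  have hz : ι 0 ∈ E.lowerSubspace := by simpa using h3 0
  refine ⟨fun h => ⟨ι h, h1 h⟩, le_antisymm (fun t ht => ?_) hlow,
    fun y => hred _ (E.lowerSubspace_le_act y), fun a => hred _ (E.lowerSubspace_le_cartan a)⟩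
  have h := h3 t
  rw [LinearMap.mem_ker.1 ht] at h
  simpa using add_mem h hz

/-- The coinvariants of `E_{p,q}(M_μ)` are identified with `H(ℂ^m ⊗ ℂ^n)` by a surjection `φ`; on
this space `T(u)` acts as the product of the matrices of the tensor factors. -/
theorem exists_coinvariants_projection (θ : Statistics) (p q n : ℕ) (μ : Fin (p + q) → ℂ) :
    ∃ φ : (Epq θ p q n (Verma (p + q) μ)).carrier →ₗ[ℂ] HAlg θ (p + q) n,
      Function.Surjective φ ∧ LinearMap.ker φ = (Epq θ p q n (Verma (p + q) μ)).lowerSubspace ∧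
      (∀ r i j t, φ ((Epq θ p q n (Verma (p + q) μ)).act (Yangian.gen n r i j) t)
        = PowerSeries.coeff (r + 1) (monodromy (fun c => θ.sign * (μ c - (c : ℕ)))
          (fun c i j => fockQ θ n (fun c => decide ((c : ℕ) < p)) c i
            * fockP θ n (fun c => decide ((c : ℕ) < p)) c j) i j) (φ t)) ∧
      ∀ a t, φ ((Epq θ p q n (Verma (p + q) μ)).gl (glE (p + q) a a) t)
        = μ a • φ t + zetaE θ.sign (fockQ θ n fun c => decide ((c : ℕ) < p))
          (fockP θ n fun c => decide ((c : ℕ) < p)) a a (φ t) := by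
  have hqp := fockQ_fockP_relations θ n fun c : Fin (p + q) => decide ((c : ℕ) < p)
  set Q := fockQ θ n fun c : Fin (p + q) => decide ((c : ℕ) < p)
  set P := fockP θ n fun c : Fin (p + q) => decide ((c : ℕ) < p)
  obtain ⟨φ, hφ1, hφ, hφs⟩ := Verma.exists_coinvariant_map μ (zetaE θ.sign Q P)
    (hqp.zetaE_relations θ.sign_mul_sign)
  obtain ⟨h1, h2, h3, h4⟩ := (Epq θ p q n (Verma (p + q) μ)).projection_of_section φ
    (fun h => vermaVec (p + q) μ ⊗ₜ[ℂ] h) hφ1 (fun a b t hab => by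
      change Verma (p + q) μ ⊗[ℂ] HAlg θ (p + q) n at t
      induction t with
      | zero => exact (congrArg φ (map_zero _)).trans (map_zero φ)
      | add s t hs ht =>
        exact (congrArg φ (map_add _ s t)).trans ((map_add φ _ _).trans ((congrArg₂ (· + ·) hs ht).trans
          (add_zero 0)))
      | tmul w h => exact (congrArg φ (Epq_gl_tmul θ p q n b a w h)).trans (by
          rw [map_add, hφ b a w h hab, neg_add_cancel]))
    (fun t => by
      refine Submodule.span_le.2 ?_ (hφs t)
      rintro _ ⟨a, b, w, h, hba, rfl⟩
      exact Submodule.subset_span ⟨b, a, w ⊗ₜ[ℂ] h, hba, (Epq_gl_tmul θ p q n a b w h).symm⟩)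
  refine ⟨φ, h1, h2, fun r i j t => ?_, fun a t => ?_⟩
  · refine (h3 _ t).trans ((congrArg φ (Epq_act_tmul θ p q n r i j _ (φ t))).trans ?_)
    rw [← transferOp_monodromy θ.sign_mul_sign hqp hφ1 hφ, coeff_seriesMatrix]
    simp only [coeffT, map_sum, LinearMap.sum_apply]
    rfl
  · refine (h4 a t).trans ((congrArg φ (Epq_gl_tmul θ p q n a a _ (φ t))).trans ?_)
    rw [vermaVec_cartan, map_add, hφ1, ← TensorProduct.smul_tmul', map_smul, hφ1]
    rfl


/-! ### The modules for `m = 1` -/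

theorem fockQ_fockP_glRelations (θ : Statistics) (n : ℕ) {m : ℕ} (s : Fin m → Bool) (a : Fin m) :
    GlRelations fun i j : Fin n => fockQ θ n s a i * fockP θ n s a j := by
  intro i j k l
  refine ((fockQ_fockP_relations θ n s).comm θ.sign_mul_sign a a a a i j k l).trans ?_
  simp only [true_and, eq_comm]

theorem Yangian.evaluation_coeffT {A : Type*} [Ring A] [Algebra ℂ A] {n : ℕ}
    (e : Fin n → Fin n → A) (he : GlRelations e) (w : ℂ) (r : ℕ) (i j : Fin n) :
    Yangian.evaluation e he w (coeffT (Yangian.gen n) r i j) = coeffT (evalT w e) r i j := by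
  rw [map_coeffT (Yangian.evaluation e he w)]
  congr 1
  funext r i j
  exact Yangian.lift_gen _ _ r i j

theorem Yangian.commute_evaluation {A : Type*} [Ring A] [Algebra ℂ A] {n : ℕ}
    {e : Fin n → Fin n → A} (he : GlRelations e) (w : ℂ) {a : A} (ha : ∀ i j, Commute a (e i j))
    (y : Yangian n) : Commute a (Yangian.evaluation e he w y) := by
  refine Yangian.commute_of_gen _ _ (fun r i j => ?_) y
  rw [show Yangian.evaluation e he w (Yangian.gen n r i j) = _ from Yangian.lift_gen _ _ r i j]
  exact (ha i j).smul_right _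

/-- The bimodule `H(ℂ^n)` over `gl_1` and `Y(gl_n)` with `T_ij(u) ↦ δ_ij + q_i p_j / (u + w)` and
`E_11 ↦ c + θ n/2 + ∑_k q_k p_k`, where `s` tells whether `q_i` is `∂_i` or `x_i`. -/
noncomputable def fockFactor (θ : Statistics) (n : ℕ) (s : Bool) (w c : ℂ) :
    CartanYangianBimodule 1 n where
  toYangianModule := YangianModule.ofEvaluation (HAlg θ 1 n)
    (fun i j => fockQ θ n (fun _ => s) 0 i * fockP θ n (fun _ => s) 0 j)
    (fockQ_fockP_glRelations θ n _ 0) w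
  cartan _ := (c • (1 : Module.End ℂ (HAlg θ 1 n))
    + zetaE θ.sign (fockQ θ n fun _ => s) (fockP θ n fun _ => s) 0 0 : Module.End ℂ (HAlg θ 1 n))
  cartan_comm _ _ := Commute.refl _
  cartan_act _ y := by
    refine Yangian.commute_evaluation (fockQ_fockP_glRelations θ n (fun _ => s) 0) w
      (fun i j => ?_) y
    refine ((Commute.one_left _).smul_left c).add_left ?_
    rw [commute_iff_eq, ← sub_eq_zero,
      (fockQ_fockP_relations θ n fun _ => s).zetaE_comm_mul θ.sign_mul_sign]
    exact sub_self _

theorem fockFactor_act (θ : Statistics) (n : ℕ) (s : Bool) (w c : ℂ) (r : ℕ) (i j : Fin n)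
    (f : HAlg θ 1 n) : (fockFactor θ n s w c).act (coeffT (Yangian.gen n) r i j) f
      = (coeffT (evalT w fun i j => fockQ θ n (fun _ => s) 0 i * fockP θ n (fun _ => s) 0 j) r i j :
        Module.End ℂ (HAlg θ 1 n)) f :=
  LinearMap.congr_fun (Yangian.evaluation_coeffT _ (fockQ_fockP_glRelations θ n _ 0) w r i j) f

theorem CartanYangianBimodule.Isomorphic.symm {m n : ℕ} {M N : CartanYangianBimodule m n}
    (h : M.Isomorphic N) : N.Isomorphic M := by
  obtain ⟨e, h1, h2⟩ := h
  refine ⟨e.symm, fun a w => ?_, fun y w => ?_⟩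
  · rw [LinearEquiv.symm_apply_eq, h1, LinearEquiv.apply_symm_apply]
  · rw [LinearEquiv.symm_apply_eq, h2, LinearEquiv.apply_symm_apply]

theorem CartanYangianBimodule.Isomorphic.trans {m n : ℕ} {M N P : CartanYangianBimodule m n}
    (h : M.Isomorphic N) (h' : N.Isomorphic P) : M.Isomorphic P := by
  obtain ⟨e, h1, h2⟩ := h
  obtain ⟨f, h3, h4⟩ := h'
  exact ⟨e.trans f, fun a w => by simp only [LinearEquiv.trans_apply, h1, h3],
    fun y w => by simp only [LinearEquiv.trans_apply, h2, h4]⟩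

theorem CartanYangianBimodule.Isomorphic.toYangianModule {m n : ℕ}
    {M N : CartanYangianBimodule m n} (h : M.Isomorphic N) :
    M.toYangianModule.Isomorphic N.toYangianModule := by
  obtain ⟨e, -, h2⟩ := h
  exact ⟨e, h2⟩

theorem GlYangianBimodule.pullShift_act {m n : ℕ} (z : ℂ) (M : GlYangianBimodule m n) (r : ℕ)
    (i j : Fin n) : (M.pullShift z).act (Yangian.gen n r i j)
      = ∑ k ∈ Finset.range (r + 1), (z ^ (r - k) * (r.choose k : ℂ)) • M.act (Yangian.gen n k i j) := by
  change M.act (Yangian.shift n z (Yangian.gen n r i j)) = _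
  rw [show Yangian.shift n z (Yangian.gen n r i j) = _ from Yangian.lift_gen _ _ r i j]
  simp only [map_sum, map_smul]

/-- For `m = 1` the projection to the coinvariants is an isomorphism, and the shift of `u` by `θ z`
turns the factor `u + θ t` into `u + θ (t - z)`. -/
theorem GlYangianBimodule.restrictCartan_pullShift_isomorphic {n : ℕ} (M : GlYangianBimodule 1 n)
    (θ : Statistics) (s : Fin 1 → Bool) (t : Fin 1 → ℂ) (z : ℂ) (φ : M.carrier →ₗ[ℂ] HAlg θ 1 n)
    (hs : Function.Surjective φ) (hk : LinearMap.ker φ = M.lowerSubspace)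
    (ha : ∀ r i j w, φ (M.act (Yangian.gen n r i j) w)
      = PowerSeries.coeff (r + 1) (monodromy (fun c => θ.sign * (t c - (c : ℕ)))
          (fun c i j => fockQ θ n s c i * fockP θ n s c j) i j) (φ w))
    (hc : ∀ a w, φ (M.gl (glE 1 a a) w)
      = t a • φ w + zetaE θ.sign (fockQ θ n s) (fockP θ n s) a a (φ w)) :
    (M.pullShift (θ.sign * z)).restrictCartan.Isomorphic
      (fockFactor θ n (s 0) (θ.sign * (t 0 - z)) (t 0)) := by
  have hs0 : s = fun _ => s 0 := funext fun a => by rw [Subsingleton.elim a 0]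
  have hbot : LinearMap.ker φ = ⊥ := by
    rw [hk, GlYangianBimodule.lowerSubspace, Submodule.span_eq_bot]
    rintro _ ⟨a, b, w, hab, -⟩
    exact absurd hab (by rw [Subsingleton.elim a b]; exact lt_irrefl _)
  let e := LinearEquiv.ofBijective φ ⟨LinearMap.ker_eq_bot.1 hbot, hs⟩
  have h1 : ∀ k i j w, φ (M.act (Yangian.gen n k i j) w) = (-(θ.sign * t 0)) ^ k •
      (fockQ θ n (fun _ => s 0) 0 i * fockP θ n (fun _ => s 0) 0 j :
        Module.End ℂ (HAlg θ 1 n)) (φ w) := by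
    intro k i j w
    rw [ha, monodromy_succ, monodromy_zero, mul_one, coeff_seriesMatrix, ← hs0]
    simp [coeffT, evalT]
  have h2 : ∀ r i j w, φ ((∑ k ∈ Finset.range (r + 1),
      ((θ.sign * z) ^ (r - k) * (r.choose k : ℂ)) • M.act (Yangian.gen n k i j)) w)
      = (-(θ.sign * (t 0 - z))) ^ r •
      (fockQ θ n (fun _ => s 0) 0 i * fockP θ n (fun _ => s 0) 0 j :
        Module.End ℂ (HAlg θ 1 n)) (φ w) := by
    intro r i j w
    simp only [LinearMap.sum_apply, LinearMap.smul_apply, map_sum, map_smul, h1, smul_smul]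
    rw [← Finset.sum_smul, show -(θ.sign * (t 0 - z)) = -(θ.sign * t 0) + θ.sign * z by ring,
      add_pow]
    congr 1
    exact Finset.sum_congr rfl fun k _ => by ring
  refine ⟨e, fun a w => ?_, fun y w => ?_⟩
  · refine (hc a w).trans ?_
    rw [Subsingleton.elim a 0, hs0]
    rfl
  · refine YangianModule.map_act_of_gen (M := (M.pullShift (θ.sign * z)).toYangianModule)
      (N := (fockFactor θ n (s 0) (θ.sign * (t 0 - z)) (t 0)).toYangianModule)
      e.toLinearMap (fun r i j w => ?_) y w
    refine (congrArg (fun f : Module.End ℂ M.carrier => φ (f w))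
      (GlYangianBimodule.pullShift_act (θ.sign * z) M r i j)).trans ((h2 r i j w).trans ?_)
    exact (fockFactor_act θ n (s 0) (θ.sign * (t 0 - z)) (t 0) (r + 1) i j (φ w)).symm

theorem EpqShift_one_zero_isomorphic (θ : Statistics) (n : ℕ) (z t : ℂ) :
    (EpqShift θ 1 0 n z (Verma 1 fun _ => t)).restrictCartan.Isomorphic
      (fockFactor θ n true (θ.sign * (t - z)) t) := by
  obtain ⟨φ, h1, h2, h3, h4⟩ := exists_coinvariants_projection θ 1 0 n fun _ => t
  exact GlYangianBimodule.restrictCartan_pullShift_isomorphic _ θ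
    (fun c : Fin 1 => decide ((c : ℕ) < 1)) (fun _ => t) z φ h1 h2 h3 h4

theorem EpqShift_zero_one_isomorphic (θ : Statistics) (n : ℕ) (z t : ℂ) :
    (EpqShift θ 0 1 n z (Verma 1 fun _ => t)).restrictCartan.Isomorphic
      (fockFactor θ n false (θ.sign * (t - z)) t) := by
  obtain ⟨φ, h1, h2, h3, h4⟩ := exists_coinvariants_projection θ 0 1 n fun _ => t
  exact GlYangianBimodule.restrictCartan_pullShift_isomorphic _ θ
    (fun c : Fin 1 => decide ((c : ℕ) < 0)) (fun _ => t) z φ h1 h2 h3 h4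


/-! ### Decomposition of the Fock space into the tensor factors -/

theorem HAlg.exists_zero_equiv (θ : Statistics) (n : ℕ) : Nonempty (HAlg θ 0 n ≃ₗ[ℂ] ℂ) := by
  obtain ⟨R, hR, -, -⟩ := HAlg.exists_fock_map (θ := θ) (m := 0) (n := n) (W := ℂ)
    (x := fun a => a.elim0) (d := fun a => a.elim0)
    ⟨fun a => a.elim0, fun a => a.elim0, fun a => a.elim0⟩ 1 fun a => a.elim0
  refine ⟨LinearEquiv.ofLinearMap R (LinearMap.toSpanSingleton ℂ _ 1) ?_ ?_⟩
  · refine LinearMap.ext_ring ?_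
    simp [hR]
  · refine LinearMap.ext fun f => ?_
    change R f • 1 = f
    induction f using HAlg.induction with
    | one => rw [hR, one_smul]
    | add f g hf hg => rw [map_add, add_smul, hf, hg]
    | smul c f hf => rw [map_smul, smul_assoc, hf]
    | opX a => exact a.elim0

/-- Under the decomposition of `H(ℂ^(m+1) ⊗ ℂ^n)`, the product of `m + 1` matrices becomes the
tensor product of the first one with the product of the others: the parity operator cancels in
`q_ai p_aj`. -/
theorem HAlg.exists_monodromy_equiv (θ : Statistics) {m : ℕ} (n : ℕ) (s : Fin (m + 1) → Bool)
    (w : Fin (m + 1) → ℂ) : ∃ R : HAlg θ (m + 1) n ≃ₗ[ℂ] HAlg θ 1 n ⊗[ℂ] HAlg θ m n,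
      (∀ r i j f, R (PowerSeries.coeff r
          (monodromy w (fun a i j => fockQ θ n s a i * fockP θ n s a j) i j) f)
        = ∑ k, ∑ x ∈ Finset.HasAntidiagonal.antidiagonal r, TensorProduct.map
          (coeffT (evalT (w 0) fun i j => fockQ θ n (fun _ => s 0) 0 i
            * fockP θ n (fun _ => s 0) 0 j) x.1 i k : Module.End ℂ (HAlg θ 1 n))
          (PowerSeries.coeff x.2 (monodromy (fun a => w a.succ) (fun a i j =>
            fockQ θ n (fun a => s a.succ) a i * fockP θ n (fun a => s a.succ) a j) k j)) (R f)) ∧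
      (∀ f, R (zetaE θ.sign (fockQ θ n s) (fockP θ n s) 0 0 f) = TensorProduct.map
        (zetaE θ.sign (fockQ θ n fun _ => s 0) (fockP θ n fun _ => s 0) 0 0 :
          Module.End ℂ (HAlg θ 1 n)) 1 (R f)) ∧
      ∀ a f, R (zetaE θ.sign (fockQ θ n s) (fockP θ n s) (Fin.succ a) a.succ f)
        = TensorProduct.map 1 (zetaE θ.sign (fockQ θ n fun a => s a.succ)
          (fockP θ n fun a => s a.succ) a a : Module.End ℂ (HAlg θ m n)) (R f) := by
  obtain ⟨R, π, hπ, hx0, hd0, hxs, hds⟩ := HAlg.exists_tensor_equiv θ m n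
  let e := R.conjAlgEquiv ℂ
  have he : ∀ T f, R (T f) = e T (R f) := fun T f => by
    simp [e, LinearEquiv.conjAlgEquiv_apply]
  have heq : ∀ {T T'}, (∀ f, R (T f) = T' (R f)) → e T = T' := fun {T T'} h =>
    LinearMap.ext fun g => by
      obtain ⟨f, rfl⟩ := R.surjective g
      rw [← he, h]
  have hX0 : ∀ i, e (opX θ (m + 1) n 0 i) = TensorProduct.map (opX θ 1 n 0 i) 1 :=
    fun i => heq (hx0 i)
  have hD0 : ∀ i, e (opD θ (m + 1) n 0 i) = TensorProduct.map (opD θ 1 n 0 i) 1 :=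
    fun i => heq (hd0 i)
  have hXs : ∀ a i, e (opX θ (m + 1) n (Fin.succ a) i) = TensorProduct.map π (opX θ m n a i) :=
    fun a i => heq (hxs a i)
  have hDs : ∀ a i, e (opD θ (m + 1) n (Fin.succ a) i) = TensorProduct.map π (opD θ m n a i) :=
    fun a i => heq (hds a i)
  have hQ0 : ∀ i, e (fockQ θ n s 0 i) = TensorProduct.map (fockQ θ n (fun _ => s 0) 0 i) 1 := by
    intro i; simp only [fockQ]; split_ifs <;> simp only [hX0, hD0]
  have hP0 : ∀ i, e (fockP θ n s 0 i) = TensorProduct.map (fockP θ n (fun _ => s 0) 0 i) 1 := by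
    intro i; simp only [fockP]; split_ifs
    · rw [map_neg, map_smul, hX0]
      exact TensorProduct.ext' fun v w => by simp [TensorProduct.neg_tmul, TensorProduct.smul_tmul']
    · exact hD0 i
  have hQs : ∀ a i, e (fockQ θ n s (Fin.succ a) i)
      = TensorProduct.map π (fockQ θ n (fun a => s a.succ) a i) := by
    intro a i; simp only [fockQ]; split_ifs <;> simp only [hXs, hDs]
  have hPs : ∀ a i, e (fockP θ n s (Fin.succ a) i)
      = TensorProduct.map π (fockP θ n (fun a => s a.succ) a i) := by
    intro a i; simp only [fockP]; split_ifs
    · rw [map_neg, map_smul, hXs]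
      exact TensorProduct.ext' fun v w => by simp [TensorProduct.tmul_neg]
    · exact hDs a i
  let σ₀ := Module.End.rTensorAlgHom ℂ (HAlg θ 1 n) (HAlg θ m n)
  let σ₁ := Module.End.lTensorAlgHom ℂ (HAlg θ m n) (HAlg θ 1 n)
  have hσ : ∀ A B, σ₀ A * σ₁ B = TensorProduct.map A B := fun A B =>
    TensorProduct.ext' fun _ _ => rfl
  have h0 : ∀ i j, e (fockQ θ n s 0 i * fockP θ n s 0 j)
      = σ₀ (fockQ θ n (fun _ => s 0) 0 i * fockP θ n (fun _ => s 0) 0 j) := by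
    intro i j
    rw [map_mul, hQ0, hP0, map_mul]
    rfl
  have h1 : ∀ a i j, e (fockQ θ n s (Fin.succ a) i * fockP θ n s a.succ j)
      = σ₁ (fockQ θ n (fun a => s a.succ) a i * fockP θ n (fun a => s a.succ) a j) := by
    intro a i j
    rw [map_mul, hQs, hPs, ← TensorProduct.map_mul, hπ]
    rfl
  have hz : ∀ a (Z : Module.End ℂ (HAlg θ 1 n ⊗[ℂ] HAlg θ m n)),
      algebraMap ℂ _ (θ.sign * (n / 2)) + ∑ k, e (fockQ θ n s a k * fockP θ n s a k) = Z →
      ∀ f, R (zetaE θ.sign (fockQ θ n s) (fockP θ n s) a a f) = Z (R f) := by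
    intro a Z hZ f
    rw [he, ← hZ, zetaE, if_pos rfl, map_add, map_sum, AlgEquiv.commutes]
  refine ⟨R, fun r i j f => ?_, hz 0 _ ?_, fun a => hz a.succ _ ?_⟩
  · have hmon := monodromy_map (e : Module.End ℂ (HAlg θ (m + 1) n) →ₐ[ℂ]
        Module.End ℂ (HAlg θ 1 n ⊗[ℂ] HAlg θ m n)) w
      (fun a i j => fockQ θ n s a i * fockP θ n s a j)
    have hc := congrArg (fun A => PowerSeries.coeff r (A i j)) hmon
    simp only [RingHom.mapMatrix_apply, Matrix.map_apply, PowerSeries.coeff_map] at hc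
    rw [he]
    refine (LinearMap.congr_fun hc (R f)).symm.trans ?_
    rw [monodromy_succ]
    simp only [AlgEquiv.coe_toAlgHom, h0, h1]
    rw [monodromy_map σ₁, Matrix.mul_apply, map_sum, LinearMap.sum_apply]
    refine Finset.sum_congr rfl fun k _ => ?_
    rw [PowerSeries.coeff_mul, LinearMap.sum_apply]
    refine Finset.sum_congr rfl fun x _ => ?_
    rw [coeff_seriesMatrix, RingHom.mapMatrix_apply, Matrix.map_apply, PowerSeries.coeff_map]
    have h2 : coeffT (evalT (w 0) fun i j => σ₀ (fockQ θ n (fun _ => s 0) 0 i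
          * fockP θ n (fun _ => s 0) 0 j)) x.1 i k
        = σ₀ (coeffT (evalT (w 0) fun i j => fockQ θ n (fun _ => s 0) 0 i
          * fockP θ n (fun _ => s 0) 0 j) x.1 i k) := by
      rw [map_coeffT σ₀]
      simp only [evalT, map_smul]
      rfl
    rw [h2]
    exact congrArg (fun T : Module.End ℂ (HAlg θ 1 n ⊗[ℂ] HAlg θ m n) => T (R f)) (hσ _ _)
  · simp only [h0]
    rw [← σ₀.commutes, ← map_sum, ← map_add, zetaE, if_pos rfl]
    rfl
  · simp only [h1]
    rw [← σ₁.commutes, ← map_sum, ← map_add, zetaE, if_pos rfl]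
    rfl

/-- The Fock space `H(ℂ^m ⊗ ℂ^n)` is the tensor product of the bimodules for `m = 1`. -/
theorem exists_tensorFamily_equiv (θ : Statistics) (n : ℕ) : ∀ (m : ℕ) (s : Fin m → Bool)
    (w c : Fin m → ℂ), ∃ Λ : HAlg θ m n ≃ₗ[ℂ]
        (CartanYangianBimodule.tensorFamily m fun a => fockFactor θ n (s a) (w a) (c a)).carrier,
      (∀ r i j f, Λ (PowerSeries.coeff r
          (monodromy w (fun a i j => fockQ θ n s a i * fockP θ n s a j) i j) f)
        = (CartanYangianBimodule.tensorFamily m fun a => fockFactor θ n (s a) (w a) (c a)).act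
          (coeffT (Yangian.gen n) r i j) (Λ f)) ∧
      ∀ a f, Λ (c a • f + zetaE θ.sign (fockQ θ n s) (fockP θ n s) a a f)
        = (CartanYangianBimodule.tensorFamily m fun a =>
          fockFactor θ n (s a) (w a) (c a)).cartan a (Λ f)
  | 0, s, w, c => by
    obtain ⟨R⟩ := HAlg.exists_zero_equiv θ n
    refine ⟨R, fun r i j f => ?_, fun a => a.elim0⟩
    refine Eq.trans ?_ (LinearMap.congr_fun
      (YangianModule.trivial_actsByScalars n r i j) (R f : ℂ)).symm
    rw [monodromy_zero, Matrix.one_apply]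
    split_ifs
    · rw [PowerSeries.coeff_one]
      rcases r with _ | r
      · exact (one_smul ℂ (R f)).symm
      · exact (map_zero R).trans (zero_smul ℂ (R f)).symm
    · exact map_zero R
  | m + 1, s, w, c => by
    obtain ⟨Λ, h1, h2⟩ := exists_tensorFamily_equiv θ n m (fun a => s a.succ)
      (fun a => w a.succ) (fun a => c a.succ)
    obtain ⟨R, h3, h4, h5⟩ := HAlg.exists_monodromy_equiv θ n s w
    let M := fockFactor θ n (s 0) (w 0) (c 0)
    let N := CartanYangianBimodule.tensorFamily m fun a : Fin m =>
      fockFactor θ n (s a.succ) (w a.succ) (c a.succ)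
    let C : HAlg θ 1 n ⊗[ℂ] HAlg θ m n ≃ₗ[ℂ] M.carrier ⊗[ℂ] N.carrier :=
      TensorProduct.congr (LinearEquiv.refl ℂ (HAlg θ 1 n)) Λ
    have hC : ∀ v w, C (v ⊗ₜ[ℂ] w) = (v : M.carrier) ⊗ₜ[ℂ] Λ w := fun v w => rfl
    have hact : ∀ r i j t, C ((∑ k, ∑ x ∈ Finset.HasAntidiagonal.antidiagonal r, TensorProduct.map
          (coeffT (evalT (w 0) fun i j => fockQ θ n (fun _ => s 0) 0 i
            * fockP θ n (fun _ => s 0) 0 j) x.1 i k : Module.End ℂ (HAlg θ 1 n))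
          (PowerSeries.coeff x.2 (monodromy (fun a => w a.succ) (fun a i j =>
            fockQ θ n (fun a => s a.succ) a i * fockP θ n (fun a => s a.succ) a j) k j)) :
              Module.End ℂ _) t)
        = (M.toYangianModule.tensor N.toYangianModule).act (coeffT (Yangian.gen n) r i j) (C t) := by
      intro r i j
      refine LinearMap.congr_fun (f := C.toLinearMap ∘ₗ ∑ k,
          ∑ x ∈ Finset.HasAntidiagonal.antidiagonal r, TensorProduct.map _ _)
        (g := (M.toYangianModule.tensor N.toYangianModule).act (coeffT (Yangian.gen n) r i j)
          ∘ₗ C.toLinearMap) (TensorProduct.ext' fun v u => ?_)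
      refine Eq.trans ?_ (YangianModule.tensor_act_coeffT M.toYangianModule N.toYangianModule
        r i j v (Λ u)).symm
      rw [LinearMap.comp_apply, LinearEquiv.coe_coe]
      simp only [LinearMap.sum_apply, map_sum, TensorProduct.map_tmul, hC]
      refine Finset.sum_congr rfl fun k _ => Finset.sum_congr rfl fun x _ => ?_
      exact congrArg₂ (fun v u => v ⊗ₜ[ℂ] u) (fockFactor_act θ n (s 0) (w 0) (c 0) x.1 i k v).symm
        (h1 x.2 k j u)
    refine ⟨R.trans C, fun r i j f => ?_, fun a f => ?_⟩
    · refine Eq.trans ?_ (hact r i j (R f))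
      refine (congrArg C (h3 r i j f)).trans ?_
      simp only [LinearMap.sum_apply]
    · refine Fin.cases ?_ (fun a => ?_) a
      · refine (congrArg C ((map_add R _ _).trans (congrArg₂ (· + ·) (map_smul R (c 0) f)
          (h4 f)))).trans ?_
        refine LinearMap.congr_fun (f := C.toLinearMap ∘ₗ (c 0 • LinearMap.id + TensorProduct.map _ 1))
          (g := (M.cartan 0).rTensor N.carrier ∘ₗ C.toLinearMap)
          (TensorProduct.ext' fun v u => ?_) (R f)
        rw [LinearMap.comp_apply, LinearMap.add_apply, LinearMap.smul_apply, LinearMap.id_apply,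
          TensorProduct.map_tmul, TensorProduct.smul_tmul', Module.End.one_apply,
          ← TensorProduct.add_tmul]
        rfl
      · refine (congrArg C ((map_add R _ _).trans (congrArg₂ (· + ·) (map_smul R (c a.succ) f)
          (h5 a f)))).trans ?_
        refine LinearMap.congr_fun
          (f := C.toLinearMap ∘ₗ (c a.succ • LinearMap.id + TensorProduct.map 1 _))
          (g := (N.cartan a).lTensor M.carrier ∘ₗ C.toLinearMap)
          (TensorProduct.ext' fun v u => ?_) (R f)
        rw [LinearMap.comp_apply, LinearMap.add_apply, LinearMap.smul_apply, LinearMap.id_apply,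
          TensorProduct.map_tmul, ← TensorProduct.tmul_smul, Module.End.one_apply,
          ← TensorProduct.tmul_add]
        exact congrArg (fun u : N.carrier => (v : M.carrier) ⊗ₜ[ℂ] u) (h2 a u)


/-! ### The coinvariants as a tensor product -/

theorem CartanYangianBimodule.tensorFamily_congr {n m : ℕ} {F G : Fin m → CartanYangianBimodule 1 n}
    (h : ∀ a, (F a).Isomorphic (G a)) : (tensorFamily m F).Isomorphic (tensorFamily m G) := by
  induction m with
  | zero => exact ⟨LinearEquiv.refl ℂ _, fun a => a.elim0, fun _ _ => rfl⟩
  | succ m ih =>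
    obtain ⟨e, he1, he2⟩ := h 0
    obtain ⟨f, hf1, hf2⟩ := ih fun a => h a.succ
    refine ⟨TensorProduct.congr e f, fun a w => ?_, fun y w =>
      YangianModule.tensor_congr_act e f he2 hf2 y w⟩
    refine Fin.cases ?_ (fun a => ?_) a
    · refine LinearMap.congr_fun (f := (TensorProduct.congr e f).toLinearMap
          ∘ₗ ((F 0).cartan 0).rTensor (tensorFamily m fun a => F a.succ).carrier)
        (g := ((G 0).cartan 0).rTensor (tensorFamily m fun a => G a.succ).carrier
          ∘ₗ (TensorProduct.congr e f).toLinearMap) (TensorProduct.ext' fun v w => ?_) w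
      exact congrArg (fun v => v ⊗ₜ[ℂ] f w) (he1 0 v)
    · refine LinearMap.congr_fun (f := (TensorProduct.congr e f).toLinearMap
          ∘ₗ ((tensorFamily m fun a => F a.succ).cartan a).lTensor (F 0).carrier)
        (g := ((tensorFamily m fun a => G a.succ).cartan a).lTensor (G 0).carrier
          ∘ₗ (TensorProduct.congr e f).toLinearMap) (TensorProduct.ext' fun v w => ?_) w
      exact congrArg (fun w => e v ⊗ₜ[ℂ] w) (hf1 a w)

theorem CartanYangianBimodule.toYangianModule_tensorFamily {n : ℕ} {m : ℕ}
    (F : Fin m → CartanYangianBimodule 1 n) : (tensorFamily m F).toYangianModule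
      = YangianModule.tensorFamily m fun a => (F a).toYangianModule := by
  induction m with
  | zero => rfl
  | succ m ih => exact congrArg (F 0).toYangianModule.tensor (ih fun a => F a.succ)

/-- The coinvariants of `E_{p,q}(M_μ)` are the tensor product of the modules for `m = 1`. -/
theorem coinvariants_isomorphic_fockFactor (θ : Statistics) (p q n : ℕ) (μ : Fin (p + q) → ℂ) :
    (Epq θ p q n (Verma (p + q) μ)).coinvariants.Isomorphic
      (CartanYangianBimodule.tensorFamily (p + q) fun a =>
        fockFactor θ n (decide ((a : ℕ) < p)) (θ.sign * (μ a - (a : ℕ))) (μ a)) := by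
  obtain ⟨φ, hs, hk, ha, hc⟩ := exists_coinvariants_projection θ p q n μ
  obtain ⟨Λ, hΛa, hΛc⟩ := exists_tensorFamily_equiv θ n (p + q) (fun a => decide ((a : ℕ) < p))
    (fun a => θ.sign * (μ a - (a : ℕ))) μ
  let e : (Epq θ p q n (Verma (p + q) μ)).coinvariants.carrier ≃ₗ[ℂ] _ :=
    ((Submodule.quotEquivOfEq _ _ hk.symm).trans (φ.quotKerEquivOfSurjective hs)).trans Λ
  refine ⟨e, fun a w => ?_, YangianModule.map_act_of_gen
    (M := (Epq θ p q n (Verma (p + q) μ)).coinvariants.toYangianModule)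
    (N := (CartanYangianBimodule.tensorFamily (p + q) fun a =>
      fockFactor θ n (decide ((a : ℕ) < p)) (θ.sign * (μ a - (a : ℕ))) (μ a)).toYangianModule)
    e.toLinearMap fun r i j w => ?_⟩
  · obtain ⟨t, rfl⟩ := Submodule.Quotient.mk_surjective _ w
    exact (congrArg Λ (hc a t)).trans (hΛc a (φ t))
  · obtain ⟨t, rfl⟩ := Submodule.Quotient.mk_surjective _ w
    exact (congrArg Λ (ha r i j t)).trans (hΛa (r + 1) i j (φ t))

/-! ### The standard modules -/

theorem ofEvaluation_scalar_actsByScalars {n : ℕ} (c w : ℂ)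
    (he : GlRelations fun i j : Fin n => if i = j then algebraMap ℂ (Module.End ℂ ℂ) c else 0) :
    (YangianModule.ofEvaluation ℂ _ he w).ActsByScalars fun
      | 0 => 1
      | r + 1 => c * (-w) ^ r := by
  intro r i j
  refine (Yangian.evaluation_coeffT (A := Module.End ℂ ℂ) _ he w r i j).trans ?_
  cases r with
  | zero =>
    exact congrArg (fun T : Module.End ℂ ℂ => if i = j then T else 0)
      (map_one (algebraMap ℂ (Module.End ℂ ℂ))).symm
  | succ r =>
    change (-w) ^ r • (if i = j then algebraMap ℂ (Module.End ℂ ℂ) c else 0)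
      = if i = j then algebraMap ℂ (Module.End ℂ ℂ) (c * (-w) ^ r) else 0
    rw [smul_ite, smul_zero, Algebra.smul_def, ← map_mul, mul_comm]

theorem OmegaStar_actsByScalars (θ : Statistics) (n : ℕ) (w : ℂ) :
    (OmegaStar θ n w).ActsByScalars fun
      | 0 => 1
      | r + 1 => -θ.sign * (-w) ^ r := by
  have key : ∀ (c : ℂ) (T : Module.End ℂ ℂ), algebraMap ℂ _ c = T →
      ∀ he : GlRelations (n := n) fun i j => if i = j then T else 0,
      (YangianModule.ofEvaluation ℂ _ he w).ActsByScalars fun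
        | 0 => 1
        | r + 1 => c * (-w) ^ r := by
    rintro c _ rfl he
    exact ofEvaluation_scalar_actsByScalars c w he
  cases θ with
  | commuting => exact key (-1) (-1) (by simp) _
  | anticommuting => exact key (- -1) 1 (by simp) _

theorem OmegaStar_equiv (θ : Statistics) (n : ℕ) (w : ℂ) :
    Nonempty ((OmegaStar θ n w).carrier ≃ₗ[ℂ] ℂ) := by
  cases θ
  · exact ⟨LinearEquiv.refl ℂ ℂ⟩
  · exact ⟨LinearEquiv.refl ℂ ℂ⟩

/-- Tensoring with a one-dimensional module multiplies `T(u)` by a scalar series. -/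
theorem YangianModule.ActsByScalars.tensor_isomorphic {n : ℕ} {O N P : YangianModule n} {c : ℕ → ℂ}
    (h : O.ActsByScalars c) (u : O.carrier ≃ₗ[ℂ] ℂ) (f : N.carrier ≃ₗ[ℂ] P.carrier)
    (hf : ∀ r i j v, f (∑ x ∈ Finset.HasAntidiagonal.antidiagonal r,
        c x.1 • N.act (coeffT (Yangian.gen n) x.2 i j) v)
      = P.act (coeffT (Yangian.gen n) r i j) (f v)) : (O.tensor N).Isomorphic P := by
  let e : O.carrier ⊗[ℂ] N.carrier ≃ₗ[ℂ] P.carrier :=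
    (TensorProduct.congr u f).trans (TensorProduct.lid ℂ P.carrier)
  have he : ∀ a v, e (a ⊗ₜ[ℂ] v) = u a • f v := fun a v => by simp [e]
  refine ⟨e, YangianModule.map_act_of_coeffT (M := O.tensor N) (N := P) e.toLinearMap
    fun r i j w => ?_⟩
  refine LinearMap.congr_fun (f := e.toLinearMap ∘ₗ (O.tensor N).act (coeffT (Yangian.gen n) r i j))
    (g := P.act (coeffT (Yangian.gen n) r i j) ∘ₗ e.toLinearMap) (TensorProduct.ext' fun a v => ?_) w
  refine (congrArg e (h.tensor_left N r i j a v)).trans ?_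
  change _ = P.act (coeffT (Yangian.gen n) r i j) (e (a ⊗ₜ[ℂ] v))
  rw [map_sum, he, map_smul, ← hf, map_sum, Finset.smul_sum]
  exact Finset.sum_congr rfl fun x _ => he a _

/-- The product of `(u + w - σ) / (u + w)` and `1 / (u + w - σ)` is `1 / (u + w)`. -/
theorem sum_antidiagonal_geometric (σ w : ℂ) (r : ℕ) {c : ℕ → ℂ} (h0 : c 0 = 1)
    (h1 : ∀ r, c (r + 1) = -σ * (-w) ^ r) :
    ∑ x ∈ Finset.HasAntidiagonal.antidiagonal r, c x.1 * (-(w - σ)) ^ x.2 = (-w) ^ r := by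
  induction r with
  | zero => simp [h0]
  | succ r ih =>
    rw [Finset.Nat.sum_antidiagonal_succ', h1]
    simp only [pow_succ, ← mul_assoc, ← Finset.sum_mul, ih]
    ring

theorem sum_smul_coeffT_evalT {A : Type*} [Ring A] [Algebra ℂ A] {n : ℕ} (σ w : ℂ) {c : ℕ → ℂ}
    (h0 : c 0 = 1) (h1 : ∀ r, c (r + 1) = -σ * (-w) ^ r) (e : Fin n → Fin n → A) (r : ℕ)
    (i j : Fin n) :
    ∑ x ∈ Finset.HasAntidiagonal.antidiagonal r, c x.1 • coeffT (evalT (w - σ) e) x.2 i j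
      = coeffT (evalT w fun i j => e i j - if i = j then σ • 1 else 0) r i j := by
  cases r with
  | zero => simp [coeffT, h0]
  | succ r =>
    rw [Finset.Nat.sum_antidiagonal_succ', h1]
    simp only [coeffT, evalT, smul_smul, ← Finset.sum_smul]
    rw [sum_antidiagonal_geometric σ w r h0 h1, smul_sub, add_comm, sub_eq_add_neg]
    congr 1
    split_ifs
    · rw [smul_smul, ← neg_smul]
      congr 1
      ring
    · simp

/-- The oscillator relation `q_i p_j = -∂_i (θ x_j) = -x_j ∂_i - θ δ_ij` factors
`δ_ij + q_i p_j / (u + w)` into `(u + w - θ) / (u + w)` and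
`δ_ij - x_j ∂_i / (u + w - θ)`. -/
theorem fockFactor_true_isomorphic (θ : Statistics) (n : ℕ) (z c : ℂ) :
    (fockFactor θ n true (θ.sign * z) c).toYangianModule.Isomorphic
      ((OmegaStar θ n (θ.sign * z)).tensor (PhiPrime θ n z)) := by
  obtain ⟨u⟩ := OmegaStar_equiv θ n (θ.sign * z)
  have hqp : ∀ i j, fockQ θ n (fun _ : Fin 1 => true) 0 i * fockP θ n (fun _ => true) 0 j
      = -(opX θ 1 n 0 j * opD θ 1 n 0 i) - if i = j then θ.sign • 1 else 0 := by
    intro i j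
    have h := eq_add_of_sub_eq ((opX_opD_relations θ 1 n).pq 0 0 i j)
    simp only [fockQ, fockP, if_true, mul_neg, mul_smul_comm, h, smul_add, smul_smul,
      θ.sign_mul_sign, one_smul, true_and, smul_ite, smul_zero]
    abel
  refine ((OmegaStar_actsByScalars θ n (θ.sign * z)).tensor_isomorphic u
    (LinearEquiv.refl ℂ (HAlg θ 1 n)) (fun r i j v => ?_)).symm
  refine Eq.trans ?_ (fockFactor_act θ n true (θ.sign * z) c r i j v).symm
  have hN : ∀ s, (PhiPrime θ n z).act (coeffT (Yangian.gen n) s i j)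
      = (coeffT (evalT (θ.sign * z - θ.sign) fun i j => -(opX θ 1 n 0 j * opD θ 1 n 0 i)) s i j :
        Module.End ℂ (HAlg θ 1 n)) := by
    intro s
    rw [show θ.sign * z - θ.sign = θ.sign * (z - 1) by ring]
    exact Yangian.evaluation_coeffT (A := Module.End ℂ (HAlg θ 1 n)) _ _ _ s i j
  have h := fun v : HAlg θ 1 n => LinearMap.congr_fun (sum_smul_coeffT_evalT θ.sign (θ.sign * z)
    (c := fun
      | 0 => 1
      | r + 1 => -θ.sign * (-(θ.sign * z)) ^ r) rfl (fun _ => rfl)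
    (fun i j => -(opX θ 1 n 0 j * opD θ 1 n 0 i)) r i j) v
  simp only [LinearMap.sum_apply] at h
  simp only [hN, hqp]
  exact h v

theorem fockFactor_false_isomorphic (θ : Statistics) (n : ℕ) (z c : ℂ) :
    (fockFactor θ n false (θ.sign * z) c).toYangianModule.Isomorphic (Phi θ n z) :=
  YangianModule.Isomorphic.of_eq rfl

/-- The coinvariants as a module over the Yangian. The cocentral factors are collected on the
left. -/
theorem coinvariants_isomorphic_standard (θ : Statistics) (p q n : ℕ) (μ : Fin (p + q) → ℂ) :
    (Epq θ p q n (Verma (p + q) μ)).coinvariants.toYangianModule.Isomorphic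
      (((YangianModule.tensorFamily p fun a =>
            OmegaStar θ n (θ.sign * (μ (Fin.castAdd q a) - (a : ℕ)))).tensor
          (YangianModule.tensorFamily p fun a =>
            PhiPrime θ n (μ (Fin.castAdd q a) - (a : ℕ)))).tensor
        (YangianModule.tensorFamily q fun b =>
          Phi θ n (μ (Fin.natAdd p b) - ((p + b : ℕ) : ℂ)))) := by
  -- `tensorFamily_add` is about families indexed by `ℕ`; the values `ν k`, `k ≥ p + q`, are not used
  obtain ⟨ν, hν⟩ : ∃ ν : ℕ → ℂ, ∀ a : Fin (p + q), ν a = μ a :=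
    ⟨fun k => if h : k < p + q then μ ⟨k, h⟩ else 0, fun a => dif_pos a.2⟩
  have h := (coinvariants_isomorphic_fockFactor θ p q n μ).toYangianModule
  rw [CartanYangianBimodule.toYangianModule_tensorFamily] at h
  simp only [← hν] at h ⊢
  refine h.trans ((YangianModule.tensorFamily_add (fun k => (fockFactor θ n (decide (k < p))
    (θ.sign * (ν k - k)) (ν k)).toYangianModule) p q).trans ?_)
  refine YangianModule.Isomorphic.tensor_congr ?_ (YangianModule.tensorFamily_congr fun b => ?_)
  · refine YangianModule.Isomorphic.trans (YangianModule.tensorFamily_congr fun a => ?_)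
      (YangianModule.tensorFamily_tensor fun a => (OmegaStar_actsByScalars θ n _).isCocentral)
    rw [decide_eq_true a.2]
    exact fockFactor_true_isomorphic θ n _ _
  · rw [decide_eq_false (by omega)]
    exact fockFactor_false_isomorphic θ n _ _

end RationalYangian

open RationalYangian in
theorem corollary2p2 (θ : Statistics) (p q n : ℕ) (μ : Fin (p + q) → ℂ) :
    CartanYangianBimodule.Isomorphic
      (Epq θ p q n (Verma (p + q) μ)).coinvariants
      (CartanYangianBimodule.tensorFamily (p + q) fun a =>
        if (a : ℕ) < p then
          (EpqShift θ 1 0 n (a : ℕ) (Verma 1 fun _ => μ a)).restrictCartan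
        else
          (EpqShift θ 0 1 n (a : ℕ) (Verma 1 fun _ => μ a)).restrictCartan) ∧
    YangianModule.Isomorphic
      (Epq θ p q n (Verma (p + q) μ)).coinvariants.toYangianModule
      (((YangianModule.tensorFamily p fun a =>
            OmegaStar θ n (θ.sign * (μ (Fin.castAdd q a) - (a : ℕ)))).tensor
          (YangianModule.tensorFamily p fun a =>
            PhiPrime θ n (μ (Fin.castAdd q a) - (a : ℕ)))).tensor
        (YangianModule.tensorFamily q fun b =>
          Phi θ n (μ (Fin.natAdd p b) - ((p + b : ℕ) : ℂ)))) ∧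
    ∀ z : ℂ, (OmegaStar θ n z).IsCocentral := by
  refine ⟨?_, coinvariants_isomorphic_standard θ p q n μ,
    fun z => (OmegaStar_actsByScalars θ n z).isCocentral⟩
  refine (coinvariants_isomorphic_fockFactor θ p q n μ).trans
    (CartanYangianBimodule.tensorFamily_congr fun a => ?_)
  split_ifs with h
  · rw [decide_eq_true h]
    exact (EpqShift_one_zero_isomorphic θ n (a : ℕ) (μ a)).symm
  · rw [decide_eq_false h]
    exact (EpqShift_zero_one_isomorphic θ n (a : ℕ) (μ a)).symm
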